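/- **Setting.** Units $8\pi G=c=1$. Consider orthogonal, spatially homogeneous models with metric $ds^2=-dt^2+h_{ab}(t)\,W^aW^b$ on $I\times U$, where $I$ is an open interval, $U$ is a connected coordinate patch of the spatial sections, $h_{ab}(t)$ is a general (not necessarily diagonal) positive definite matrix and $W^a$ is the coframe of a smooth frame $E_a$ on $U$. Either the model is a Bianchi model, $[E_a,E_b]=-C_{ab}{}^{c}E_c$ with constants $C_{ab}{}^{c}=\epsilon_{abe}N^{ec}+A_a\delta_b^c-A_b\delta_a^c$, $N^{ab}=N^{ba}$, or it is a Kantowski–Sachs model, $-dt^2+A(t)^2dx^2+B(t)^2(dy^2+\sin^2\! y\,dz^2)$. The model contains finitely many comoving perfect fluids, with total energy density $\rho$ and pressure $P$ (nothing is assumed about their sign or equation of state), and $n$ free $p$-form gauge fields with $p\in\{0,1,2,3\}$ (each field may have its own $p$), with field strengths $F^{(\ell)}$ that are $(p+1)$-forms with components depending only on $t$ in the frame $(\partial_t,E_a)$, with actions $-\frac{\alpha_\ell}{2}\int F^{(\ell)}\wedge\star F^{(\ell)}$ for real constants $\alpha_\ell\neq0$ of either sign, with field equations $dF^{(\ell)}=0$,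 $d\star F^{(\ell)}=0$ and energy-momentum tensors $$T^{(\ell)}_{\mu\nu}=\alpha_\ell\Big(\tfrac1{p!}F_\mu{}^{\beta_1\dots\beta_p}F_{\nu\beta_1\dots\beta_p}-\tfrac1{2(p+1)!}\,g_{\mu\nu}F^{\beta_1\dots\beta_{p+1}}F_{\beta_1\dots\beta_{p+1}}\Big).$$ Such a model is a *shear-free solution* if Einstein's equations, the conservation law $\dot\rho+3H(\rho+P)=0$ and the gauge field equations hold, every gauge field has zero energy flux ($T^{(\ell)}_{0a}=0$), the traceless three-dimensional Ricci tensor ${}^3S_{ab}$ of the spatial sections does not vanish identically, the congruence $u=\partial_t$ has vanishing shear, and the model is not static: the Hubble scalar $H=\frac13\nabla_\mu u^\mu$ is not identically zero. The Hamiltonian of the $\ell$-th gauge field is *bounded from below* if its Hamiltonian density in a local Lorentz frame (the canonical one without the gauge dependent term that is removed by the Belinfante procedure) is bounded from below over all values of the field strength. Bianchi type III means that $N^{ab}=\mathrm{diag}(0,1,-1)$, $A_a=(1,0,0)$ in a suitable basis, $N^a{}_a=h_{ab}N^{ab}$, and LRS means that around every point there is a local Killing field leaving $u$ invariant that is an infinitesimal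 rotation about that point. **Theorem (boundedness of the Hamiltonian).** The LRS Bianchi type III spacetime with $N^a{}_a=0$ is the unique spacetime in this class that admits shear-free solutions in which the Hamiltonian of each gauge field is bounded from below. That is: 1. Every shear-free solution in which the Hamiltonian of each gauge field is bounded from below is a Bianchi type III model with $N^a{}_a=0$ and is LRS. 2. Conversely, for every $n\ge1$ and every Bianchi type III frame and constant positive definite matrix $\hat h_{ab}$ with $\hat h_{ab}N^{ab}=0$ there is a shear-free solution with $h_{ab}(t)=a(t)^2\hat h_{ab}$, $a>0$, and with $n$ nowhere vanishing gauge fields whose Hamiltonians are all bounded from below. Such frames and matrices exist. 3. For each of the theories ($p\in\{0,1,2,3\}$, any real prefactor $\alpha$) the Hamiltonian is bounded from below if and only if the weak energy condition $T_{\mu\nu}V^\mu V^\nu\ge0$ holds for all values of the field strength and all timelike vectors $V$. 4. In every shear-free solution that is not an LRS Bianchi type III model with $N^a{}_a=0$, at least one gauge field has negative energy density, as seen by the comoving observers, somewhere. -/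

import Mathlib

open scoped ContDiff Matrix

noncomputable section

namespace ShearFree

/-! Tensor calculus in a moving frame on an open subset of `ℝⁿ`. -/

section Frame

variable {n : ℕ}

/-- Points of (and tangent vectors to) `ℝⁿ`. -/
abbrev Pt (n : ℕ) : Type := Fin n → ℝ

/-- Derivative of a function along the `μ`-th vector field of a frame, `e_μ(f)`. -/
def frameDeriv (e : Fin n → Pt n → Pt n) (f : Pt n → ℝ) (μ : Fin n) (x : Pt n) : ℝ :=
  fderiv ℝ f x (e μ x)

/-- The components `v^κ` of a vector, `v = v^κ e_κ(x)`. -/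
def frameCoord (e : Fin n → Pt n → Pt n) (x v : Pt n) (κ : Fin n) : ℝ :=
  ((Matrix.of fun i j => e j x i)⁻¹ *ᵥ v) κ

/-- The commutation functions `[e_μ, e_ν] = D_{μν}^κ e_κ`. -/
def commCoeff (e : Fin n → Pt n → Pt n) (μ ν κ : Fin n) (x : Pt n) : ℝ :=
  frameCoord e x (VectorField.lieBracket ℝ (e μ) (e ν) x) κ

/-- The Koszul formula for `g(∇_{e_μ} e_ν, e_l)`, where `g x` is the matrix `g(e_μ, e_ν)` at `x`. -/
def connLower (e : Fin n → Pt n → Pt n) (g : Pt n → Matrix (Fin n) (Fin n) ℝ)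
    (l μ ν : Fin n) (x : Pt n) : ℝ :=
  (1 / 2) * (frameDeriv e (fun y => g y ν l) μ x + frameDeriv e (fun y => g y μ l) ν x
    - frameDeriv e (fun y => g y μ ν) l x
    + ∑ κ, (commCoeff e μ ν κ x * g x κ l - commCoeff e μ l κ x * g x κ ν
      - commCoeff e ν l κ x * g x κ μ))

/-- Levi-Civita connection coefficients, `∇_{e_μ} e_ν = Γ^κ_{μν} e_κ`. -/
def conn (e : Fin n → Pt n → Pt n) (g : Pt n → Matrix (Fin n) (Fin n) ℝ)
    (κ μ ν : Fin n) (x : Pt n) : ℝ :=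
  ∑ l, (g x)⁻¹ κ l * connLower e g l μ ν x

/-- The curvature tensor, `R(e_μ, e_ν) e_σ = R^κ_{σμν} e_κ` with
`R(X, Y) = ∇_X ∇_Y - ∇_Y ∇_X - ∇_[X, Y]`. -/
def riemann (e : Fin n → Pt n → Pt n) (g : Pt n → Matrix (Fin n) (Fin n) ℝ)
    (κ σ μ ν : Fin n) (x : Pt n) : ℝ :=
  frameDeriv e (conn e g κ ν σ) μ x - frameDeriv e (conn e g κ μ σ) ν x
    + ∑ l, (conn e g l ν σ x * conn e g κ μ l x - conn e g l μ σ x * conn e g κ ν l x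
      - commCoeff e μ ν l x * conn e g κ l σ x)

/-- The Ricci tensor `R_{σν} = R^μ_{σμν}`. -/
def ricci (e : Fin n → Pt n → Pt n) (g : Pt n → Matrix (Fin n) (Fin n) ℝ)
    (σ ν : Fin n) (x : Pt n) : ℝ :=
  ∑ μ, riemann e g μ σ μ ν x

/-- The Ricci scalar. -/
def scalarCurv (e : Fin n → Pt n → Pt n) (g : Pt n → Matrix (Fin n) (Fin n) ℝ)
    (x : Pt n) : ℝ :=
  ∑ μ, ∑ ν, (g x)⁻¹ μ ν * ricci e g μ ν x

/-- The Einstein tensor. -/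
def einstein (e : Fin n → Pt n → Pt n) (g : Pt n → Matrix (Fin n) (Fin n) ℝ)
    (μ ν : Fin n) (x : Pt n) : ℝ :=
  ricci e g μ ν x - (1 / 2) * scalarCurv e g x * g x μ ν

/-- Covariant derivative `(∇_μ T)_{J_1 … J_k}` of a covariant tensor given by its components. -/
def covD (e : Fin n → Pt n → Pt n) (g : Pt n → Matrix (Fin n) (Fin n) ℝ) {k : ℕ}
    (T : (Fin k → Fin n) → Pt n → ℝ) (μ : Fin n) (J : Fin k → Fin n) (x : Pt n) : ℝ :=
  frameDeriv e (T J) μ x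
    - ∑ i, ∑ κ, conn e g κ μ (J i) x * T (Function.update J i κ) x

/-- Exterior derivative of a form, as the antisymmetrised covariant derivative:
`(dF)_{I_0 … I_k} = ∑_i (-1)^i (∇_{I_i} F)_{I_0 … (omit I_i) … I_k}`. -/
def extD (e : Fin n → Pt n → Pt n) (g : Pt n → Matrix (Fin n) (Fin n) ℝ) {k : ℕ}
    (F : (Fin k → Fin n) → Pt n → ℝ) (I : Fin (k + 1) → Fin n) (x : Pt n) : ℝ :=
  ∑ i : Fin (k + 1), (-1) ^ (i : ℕ) * covD e g F (I i) (fun j => I (i.succAbove j)) x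

/-- Divergence `∇^μ F_{μ J_1 … J_k}` of a form; it vanishes iff `d ⋆ F = 0`. -/
def diverg (e : Fin n → Pt n → Pt n) (g : Pt n → Matrix (Fin n) (Fin n) ℝ) {k : ℕ}
    (F : (Fin (k + 1) → Fin n) → Pt n → ℝ) (J : Fin k → Fin n) (x : Pt n) : ℝ :=
  ∑ μ, ∑ ν, (g x)⁻¹ μ ν * covD e g F μ (Fin.cons ν J) x

/-- Components of the Lie derivative `L_ξ g` of the metric along a vector field. -/
def lieMetric (e : Fin n → Pt n → Pt n) (g : Pt n → Matrix (Fin n) (Fin n) ℝ)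
    (ξ : Pt n → Pt n) (μ ν : Fin n) (x : Pt n) : ℝ :=
  fderiv ℝ (fun y => g y μ ν) x (ξ x)
    - ∑ κ, (frameCoord e x (VectorField.lieBracket ℝ ξ (e μ) x) κ * g x κ ν
      + frameCoord e x (VectorField.lieBracket ℝ ξ (e ν) x) κ * g x μ κ)

end Frame

/-! Free `p`-form gauge theories with action `S = -(α/2) ∫ F ∧ ⋆F`. -/

/-- Total antisymmetry of the components of a `k`-form. -/
def IsAlternating {k n : ℕ} (F : (Fin k → Fin n) → ℝ) : Prop :=
  ∀ (I : Fin k → Fin n) (σ : Equiv.Perm (Fin k)),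
    F (fun i => I (σ i)) = ((Equiv.Perm.sign σ : ℤ) : ℝ) * F I

/-- The contraction `F_{I_1 … I_k} G^{I_1 … I_k}` with respect to a metric. -/
def contract {k : ℕ} (g : Matrix (Fin 4) (Fin 4) ℝ) (F G : (Fin k → Fin 4) → ℝ) : ℝ :=
  ∑ I : Fin k → Fin 4, ∑ J : Fin k → Fin 4, (∏ i, g⁻¹ (I i) (J i)) * F I * G J

/-- Energy-momentum tensor at a point of a `p`-form gauge field with action prefactor `α`, in terms
of the value `F` of the field strength, a `(p + 1)`-form, and of the value `g` of the metric. -/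
def emt (p : ℕ) (α : ℝ) (g : Matrix (Fin 4) (Fin 4) ℝ) (F : (Fin (p + 1) → Fin 4) → ℝ)
    (μ ν : Fin 4) : ℝ :=
  α * ((1 / (p.factorial : ℝ)) *
      contract g (fun I : Fin p → Fin 4 => F (Fin.cons μ I)) (fun I => F (Fin.cons ν I))
    - (1 / (2 * ((p + 1).factorial : ℝ))) * g μ ν * contract g F F)

/-- The Minkowski metric. -/
def minkowski : Matrix (Fin 4) (Fin 4) ℝ := Matrix.diagonal ![-1, 1, 1, 1]

/-- The (gauge invariant) Hamiltonian density of the theory in a local Lorentz frame, as a function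
of the value `F` of the field strength: the canonical Hamiltonian density without the gauge
dependent term that is removed by adding the divergence of a Belinfante tensor. -/
def hamiltonianDensity (p : ℕ) (α : ℝ) (F : (Fin (p + 1) → Fin 4) → ℝ) : ℝ :=
  α * ((1 / (p.factorial : ℝ)) *
      ∑ J : Fin p → Fin 3, F (Fin.cons 0 fun i => (J i).succ) ^ 2
    + (1 / (2 * ((p + 1).factorial : ℝ))) * contract minkowski F F)

/-- The Hamiltonian of the theory is bounded from below. -/
def HamiltonianBoundedBelow (p : ℕ) (α : ℝ) : Prop :=
  ∃ c : ℝ, ∀ F : (Fin (p + 1) → Fin 4) → ℝ, IsAlternating F → c ≤ hamiltonianDensity p α F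

/-- The weak energy condition for the theory: `T_{μν} V^μ V^ν ≥ 0` for all timelike `V` and all
values of the field strength. -/
def WeakEnergyCondition (p : ℕ) (α : ℝ) : Prop :=
  ∀ F : (Fin (p + 1) → Fin 4) → ℝ, IsAlternating F → ∀ V : Fin 4 → ℝ,
    ∑ μ, ∑ ν, minkowski μ ν * V μ * V ν < 0 →
      0 ≤ ∑ μ, ∑ ν, emt p α minkowski F μ ν * V μ * V ν

/-- A homogeneous `p`-form gauge field: the components of its field strength in the frame
`(∂_t, E_1, E_2, E_3)` depend only on `t`. -/
structure GaugeField where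
  p : ℕ
  p_le : p ≤ 3
  α : ℝ
  α_ne_zero : α ≠ 0
  F : ℝ → (Fin (p + 1) → Fin 4) → ℝ

/-! Spatial sections. -/

/-- A smooth frame `E_1, E_2, E_3` on a coordinate patch `U` of the spatial sections. -/
structure SpatialFrame where
  U : Set (Pt 3)
  isOpen : IsOpen U
  isConnected : IsConnected U
  E : Fin 3 → Pt 3 → Pt 3
  smooth : ∀ a, ContDiffOn ℝ ∞ (E a) U
  indep : ∀ x ∈ U, LinearIndependent ℝ fun a => E a x

/-- The totally antisymmetric symbol with `ε_{123} = 1`. -/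
def eps (a b c : Fin 3) : ℝ :=
  Matrix.det (Matrix.of fun i j : Fin 3 => if ![a, b, c] i = j then (1 : ℝ) else 0)

/-- The structure constants `C_{ab}^d = ε_{abe} N^{ed} + A_a δ_b^d - A_b δ_a^d`. -/
def behrConst (N : Matrix (Fin 3) (Fin 3) ℝ) (A : Fin 3 → ℝ) (a b d : Fin 3) : ℝ :=
  ∑ e, eps a b e * N e d + (if b = d then A a else 0) - (if a = d then A b else 0)

/-- The symmetric tensor density `N^{ab}` in the Behr decomposition of structure constants. -/
def behrN (C : Fin 3 → Fin 3 → Fin 3 → ℝ) (f d : Fin 3) : ℝ :=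
  (1 / 4) * ∑ a, ∑ b, (eps a b f * C a b d + eps a b d * C a b f)

/-- `C_{ab}^c` are the structure constants, in some basis, of a Lie algebra of Bianchi type III:
a constant change of basis `Y'_a = M_a^i Y_i` gives the canonical form `N = diag(0, 1, -1)`,
`A = (1, 0, 0)`. -/
def IsTypeIII (C : Fin 3 → Fin 3 → Fin 3 → ℝ) : Prop :=
  ∃ M : Matrix (Fin 3) (Fin 3) ℝ, IsUnit M.det ∧ ∀ a b k,
    ∑ c, behrConst (Matrix.diagonal ![0, 1, -1]) ![1, 0, 0] a b c * M c k
      = ∑ i, ∑ j, M a i * M b j * C i j k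

/-- The frame is a left-invariant frame of a Bianchi model with structure constants `C_{ab}^c` of
the Killing fields: `[E_a, E_b] = - C_{ab}^c E_c`. -/
def SpatialFrame.IsBianchi (S : SpatialFrame) (C : Fin 3 → Fin 3 → Fin 3 → ℝ) : Prop :=
  ∀ x ∈ S.U, ∀ a b c, commCoeff S.E a b c x = - C a b c

/-- The frame `∂_x, ∂_y, (1 / sin y) ∂_z` on (a patch of) `ℝ × S²`, dual to `dx, dy, sin y dz`. -/
def SpatialFrame.IsKantowskiSachs (S : SpatialFrame) : Prop :=
  ∀ x ∈ S.U, 0 < x 1 ∧ x 1 < Real.pi ∧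
    S.E 0 x = ![1, 0, 0] ∧ S.E 1 x = ![0, 1, 0] ∧ S.E 2 x = ![0, 0, 1 / Real.sin (x 1)]

/-! Cosmological models. -/

/-- The frame `(∂_t, E_1, E_2, E_3)` on spacetime, with coordinates `(t, x^1, x^2, x^3)`. -/
def SpatialFrame.e (S : SpatialFrame) (μ : Fin 4) (x : Pt 4) : Pt 4 :=
  Fin.cases (motive := fun _ => Pt 4) (Pi.single 0 1)
    (fun a => Fin.cons (0 : ℝ) (S.E a (Fin.tail x))) μ

/-- Components of `-dt² + h_{ab}(t) W^a W^b` in the frame `(∂_t, E_1, E_2, E_3)`. -/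
def spacetimeMetric (h : ℝ → Matrix (Fin 3) (Fin 3) ℝ) (x : Pt 4) : Matrix (Fin 4) (Fin 4) ℝ :=
  Matrix.of fun μ ν => Fin.cases (motive := fun _ => ℝ)
    (Fin.cases (motive := fun _ => ℝ) (-1) (fun _ => 0) ν)
    (fun a => Fin.cases (motive := fun _ => ℝ) 0 (fun b => h (x 0) a b) ν) μ

/-- The data of a model with `n` gauge fields on `I × U`: the time interval `I`, the spatial metric
`h_{ab}(t)`, the gauge fields, and a finite collection of comoving perfect fluids with energy
densities `ρ` and pressures `P`. -/
structure Cosmology (S : SpatialFrame) (n : ℕ) where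
  I : Set ℝ
  h : ℝ → Matrix (Fin 3) (Fin 3) ℝ
  field : Fin n → GaugeField
  m : ℕ
  ρ : Fin m → ℝ → ℝ
  P : Fin m → ℝ → ℝ
  isOpen : IsOpen I
  isConnected : IsConnected I
  h_posDef : ∀ t ∈ I, (h t).PosDef
  h_smooth : ∀ a b, ContDiffOn ℝ ∞ (fun t => h t a b) I
  F_alternating : ∀ i, ∀ t ∈ I, IsAlternating ((field i).F t)
  F_smooth : ∀ i J, ContDiffOn ℝ ∞ (fun t => (field i).F t J) I
  ρ_smooth : ∀ i, ContDiffOn ℝ ∞ (ρ i) I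
  P_smooth : ∀ i, ContDiffOn ℝ ∞ (P i) I

namespace Cosmology

variable {S : SpatialFrame} {n : ℕ} (M : Cosmology S n)

/-- The spacetime region `I × U`. -/
def region : Set (Pt 4) := {x | x 0 ∈ M.I ∧ Fin.tail x ∈ S.U}

/-- The spacetime metric in the frame `(∂_t, E_1, E_2, E_3)`. -/
def g : Pt 4 → Matrix (Fin 4) (Fin 4) ℝ := spacetimeMetric M.h

/-- Components `u_μ` of the four-velocity `u = ∂_t` normal to the spatial sections. -/
def uLower (μ : Fin 4) : ℝ := if μ = 0 then -1 else 0

/-- `∇_μ u_ν`. -/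
def gradU (μ ν : Fin 4) (x : Pt 4) : ℝ :=
  covD S.e M.g (fun J : Fin 1 → Fin 4 => fun _ => uLower (J 0)) μ ![ν] x

/-- The projection `h_{μν} = g_{μν} + u_μ u_ν`. -/
def proj (μ ν : Fin 4) (x : Pt 4) : ℝ := M.g x μ ν + uLower μ * uLower ν

/-- The Hubble scalar, `3 H = ∇_μ u^μ`. -/
def hubble (x : Pt 4) : ℝ := (1 / 3) * ∑ μ, ∑ ν, (M.g x)⁻¹ μ ν * M.gradU μ ν x

/-- The shear tensor `σ_{μν} = ∇_{(ν} u_{μ)} - H h_{μν}`. -/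
def shear (μ ν : Fin 4) (x : Pt 4) : ℝ :=
  (1 / 2) * (M.gradU μ ν x + M.gradU ν μ x) - M.hubble x * M.proj μ ν x

/-- The traceless Ricci tensor `³S_{ab}` of the spatial section at time `t`. -/
def tracelessRicci (t : ℝ) (a b : Fin 3) (y : Pt 3) : ℝ :=
  ricci S.E (fun _ => M.h t) a b y - (1 / 3) * scalarCurv S.E (fun _ => M.h t) y * M.h t a b

/-- Energy-momentum tensor of the `i`-th gauge field. -/
def fieldEMT (i : Fin n) (μ ν : Fin 4) (x : Pt 4) : ℝ :=
  emt (M.field i).p (M.field i).α (M.g x) ((M.field i).F (x 0)) μ ν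

/-- Total energy density of the perfect fluids. -/
def totalρ (t : ℝ) : ℝ := ∑ i, M.ρ i t

/-- Total pressure of the perfect fluids. -/
def totalP (t : ℝ) : ℝ := ∑ i, M.P i t

/-- Components of the field strength of the `i`-th gauge field, as functions on spacetime. -/
def fieldStrength (i : Fin n) (J : Fin ((M.field i).p + 1) → Fin 4) (x : Pt 4) : ℝ :=
  (M.field i).F (x 0) J

/-- The model is a Bianchi model or a Kantowski-Sachs model
`-dt² + A(t)² dx² + B(t)² (dy² + sin² y dz²)`. -/
def IsHomogeneous : Prop :=
  (∃ C, S.IsBianchi C) ∨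
    (S.IsKantowskiSachs ∧ ∃ A B : ℝ → ℝ, ∀ t ∈ M.I,
      M.h t = Matrix.diagonal ![A t ^ 2, B t ^ 2, B t ^ 2])

/-- Shear-free solutions: general relativistic solutions (in units `8πG = c = 1`) with homogeneous,
intrinsically anisotropic and isotropically expanding spatial sections, containing comoving perfect
fluids and free `p`-form gauge fields without energy flux. -/
structure IsShearFreeSolution : Prop where
  homogeneous : M.IsHomogeneous
  anisotropic : ∃ t ∈ M.I, ∃ y ∈ S.U, ∃ a b, M.tracelessRicci t a b y ≠ 0
  shear_eq_zero : ∀ x ∈ M.region, ∀ μ ν, M.shear μ ν x = 0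
  not_static : ∃ x ∈ M.region, M.hubble x ≠ 0
  closed : ∀ i, ∀ x ∈ M.region, ∀ J, extD S.e M.g (M.fieldStrength i) J x = 0
  coclosed : ∀ i, ∀ x ∈ M.region, ∀ J, diverg S.e M.g (M.fieldStrength i) J x = 0
  no_flux : ∀ i, ∀ x ∈ M.region, ∀ a : Fin 3, M.fieldEMT i 0 a.succ x = 0
  fluid : ∀ x ∈ M.region,
    deriv M.totalρ (x 0) + 3 * M.hubble x * (M.totalρ (x 0) + M.totalP (x 0)) = 0
  einstein_eq : ∀ x ∈ M.region, ∀ μ ν, einstein S.e M.g μ ν x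
    = M.totalρ (x 0) * uLower μ * uLower ν + M.totalP (x 0) * M.proj μ ν x
      + ∑ i, M.fieldEMT i μ ν x

/-- Every gauge field of the model has a Hamiltonian that is bounded from below. -/
def HamiltoniansBoundedBelow : Prop :=
  ∀ i, HamiltonianBoundedBelow (M.field i).p (M.field i).α

/-- Local rotational symmetry: around every point there is a Killing vector field which leaves `u`
invariant and is an infinitesimal rotation about that point. -/
def IsLRS : Prop :=
  ∀ x₀ ∈ M.region, ∃ V : Set (Pt 4), IsOpen V ∧ x₀ ∈ V ∧ V ⊆ M.region ∧
    ∃ ξ : Pt 4 → Pt 4, ContDiffOn ℝ ∞ ξ V ∧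
      (∀ x ∈ V, ∀ μ ν, lieMetric S.e M.g ξ μ ν x = 0) ∧
      (∀ x ∈ V, VectorField.lieBracket ℝ ξ (S.e 0) x = 0) ∧
      ξ x₀ = 0 ∧ fderiv ℝ ξ x₀ ≠ 0

/-- The model is an LRS Bianchi type III model with `N^a_a = h_{ab} N^{ab} = 0`. -/
def IsTracelessLRSBianchiIII : Prop :=
  (∃ C, S.IsBianchi C ∧ IsTypeIII C ∧ ∀ t ∈ M.I, ∑ a, ∑ b, M.h t a b * behrN C a b = 0) ∧ M.IsLRS

end Cosmology

end ShearFree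

end

set_option linter.unusedSimpArgs false

noncomputable section

namespace ShearFree

/-! ### Smoothness of inverse matrices, commutation functions and connection coefficients. -/

section Smoothness

/-! Vanishing shear makes the logarithmic derivatives of all metric components equal, so `h = s(t)
k` with `k` constant (`Cosmology.exists_scale`). A constant change of spatial frame turns `k` into
the unit matrix, and every condition on a model is covariant under such a change
(`IsShearFreeModel.changeFrame`). In the new frame the Ricci tensor of the sections has components
independent of time, and the trace-free spatial Einstein equations equate their trace-free part with
the anisotropic stress of the gauge fields.

The gauge field equations and the absence of energy flux fix how that stress depends on time
(`StressForm`). For `p = 0` the spatial gradient is constant; for `p = 2` the spatial vector dual to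
the field grows like the square root of `s`, while its square enters the stress divided by `s`. If
`α > 0`, both contribute a constant `v ⊗ v`, where `v` is a closed and coclosed one-form with
constant components. For `p = 1` zero flux makes the electric and magnetic vectors parallel, so that
`s E ⊗ E + B ⊗ B` is conserved and the anisotropic stress is a constant matrix divided by `s`. For
`p = 3` the stress is isotropic. Since the model is not static, `s` takes two values; comparing the
two times removes the trace-free part of the `1 / s` terms. What remains is `Ric = ∑ v_i ⊗ v_i + c
g` with harmonic `v_i` (`exists_ricci_eq`). Positivity of the prefactors enters as the plus sign in
front of the squares.

This condition is very restrictive. On a Bianchi model a nonzero `v_i` is rotated to the first axis,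
and harmonicity together with the Ricci equations leaves only the algebra `ℝ ⊕ r₂` with its centre
orthogonal to the derived algebra, besides the isotropic abelian case (`eq_zero_of_ricci_eq`,
`IsBianchi.exists_adapted`). Geometrically this is `ℝ × H²`: it is of type III, the orthogonality is
`N^a_a = 0`, and the rotations of `H²` give the local rotational symmetry
(`IsConformallyOrthonormal.isLRS`). On a Kantowski–Sachs model the sphere would require `c > 0` and
the line would require `c ≤ 0`.

Conversely, a type III algebra with `N^a_a = 0` has an adapted orthonormal basis
(`exists_adapted_basis`). Scalar fields with constant gradient along the flat direction, together
with a fluid satisfying `ρ + 3P = 0`, then solve all equations with scale factor `t`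
(`scalarModel`).

The energy density is `α` times a positive definite quadratic form in the field strength
(`emt_one_pos`). Hence a Hamiltonian bounded from below and the weak energy condition both amount to
`0 ≤ α`. A field with `α < 0` whose energy density is nowhere negative vanishes identically, so the
uniqueness argument, run under the hypothesis `HasPositiveEnergy`, also yields the last claim by
contraposition. -/

theorem contDiffOn_det {m : ℕ} {E : Type*} [NormedAddCommGroup E] [NormedSpace ℝ E] {s : Set E}
    {A : E → Matrix (Fin m) (Fin m) ℝ} (hA : ∀ i j, ContDiffOn ℝ ∞ (fun x => A x i j) s) :
    ContDiffOn ℝ ∞ (fun x => (A x).det) s := by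
  simp only [Matrix.det_apply']
  exact ContDiffOn.sum fun σ _ => contDiffOn_const.mul (contDiffOn_prod fun i _ => hA _ _)

/-- Cramer's rule: the entries are cofactors, again determinants of smooth matrices, divided by a
nonvanishing determinant. -/
theorem contDiffOn_inv_apply {m : ℕ} {E : Type*} [NormedAddCommGroup E] [NormedSpace ℝ E]
    {s : Set E} {A : E → Matrix (Fin m) (Fin m) ℝ}
    (hA : ∀ i j, ContDiffOn ℝ ∞ (fun x => A x i j) s) (hdet : ∀ x ∈ s, (A x).det ≠ 0)
    (i j : Fin m) : ContDiffOn ℝ ∞ (fun x => (A x)⁻¹ i j) s := by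
  simp only [Matrix.inv_def, Matrix.smul_apply, Ring.inverse_eq_inv', smul_eq_mul,
    Matrix.adjugate_apply]
  refine ((contDiffOn_det hA).inv hdet).mul (contDiffOn_det fun k l => ?_)
  by_cases hk : k = j
  · subst hk
    simpa using contDiffOn_const
  · simpa [Matrix.updateRow_ne hk] using hA k l

variable {n : ℕ}

/-- A smooth frame together with the components of a smooth nondegenerate metric. -/
structure IsRegularOn (e : Fin n → Pt n → Pt n) (g : Pt n → Matrix (Fin n) (Fin n) ℝ)
    (s : Set (Pt n)) : Prop where
  isOpen : IsOpen s
  frame : ∀ μ, ContDiffOn ℝ ∞ (e μ) s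
  indep : ∀ x ∈ s, LinearIndependent ℝ fun μ => e μ x
  metric : ∀ μ ν, ContDiffOn ℝ ∞ (fun x => g x μ ν) s
  det_ne : ∀ x ∈ s, (g x).det ≠ 0

theorem differentiableAt_of_contDiffOn {E F : Type*} [NormedAddCommGroup E] [NormedSpace ℝ E]
    [NormedAddCommGroup F] [NormedSpace ℝ F] {f : E → F} {s : Set E} (hs : IsOpen s)
    (hf : ContDiffOn ℝ ∞ f s) {x : E} (hx : x ∈ s) : DifferentiableAt ℝ f x :=
  (hf.contDiffAt (hs.mem_nhds hx)).differentiableAt (by simp)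

theorem frameMatrix_det_ne {e : Fin n → Pt n → Pt n} {x : Pt n}
    (h : LinearIndependent ℝ fun μ => e μ x) :
    (Matrix.of fun i j => e j x i).det ≠ 0 := by
  rw [← isUnit_iff_ne_zero, ← Matrix.isUnit_iff_isUnit_det,
    ← Matrix.linearIndependent_cols_iff_isUnit]
  exact h

/-- The components of a vector are determined by its expansion in the frame. -/
theorem frameCoord_eq {e : Fin n → Pt n → Pt n} {x v : Pt n}
    (h : LinearIndependent ℝ fun μ => e μ x) {c : Fin n → ℝ} (hv : v = ∑ κ, c κ • e κ x)
    (κ : Fin n) : frameCoord e x v κ = c κ := by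
  have hA := frameMatrix_det_ne h
  have hvc : v = (Matrix.of fun i j => e j x i) *ᵥ c := by
    ext i
    simp [hv, Matrix.mulVec, dotProduct, mul_comm]
  rw [frameCoord, hvc, Matrix.mulVec_mulVec, Matrix.nonsing_inv_mul _ (isUnit_iff_ne_zero.2 hA),
    Matrix.one_mulVec]

theorem sum_frameCoord_smul {e : Fin n → Pt n → Pt n} {x : Pt n}
    (h : LinearIndependent ℝ fun μ => e μ x) (v : Pt n) :
    ∑ κ, frameCoord e x v κ • e κ x = v := by
  have hA := frameMatrix_det_ne h
  have : (Matrix.of fun i j => e j x i) *ᵥ (fun κ => frameCoord e x v κ) = v := by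
    have : (fun κ => frameCoord e x v κ) = (Matrix.of fun i j => e j x i)⁻¹ *ᵥ v := rfl
    rw [this, Matrix.mulVec_mulVec, Matrix.mul_nonsing_inv _ (isUnit_iff_ne_zero.2 hA),
      Matrix.one_mulVec]
  conv_rhs => rw [← this]
  ext i
  simp [Matrix.mulVec, dotProduct, mul_comm]

theorem frameCoord_smul (e : Fin n → Pt n → Pt n) (x v : Pt n) (c : ℝ) (κ : Fin n) :
    frameCoord e x (c • v) κ = c * frameCoord e x v κ := by
  simp [frameCoord, Matrix.mulVec_smul]

theorem frameCoord_add (e : Fin n → Pt n → Pt n) (x v w : Pt n) (κ : Fin n) :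
    frameCoord e x (v + w) κ = frameCoord e x v κ + frameCoord e x w κ := by
  simp [frameCoord, Matrix.mulVec_add]

theorem frameCoord_sum (e : Fin n → Pt n → Pt n) (x : Pt n) {ι : Type*} (s : Finset ι)
    (v : ι → Pt n) (κ : Fin n) :
    frameCoord e x (∑ i ∈ s, v i) κ = ∑ i ∈ s, frameCoord e x (v i) κ := by
  simp [frameCoord, Matrix.mulVec_sum]

theorem contDiffOn_fderiv_apply {f : Pt n → ℝ} {v : Pt n → Pt n} {s : Set (Pt n)} (hs : IsOpen s)
    (hf : ContDiffOn ℝ ∞ f s) (hv : ContDiffOn ℝ ∞ v s) :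
    ContDiffOn ℝ ∞ (fun x => fderiv ℝ f x (v x)) s :=
  (hf.fderiv_of_isOpen hs (by simp)).clm_apply hv

variable {e : Fin n → Pt n → Pt n} {g : Pt n → Matrix (Fin n) (Fin n) ℝ} {s : Set (Pt n)}

theorem contDiffOn_commCoeff (hs : IsOpen s) (he : ∀ μ, ContDiffOn ℝ ∞ (e μ) s)
    (hi : ∀ x ∈ s, LinearIndependent ℝ fun μ => e μ x) (μ ν κ : Fin n) :
    ContDiffOn ℝ ∞ (commCoeff e μ ν κ) s := by
  have hc : ∀ i j, ContDiffOn ℝ ∞ (fun x => e j x i) s := fun i j => contDiffOn_pi.1 (he j) i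
  have hL : ContDiffOn ℝ ∞ (VectorField.lieBracket ℝ (e μ) (e ν)) s := by
    rw [VectorField.lieBracket_eq]
    exact (((he ν).fderiv_of_isOpen hs (by simp)).clm_apply (he μ)).sub
      (((he μ).fderiv_of_isOpen hs (by simp)).clm_apply (he ν))
  unfold commCoeff frameCoord
  simp only [Matrix.mulVec, dotProduct]
  refine ContDiffOn.sum fun i _ => ContDiffOn.mul ?_ (contDiffOn_pi.1 hL i)
  exact contDiffOn_inv_apply (fun i j => by simpa using hc i j)
    (fun x hx => frameMatrix_det_ne (hi x hx)) κ i

theorem IsRegularOn.contDiffOn_connLower (h : IsRegularOn e g s) (l μ ν : Fin n) :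
    ContDiffOn ℝ ∞ (connLower e g l μ ν) s := by
  have hd : ∀ a b c, ContDiffOn ℝ ∞ (frameDeriv e (fun y => g y a b) c) s := fun a b c =>
    contDiffOn_fderiv_apply h.isOpen (h.metric a b) (h.frame c)
  have hC := contDiffOn_commCoeff h.isOpen h.frame h.indep
  unfold connLower
  refine contDiffOn_const.mul ((((hd _ _ _).add (hd _ _ _)).sub (hd _ _ _)).add
    (ContDiffOn.sum fun κ _ => ?_))
  exact (((hC _ _ _).mul (h.metric _ _)).sub ((hC _ _ _).mul (h.metric _ _))).sub
    ((hC _ _ _).mul (h.metric _ _))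

theorem IsRegularOn.contDiffOn_conn (h : IsRegularOn e g s) (κ μ ν : Fin n) :
    ContDiffOn ℝ ∞ (conn e g κ μ ν) s := by
  unfold conn
  exact ContDiffOn.sum fun l _ => (contDiffOn_inv_apply h.metric h.det_ne κ l).mul
    (h.contDiffOn_connLower l μ ν)

theorem IsRegularOn.differentiableAt_conn (h : IsRegularOn e g s) (κ μ ν : Fin n) {x : Pt n}
    (hx : x ∈ s) : DifferentiableAt ℝ (conn e g κ μ ν) x :=
  differentiableAt_of_contDiffOn h.isOpen (h.contDiffOn_conn κ μ ν) hx

end Smoothness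

/-! Behaviour of the tensor calculus under a constant change of frame. -/

section ChangeOfFrame

variable {n : ℕ}

/-- The frame `e'_μ = Λ_μ^ν e_ν`. -/
def mulFrame (Λ : Matrix (Fin n) (Fin n) ℝ) (e : Fin n → Pt n → Pt n) (μ : Fin n) (x : Pt n) :
    Pt n :=
  ∑ ν, Λ μ ν • e ν x

/-- Components of the metric in the frame `mulFrame Λ e`. -/
def mulMetric (Λ : Matrix (Fin n) (Fin n) ℝ) (g : Pt n → Matrix (Fin n) (Fin n) ℝ) (x : Pt n) :
    Matrix (Fin n) (Fin n) ℝ :=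
  Λ * g x * Λᵀ

/-- Components of a covariant tensor after a change of basis. -/
def mulForm (Λ : Matrix (Fin n) (Fin n) ℝ) {k : ℕ} (F : (Fin k → Fin n) → ℝ)
    (J : Fin k → Fin n) : ℝ :=
  ∑ K : Fin k → Fin n, (∏ i, Λ (J i) (K i)) * F K

variable {Λ : Matrix (Fin n) (Fin n) ℝ} {e : Fin n → Pt n → Pt n}
  {g : Pt n → Matrix (Fin n) (Fin n) ℝ} {s : Set (Pt n)} {x : Pt n}

theorem sum_mul_inv_apply (hΛ : IsUnit Λ.det) (a b : Fin n) :
    ∑ c, Λ a c * Λ⁻¹ c b = if a = b then 1 else 0 := by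
  have := congrFun (congrFun (Matrix.mul_nonsing_inv Λ hΛ) a) b
  simpa [Matrix.mul_apply, Matrix.one_apply] using this

theorem sum_inv_mul_apply (hΛ : IsUnit Λ.det) (a b : Fin n) :
    ∑ c, Λ⁻¹ a c * Λ c b = if a = b then 1 else 0 := by
  have := congrFun (congrFun (Matrix.nonsing_inv_mul Λ hΛ) a) b
  simpa [Matrix.mul_apply, Matrix.one_apply] using this

/-- Two families that agree after contraction with an invertible matrix agree. -/
theorem eq_of_sum_mul_eq (hΛ : IsUnit Λ.det) {c d : Fin n → ℝ}
    (h : ∀ γ, ∑ κ, c κ * Λ κ γ = ∑ κ, d κ * Λ κ γ) : c = d := by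
  have h' : Matrix.vecMul c Λ = Matrix.vecMul d Λ := by
    ext γ; simpa [Matrix.vecMul, dotProduct] using h γ
  have := congrArg (fun v => Matrix.vecMul v Λ⁻¹) h'
  simpa [Matrix.vecMul_vecMul, Matrix.mul_nonsing_inv Λ hΛ] using this

theorem mulFrame_linearIndependent (hΛ : IsUnit Λ.det)
    (h : LinearIndependent ℝ fun μ => e μ x) :
    LinearIndependent ℝ fun μ => mulFrame Λ e μ x := by
  have h1 := frameMatrix_det_ne h
  have h2 : (Matrix.of fun i j => mulFrame Λ e j x i) = (Matrix.of fun i j => e j x i) * Λᵀ := by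
    ext i j
    simp [mulFrame, Matrix.mul_apply, mul_comm]
  have h3 : IsUnit (Matrix.of fun i j => mulFrame Λ e j x i) := by
    rw [h2, Matrix.isUnit_iff_isUnit_det, Matrix.det_mul, Matrix.det_transpose]
    exact (isUnit_iff_ne_zero.2 h1).mul hΛ
  rw [← Matrix.linearIndependent_cols_iff_isUnit] at h3
  exact h3

theorem mulFrame_contDiffOn (he : ∀ μ, ContDiffOn ℝ ∞ (e μ) s) (μ : Fin n) :
    ContDiffOn ℝ ∞ (mulFrame Λ e μ) s :=
  ContDiffOn.sum fun ν _ => (he ν).const_smul (Λ μ ν)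

theorem mulMetric_apply (x : Pt n) (μ ν : Fin n) :
    mulMetric Λ g x μ ν = ∑ α, ∑ β, Λ μ α * Λ ν β * g x α β := by
  simp only [mulMetric, Matrix.mul_apply, Matrix.transpose_apply, Finset.sum_mul]
  rw [Finset.sum_comm]
  exact Finset.sum_congr rfl fun _ _ => Finset.sum_congr rfl fun _ _ => by ring

theorem IsRegularOn.mul (hΛ : IsUnit Λ.det) (h : IsRegularOn e g s) :
    IsRegularOn (mulFrame Λ e) (mulMetric Λ g) s where
  isOpen := h.isOpen
  frame := mulFrame_contDiffOn h.frame
  indep x hx := mulFrame_linearIndependent hΛ (h.indep x hx)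
  metric μ ν := by
    simp only [mulMetric_apply]
    exact ContDiffOn.sum fun α _ => ContDiffOn.sum fun β _ => contDiffOn_const.mul (h.metric α β)
  det_ne x hx := by
    simp only [mulMetric, Matrix.det_mul, Matrix.det_transpose]
    have := hΛ.ne_zero
    exact mul_ne_zero (mul_ne_zero this (h.det_ne x hx)) this

theorem mulFrame_inv_mulFrame (hΛ : IsUnit Λ.det) : mulFrame Λ⁻¹ (mulFrame Λ e) = e := by
  funext μ x
  simp only [mulFrame, Finset.smul_sum, smul_smul]
  rw [Finset.sum_comm]
  simp only [← Finset.sum_smul, sum_inv_mul_apply hΛ]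
  simp

theorem frameDeriv_mulFrame (f : Pt n → ℝ) (μ : Fin n) (x : Pt n) :
    frameDeriv (mulFrame Λ e) f μ x = ∑ ν, Λ μ ν * frameDeriv e f ν x := by
  simp [frameDeriv, mulFrame, map_sum]

theorem frameDeriv_sum {ι : Type*} (t : Finset ι) {f : ι → Pt n → ℝ} (c : ι → ℝ)
    (hf : ∀ i ∈ t, DifferentiableAt ℝ (f i) x) (μ : Fin n) :
    frameDeriv e (fun y => ∑ i ∈ t, c i * f i y) μ x = ∑ i ∈ t, c i * frameDeriv e (f i) μ x := by
  unfold frameDeriv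
  rw [fderiv_fun_sum fun i hi => (hf i hi).const_mul (c i)]
  simp only [sum_apply]
  exact Finset.sum_congr rfl fun i hi => by rw [fderiv_const_mul (hf i hi)]; simp

theorem lieBracket_mulFrame_right (V : Pt n → Pt n) (he : ∀ μ, DifferentiableAt ℝ (e μ) x)
    (ν : Fin n) :
    VectorField.lieBracket ℝ V (mulFrame Λ e ν) x
      = ∑ β, Λ ν β • VectorField.lieBracket ℝ V (e β) x := by
  have h : HasFDerivAt (mulFrame Λ e ν) (∑ β, Λ ν β • fderiv ℝ (e β) x) x :=
    HasFDerivAt.fun_sum fun β _ => (he β).hasFDerivAt.const_smul (Λ ν β)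
  simp only [VectorField.lieBracket, h.fderiv, sum_apply,
    smul_apply, mulFrame, map_sum, map_smul, smul_sub, Finset.sum_sub_distrib]

theorem lieBracket_mulFrame (he : ∀ μ, DifferentiableAt ℝ (e μ) x) (μ ν : Fin n) :
    VectorField.lieBracket ℝ (mulFrame Λ e μ) (mulFrame Λ e ν) x
      = ∑ α, ∑ β, (Λ μ α * Λ ν β) • VectorField.lieBracket ℝ (e α) (e β) x := by
  rw [lieBracket_mulFrame_right _ he, Finset.sum_comm]
  refine Finset.sum_congr rfl fun β _ => ?_
  rw [VectorField.lieBracket_swap, lieBracket_mulFrame_right _ he, ← Finset.sum_neg_distrib,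
    Finset.smul_sum]
  refine Finset.sum_congr rfl fun α _ => ?_
  rw [VectorField.lieBracket_swap (V := e α), smul_neg, smul_neg, smul_smul, mul_comm]

theorem frameCoord_mulFrame (hΛ : IsUnit Λ.det) (h : LinearIndependent ℝ fun μ => e μ x)
    (v : Pt n) (γ : Fin n) :
    ∑ κ, frameCoord (mulFrame Λ e) x v κ * Λ κ γ = frameCoord e x v γ := by
  symm
  apply frameCoord_eq h
  conv_lhs => rw [← sum_frameCoord_smul (mulFrame_linearIndependent hΛ h) v]
  simp only [mulFrame, Finset.smul_sum, smul_smul, Finset.sum_smul]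
  rw [Finset.sum_comm]

/-- The matrix is constant, so the bracket produces no derivative terms. The upper index is left
contracted with `Λ`; all later transformation laws have this form, which keeps `Λ⁻¹` out until a
trace is taken. -/
theorem commCoeff_mulFrame (hΛ : IsUnit Λ.det) (h : LinearIndependent ℝ fun μ => e μ x)
    (he : ∀ μ, DifferentiableAt ℝ (e μ) x) (μ ν γ : Fin n) :
    ∑ κ, commCoeff (mulFrame Λ e) μ ν κ x * Λ κ γ
      = ∑ α, ∑ β, Λ μ α * Λ ν β * commCoeff e α β γ x := by
  simp only [commCoeff]
  rw [frameCoord_mulFrame hΛ h, lieBracket_mulFrame he]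
  simp only [frameCoord_sum, frameCoord_smul]

end ChangeOfFrame

end ShearFree

/-! ### Connection and curvature under a constant change of frame. -/

namespace ShearFree

section ChangeOfFrame

variable {n : ℕ} {Λ : Matrix (Fin n) (Fin n) ℝ} {e : Fin n → Pt n → Pt n}
  {g : Pt n → Matrix (Fin n) (Fin n) ℝ} {s : Set (Pt n)} {x : Pt n}

theorem sum_comm₃ {ι κ μ : Type*} [Fintype ι] [Fintype κ] [Fintype μ] (f : ι → κ → μ → ℝ) :
    ∑ a, ∑ b, ∑ c, f a b c = ∑ b, ∑ c, ∑ a, f a b c := by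
  rw [Finset.sum_comm]
  exact Finset.sum_congr rfl fun _ _ => Finset.sum_comm

theorem sum_comm₄ {ι κ μ ν : Type*} [Fintype ι] [Fintype κ] [Fintype μ] [Fintype ν]
    (f : ι → κ → μ → ν → ℝ) :
    ∑ a, ∑ b, ∑ c, ∑ d, f a b c d = ∑ c, ∑ d, ∑ a, ∑ b, f a b c d := by
  simp_rw [fun a => sum_comm₃ (f a)]
  rw [sum_comm₃]

/-- Contraction of a three-index quantity with three rows of a matrix. -/
def rows₃ (Λ : Matrix (Fin n) (Fin n) ℝ) (a b c : Fin n) (X : Fin n → Fin n → Fin n → ℝ) : ℝ :=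
  ∑ α, ∑ β, ∑ γ, Λ a α * Λ b β * Λ c γ * X α β γ

theorem rows₃_swap_left (a b c : Fin n) (X : Fin n → Fin n → Fin n → ℝ) :
    rows₃ Λ a b c X = rows₃ Λ b a c fun β α γ => X α β γ := by
  unfold rows₃
  rw [Finset.sum_comm]
  refine Finset.sum_congr rfl fun _ _ => Finset.sum_congr rfl fun _ _ =>
    Finset.sum_congr rfl fun _ _ => by ring

theorem rows₃_swap_right (a b c : Fin n) (X : Fin n → Fin n → Fin n → ℝ) :
    rows₃ Λ a b c X = rows₃ Λ a c b fun α γ β => X α β γ := by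
  unfold rows₃
  refine Finset.sum_congr rfl fun _ _ => ?_
  rw [Finset.sum_comm]
  refine Finset.sum_congr rfl fun _ _ => Finset.sum_congr rfl fun _ _ => by ring

theorem rows₃_add (a b c : Fin n) (X Y : Fin n → Fin n → Fin n → ℝ) :
    rows₃ Λ a b c X + rows₃ Λ a b c Y = rows₃ Λ a b c fun α β γ => X α β γ + Y α β γ := by
  simp only [rows₃, mul_add, Finset.sum_add_distrib]

theorem rows₃_sub (a b c : Fin n) (X Y : Fin n → Fin n → Fin n → ℝ) :
    rows₃ Λ a b c X - rows₃ Λ a b c Y = rows₃ Λ a b c fun α β γ => X α β γ - Y α β γ := by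
  simp only [rows₃, mul_sub, Finset.sum_sub_distrib]

theorem mul_rows₃ (r : ℝ) (a b c : Fin n) (X : Fin n → Fin n → Fin n → ℝ) :
    r * rows₃ Λ a b c X = rows₃ Λ a b c fun α β γ => r * X α β γ := by
  simp only [rows₃, Finset.mul_sum]
  refine Finset.sum_congr rfl fun _ _ => Finset.sum_congr rfl fun _ _ =>
    Finset.sum_congr rfl fun _ _ => by ring

theorem frameDeriv_mulMetric (hg : ∀ μ ν, DifferentiableAt ℝ (fun y => g y μ ν) x)
    (μ ν l : Fin n) :
    frameDeriv (mulFrame Λ e) (fun y => mulMetric Λ g y ν l) μ x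
      = rows₃ Λ μ ν l fun α β δ => frameDeriv e (fun y => g y β δ) α x := by
  have h : (fun y => mulMetric Λ g y ν l)
      = fun y => ∑ p : Fin n × Fin n, (Λ ν p.1 * Λ l p.2) * g y p.1 p.2 := by
    funext y
    rw [mulMetric_apply, Fintype.sum_prod_type]
  rw [h, frameDeriv_mulFrame]
  unfold rows₃
  refine Finset.sum_congr rfl fun α _ => ?_
  rw [frameDeriv_sum _ _ (fun p _ => hg p.1 p.2), Fintype.sum_prod_type, Finset.mul_sum]
  refine Finset.sum_congr rfl fun β _ => ?_
  rw [Finset.mul_sum]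
  exact Finset.sum_congr rfl fun _ _ => by ring

theorem sum_commCoeff_mulMetric (hΛ : IsUnit Λ.det) (h : LinearIndependent ℝ fun μ => e μ x)
    (he : ∀ μ, DifferentiableAt ℝ (e μ) x) (μ ν l : Fin n) :
    ∑ κ, commCoeff (mulFrame Λ e) μ ν κ x * mulMetric Λ g x κ l
      = rows₃ Λ μ ν l fun α β δ => ∑ κ, commCoeff e α β κ x * g x κ δ := by
  have h1 : ∑ κ, commCoeff (mulFrame Λ e) μ ν κ x * mulMetric Λ g x κ l
      = ∑ γ, (∑ κ, commCoeff (mulFrame Λ e) μ ν κ x * Λ κ γ) * ∑ δ, g x γ δ * Λ l δ := by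
    simp only [mulMetric_apply, Finset.mul_sum, Finset.sum_mul]
    rw [Finset.sum_comm]
    refine Finset.sum_congr rfl fun γ _ => ?_
    rw [Finset.sum_comm]
    exact Finset.sum_congr rfl fun _ _ => Finset.sum_congr rfl fun _ _ => by ring
  rw [h1]
  simp only [commCoeff_mulFrame hΛ h he, rows₃]
  have h2 : ∀ γ, (∑ α, ∑ β, Λ μ α * Λ ν β * commCoeff e α β γ x) * ∑ δ, g x γ δ * Λ l δ
      = ∑ δ, ∑ α, ∑ β, Λ μ α * Λ ν β * Λ l δ * (commCoeff e α β γ x * g x γ δ) := fun γ => by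
    rw [Finset.mul_sum]
    refine Finset.sum_congr rfl fun δ _ => ?_
    simp only [Finset.sum_mul]
    exact Finset.sum_congr rfl fun _ _ => Finset.sum_congr rfl fun _ _ => by ring
  simp only [h2]
  rw [sum_comm₄]
  refine Finset.sum_congr rfl fun α _ => Finset.sum_congr rfl fun β _ => ?_
  rw [Finset.sum_comm]
  simp only [Finset.mul_sum]

theorem sum_mul_rows₃ (c : Fin n → ℝ) (μ ν : Fin n) (X : Fin n → Fin n → Fin n → ℝ) :
    ∑ l, c l * rows₃ Λ l μ ν X
      = ∑ α, ∑ β, Λ μ α * Λ ν β * ∑ δ, (∑ l, c l * Λ l δ) * X δ α β := by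
  have h : ∀ l, c l * rows₃ Λ l μ ν X
      = ∑ δ, ∑ α, ∑ β, Λ μ α * Λ ν β * (c l * Λ l δ * X δ α β) := fun l => by
    simp only [rows₃, Finset.mul_sum]
    exact Finset.sum_congr rfl fun _ _ => Finset.sum_congr rfl fun _ _ =>
      Finset.sum_congr rfl fun _ _ => by ring
  simp only [h]
  rw [sum_comm₄]
  refine Finset.sum_congr rfl fun α _ => Finset.sum_congr rfl fun β _ => ?_
  rw [Finset.sum_comm]
  simp only [Finset.mul_sum, Finset.sum_mul]

theorem IsRegularOn.differentiableAt_frame (h : IsRegularOn e g s) (hx : x ∈ s) (μ : Fin n) :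
    DifferentiableAt ℝ (e μ) x :=
  differentiableAt_of_contDiffOn h.isOpen (h.frame μ) hx

theorem IsRegularOn.differentiableAt_metric (h : IsRegularOn e g s) (hx : x ∈ s) (μ ν : Fin n) :
    DifferentiableAt ℝ (fun y => g y μ ν) x :=
  differentiableAt_of_contDiffOn h.isOpen (h.metric μ ν) hx

/-- Each of the six terms of the Koszul formula is a three-index array contracted with three rows of
`Λ`, but in its own order of the indices. The swaps bring all of them to the order `l, μ, ν`, where
they can be added. -/
theorem IsRegularOn.connLower_mul (hΛ : IsUnit Λ.det) (h : IsRegularOn e g s) (hx : x ∈ s)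
    (l μ ν : Fin n) :
    connLower (mulFrame Λ e) (mulMetric Λ g) l μ ν x
      = rows₃ Λ l μ ν fun δ α β => connLower e g δ α β x := by
  have hg := h.differentiableAt_metric hx
  have hi := h.indep x hx
  have he := h.differentiableAt_frame hx
  unfold connLower
  rw [frameDeriv_mulMetric hg, frameDeriv_mulMetric hg, frameDeriv_mulMetric hg,
    Finset.sum_sub_distrib, Finset.sum_sub_distrib, sum_commCoeff_mulMetric hΛ hi he,
    sum_commCoeff_mulMetric hΛ hi he, sum_commCoeff_mulMetric hΛ hi he,
    rows₃_swap_right μ ν l, rows₃_swap_left μ l ν,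
    rows₃_swap_right ν μ l, rows₃_swap_left ν l μ, rows₃_swap_right l ν μ,
    rows₃_swap_right μ ν l, rows₃_swap_left μ l ν, rows₃_swap_left μ l ν,
    rows₃_swap_left ν l μ, rows₃_swap_right l ν μ, rows₃_add, rows₃_sub, rows₃_sub, rows₃_sub,
    rows₃_add, mul_rows₃]
  simp only [Finset.sum_sub_distrib]

theorem mulMetric_inv (hΛ : IsUnit Λ.det) (x : Pt n) :
    Λᵀ * (mulMetric Λ g x)⁻¹ = (g x)⁻¹ * Λ⁻¹ := by
  rw [mulMetric, Matrix.mul_inv_rev, Matrix.mul_inv_rev, ← Matrix.mul_assoc,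
    Matrix.mul_nonsing_inv _ (by rwa [Matrix.det_transpose]), Matrix.one_mul]

/-- Raising the index with the inverse of the new metric brings in `(Λᵀ)⁻¹`, which the contraction
with `Λ` on the left cancels. -/
theorem IsRegularOn.conn_mul (hΛ : IsUnit Λ.det) (h : IsRegularOn e g s) (hx : x ∈ s)
    (γ μ ν : Fin n) :
    ∑ κ, conn (mulFrame Λ e) (mulMetric Λ g) κ μ ν x * Λ κ γ
      = ∑ α, ∑ β, Λ μ α * Λ ν β * conn e g γ α β x := by
  have h1 : ∑ κ, conn (mulFrame Λ e) (mulMetric Λ g) κ μ ν x * Λ κ γ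
      = ∑ l, (Λᵀ * (mulMetric Λ g x)⁻¹) γ l * connLower (mulFrame Λ e) (mulMetric Λ g) l μ ν x := by
    simp only [conn, Matrix.mul_apply, Finset.sum_mul]
    rw [Finset.sum_comm]
    exact Finset.sum_congr rfl fun _ _ => Finset.sum_congr rfl fun _ _ => by
      rw [Matrix.transpose_apply]; ring
  have h2 : ∀ δ, ∑ l, ((g x)⁻¹ * Λ⁻¹) γ l * Λ l δ = (g x)⁻¹ γ δ := fun δ => by
    have : ((g x)⁻¹ * Λ⁻¹ * Λ) γ δ = (g x)⁻¹ γ δ := by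
      rw [Matrix.mul_assoc, Matrix.nonsing_inv_mul _ hΛ, Matrix.mul_one]
    rwa [Matrix.mul_apply] at this
  rw [h1, mulMetric_inv hΛ]
  simp only [h.connLower_mul hΛ hx]
  rw [sum_mul_rows₃]
  simp only [h2, conn]

theorem sum_mul_mul_eq {c d : Fin n → ℝ} {M : Fin n → Fin n → ℝ}
    (h : ∀ γ, ∑ κ, c κ * Λ κ γ = d γ) (γ : Fin n) :
    ∑ κ, c κ * ∑ α, Λ κ α * M α γ = ∑ α, d α * M α γ := by
  simp only [← h, Finset.mul_sum, Finset.sum_mul]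
  rw [Finset.sum_comm]
  exact Finset.sum_congr rfl fun _ _ => Finset.sum_congr rfl fun _ _ => by ring

theorem IsRegularOn.conn_quadratic_mul (hΛ : IsUnit Λ.det) (h : IsRegularOn e g s) (hx : x ∈ s)
    (γ σ μ ν : Fin n) :
    ∑ κ, (∑ l, conn (mulFrame Λ e) (mulMetric Λ g) l ν σ x
        * conn (mulFrame Λ e) (mulMetric Λ g) κ μ l x) * Λ κ γ
      = rows₃ Λ σ μ ν fun δ α β => ∑ l, conn e g l β δ x * conn e g γ α l x := by
  have h1 : ∑ κ, (∑ l, conn (mulFrame Λ e) (mulMetric Λ g) l ν σ x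
        * conn (mulFrame Λ e) (mulMetric Λ g) κ μ l x) * Λ κ γ
      = ∑ l, conn (mulFrame Λ e) (mulMetric Λ g) l ν σ x
        * ∑ β, Λ l β * (∑ α, Λ μ α * conn e g γ α β x) := by
    have h2 : ∀ l, ∑ β, Λ l β * (∑ α, Λ μ α * conn e g γ α β x)
        = ∑ κ, conn (mulFrame Λ e) (mulMetric Λ g) κ μ l x * Λ κ γ := fun l => by
      rw [h.conn_mul hΛ hx]
      simp only [Finset.mul_sum]
      rw [Finset.sum_comm]
      exact Finset.sum_congr rfl fun _ _ => Finset.sum_congr rfl fun _ _ => by ring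
    simp only [h2]
    simp only [Finset.sum_mul, Finset.mul_sum]
    rw [Finset.sum_comm]
    exact Finset.sum_congr rfl fun _ _ => Finset.sum_congr rfl fun _ _ => by ring
  rw [h1, sum_mul_mul_eq (M := fun β γ => ∑ α, Λ μ α * conn e g γ α β x)
    (fun δ => h.conn_mul hΛ hx δ ν σ)]
  have h3 : ∀ l, (∑ β, ∑ δ, Λ ν β * Λ σ δ * conn e g l β δ x) * ∑ α, Λ μ α * conn e g γ α l x
      = ∑ α, ∑ β, ∑ δ, Λ σ δ * Λ μ α * Λ ν β * (conn e g l β δ x * conn e g γ α l x) := fun l => by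
    rw [Finset.mul_sum]
    refine Finset.sum_congr rfl fun α _ => ?_
    simp only [Finset.sum_mul]
    exact Finset.sum_congr rfl fun _ _ => Finset.sum_congr rfl fun _ _ => by ring
  simp only [h3, rows₃]
  rw [sum_comm₃]
  simp_rw [fun α β => Finset.sum_comm (s := (Finset.univ : Finset (Fin n)))
    (t := (Finset.univ : Finset (Fin n)))
    (f := fun l δ => Λ σ δ * Λ μ α * Λ ν β * (conn e g l β δ x * conn e g γ α l x))]
  rw [← sum_comm₃ fun δ α β => ∑ l,
    Λ σ δ * Λ μ α * Λ ν β * (conn e g l β δ x * conn e g γ α l x)]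
  simp only [Finset.mul_sum]

theorem IsRegularOn.comm_conn_mul (hΛ : IsUnit Λ.det) (h : IsRegularOn e g s) (hx : x ∈ s)
    (γ σ μ ν : Fin n) :
    ∑ κ, (∑ l, commCoeff (mulFrame Λ e) μ ν l x
        * conn (mulFrame Λ e) (mulMetric Λ g) κ l σ x) * Λ κ γ
      = rows₃ Λ σ μ ν fun δ α β => ∑ l, commCoeff e α β l x * conn e g γ l δ x := by
  have h1 : ∑ κ, (∑ l, commCoeff (mulFrame Λ e) μ ν l x
        * conn (mulFrame Λ e) (mulMetric Λ g) κ l σ x) * Λ κ γ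
      = ∑ l, commCoeff (mulFrame Λ e) μ ν l x
        * ∑ β, Λ l β * (∑ α, Λ σ α * conn e g γ β α x) := by
    have h2 : ∀ l, ∑ β, Λ l β * (∑ α, Λ σ α * conn e g γ β α x)
        = ∑ κ, conn (mulFrame Λ e) (mulMetric Λ g) κ l σ x * Λ κ γ := fun l => by
      rw [h.conn_mul hΛ hx]
      simp only [Finset.mul_sum]
      exact Finset.sum_congr rfl fun _ _ => Finset.sum_congr rfl fun _ _ => by ring
    simp only [h2]
    simp only [Finset.sum_mul, Finset.mul_sum]
    rw [Finset.sum_comm]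
    exact Finset.sum_congr rfl fun _ _ => Finset.sum_congr rfl fun _ _ => by ring
  rw [h1, sum_mul_mul_eq (M := fun β γ => ∑ α, Λ σ α * conn e g γ β α x)
    (fun δ => commCoeff_mulFrame hΛ (h.indep x hx) (h.differentiableAt_frame hx) μ ν δ)]
  have h3 : ∀ l, (∑ α, ∑ β, Λ μ α * Λ ν β * commCoeff e α β l x) * ∑ δ, Λ σ δ * conn e g γ l δ x
      = ∑ δ, ∑ α, ∑ β, Λ σ δ * Λ μ α * Λ ν β * (commCoeff e α β l x * conn e g γ l δ x) :=
    fun l => by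
    rw [Finset.mul_sum]
    refine Finset.sum_congr rfl fun α _ => ?_
    simp only [Finset.sum_mul]
    exact Finset.sum_congr rfl fun _ _ => Finset.sum_congr rfl fun _ _ => by ring
  simp only [h3, rows₃]
  rw [sum_comm₃]
  refine Finset.sum_congr rfl fun δ _ => ?_
  have h4 : ∀ α, (∑ l, ∑ β, Λ σ δ * Λ μ α * Λ ν β * (commCoeff e α β l x * conn e g γ l δ x))
      = ∑ β, Λ σ δ * Λ μ α * Λ ν β * ∑ l, commCoeff e α β l x * conn e g γ l δ x := fun α => by
    rw [Finset.sum_comm]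
    simp only [Finset.mul_sum]
  exact Finset.sum_congr rfl fun α _ => h4 α

theorem IsRegularOn.frameDeriv_conn_mul (hΛ : IsUnit Λ.det) (h : IsRegularOn e g s) (hx : x ∈ s)
    (γ σ μ ν : Fin n) :
    ∑ κ, frameDeriv (mulFrame Λ e) (conn (mulFrame Λ e) (mulMetric Λ g) κ ν σ) μ x * Λ κ γ
      = rows₃ Λ σ μ ν fun δ α β => frameDeriv e (conn e g γ β δ) α x := by
  have h1 : ∑ κ, frameDeriv (mulFrame Λ e) (conn (mulFrame Λ e) (mulMetric Λ g) κ ν σ) μ x * Λ κ γ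
      = frameDeriv (mulFrame Λ e)
        (fun y => ∑ κ, Λ κ γ * conn (mulFrame Λ e) (mulMetric Λ g) κ ν σ y) μ x := by
    rw [frameDeriv_sum _ _ fun κ _ => (h.mul hΛ).differentiableAt_conn κ ν σ hx]
    exact Finset.sum_congr rfl fun _ _ => mul_comm _ _
  -- The law for the connection holds on the whole open set, hence near `x`, and may be
  -- differentiated there.
  have h2 : (fun y => ∑ κ, Λ κ γ * conn (mulFrame Λ e) (mulMetric Λ g) κ ν σ y)
      =ᶠ[nhds x] fun y => ∑ p : Fin n × Fin n, (Λ ν p.1 * Λ σ p.2) * conn e g γ p.1 p.2 y := by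
    filter_upwards [h.isOpen.mem_nhds hx] with y hy
    rw [Fintype.sum_prod_type, ← h.conn_mul hΛ hy]
    exact Finset.sum_congr rfl fun _ _ => mul_comm _ _
  rw [h1, frameDeriv, h2.fderiv_eq, ← frameDeriv, frameDeriv_mulFrame]
  have h3 : ∀ α, frameDeriv e
      (fun y => ∑ p : Fin n × Fin n, (Λ ν p.1 * Λ σ p.2) * conn e g γ p.1 p.2 y) α x
      = ∑ β, ∑ δ, Λ ν β * Λ σ δ * frameDeriv e (conn e g γ β δ) α x := fun α => by
    rw [frameDeriv_sum _ _ fun p _ => h.differentiableAt_conn γ p.1 p.2 hx, Fintype.sum_prod_type]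
  simp only [h3, rows₃, Finset.mul_sum]
  rw [sum_comm₃ fun δ α β => Λ σ δ * Λ μ α * Λ ν β * frameDeriv e (conn e g γ β δ) α x]
  exact Finset.sum_congr rfl fun _ _ => Finset.sum_congr rfl fun _ _ =>
    Finset.sum_congr rfl fun _ _ => by ring

/-- With constant `Λ` the five pieces of the curvature (two derivatives, two products, one
commutator term) transform separately, so no inhomogeneous terms have to cancel. -/
theorem IsRegularOn.riemann_mul (hΛ : IsUnit Λ.det) (h : IsRegularOn e g s) (hx : x ∈ s)
    (γ σ μ ν : Fin n) :
    ∑ κ, riemann (mulFrame Λ e) (mulMetric Λ g) κ σ μ ν x * Λ κ γ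
      = rows₃ Λ σ μ ν fun δ α β => riemann e g γ δ α β x := by
  have e1 : ∀ (e : Fin n → Pt n → Pt n) (g : Pt n → Matrix (Fin n) (Fin n) ℝ) (κ σ μ ν : Fin n),
      riemann e g κ σ μ ν x = frameDeriv e (conn e g κ ν σ) μ x - frameDeriv e (conn e g κ μ σ) ν x
      + ∑ l, conn e g l ν σ x * conn e g κ μ l x - ∑ l, conn e g l μ σ x * conn e g κ ν l x
      - ∑ l, commCoeff e μ ν l x * conn e g κ l σ x := fun e g κ σ μ ν => by
    simp only [riemann, Finset.sum_sub_distrib]; ring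
  simp only [e1, add_mul, sub_mul, Finset.sum_add_distrib, Finset.sum_sub_distrib]
  rw [h.frameDeriv_conn_mul hΛ hx, h.frameDeriv_conn_mul hΛ hx, h.conn_quadratic_mul hΛ hx,
    h.conn_quadratic_mul hΛ hx, h.comm_conn_mul hΛ hx, rows₃_swap_right σ ν μ,
    rows₃_swap_right σ ν μ, rows₃_sub, rows₃_add, rows₃_sub, rows₃_sub]

/-- The upper index is freed by `Λ⁻¹`; in the trace this inverse meets the row of `Λ` belonging to
the index it is traced with. -/
theorem IsRegularOn.ricci_mul (hΛ : IsUnit Λ.det) (h : IsRegularOn e g s) (hx : x ∈ s)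
    (σ ν : Fin n) :
    ricci (mulFrame Λ e) (mulMetric Λ g) σ ν x
      = ∑ δ, ∑ β, Λ σ δ * Λ ν β * ricci e g δ β x := by
  have h1 : ∀ μ, riemann (mulFrame Λ e) (mulMetric Λ g) μ σ μ ν x
      = ∑ γ, Λ⁻¹ γ μ * rows₃ Λ μ σ ν fun α δ β => riemann e g γ δ α β x := fun μ => by
    have h2 : ∀ γ, rows₃ Λ μ σ ν (fun α δ β => riemann e g γ δ α β x)
        = ∑ κ, riemann (mulFrame Λ e) (mulMetric Λ g) κ σ μ ν x * Λ κ γ := fun γ => by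
      rw [h.riemann_mul hΛ hx, rows₃_swap_left]
    simp only [h2, Finset.mul_sum]
    rw [Finset.sum_comm]
    have h3 : ∀ κ, ∑ γ, Λ⁻¹ γ μ * (riemann (mulFrame Λ e) (mulMetric Λ g) κ σ μ ν x * Λ κ γ)
        = riemann (mulFrame Λ e) (mulMetric Λ g) κ σ μ ν x * if κ = μ then 1 else 0 := fun κ => by
      rw [← sum_mul_inv_apply hΛ, Finset.mul_sum]
      exact Finset.sum_congr rfl fun _ _ => by ring
    simp [h3]
  simp only [ricci, h1]
  rw [Finset.sum_comm]
  simp only [sum_mul_rows₃, sum_inv_mul_apply hΛ]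
  rw [sum_comm₃]
  refine Finset.sum_congr rfl fun δ _ => Finset.sum_congr rfl fun β _ => ?_
  simp [Finset.mul_sum]

theorem sum_mulMetric_inv_mul (hΛ : IsUnit Λ.det) (T : Fin n → Fin n → ℝ) :
    ∑ μ, ∑ ν, (mulMetric Λ g x)⁻¹ μ ν * ∑ α, ∑ β, Λ μ α * Λ ν β * T α β
      = ∑ α, ∑ β, (g x)⁻¹ α β * T α β := by
  have h1 : Λᵀ * (mulMetric Λ g x)⁻¹ * Λ = (g x)⁻¹ := by
    rw [mulMetric_inv hΛ, Matrix.mul_assoc, Matrix.nonsing_inv_mul _ hΛ, Matrix.mul_one]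
  simp only [← h1, Matrix.mul_apply, Matrix.transpose_apply, Finset.mul_sum, Finset.sum_mul]
  rw [sum_comm₄]
  refine Finset.sum_congr rfl fun α _ => Finset.sum_congr rfl fun β _ => ?_
  rw [Finset.sum_comm]
  exact Finset.sum_congr rfl fun _ _ => Finset.sum_congr rfl fun _ _ => by ring

theorem IsRegularOn.scalarCurv_mul (hΛ : IsUnit Λ.det) (h : IsRegularOn e g s) (hx : x ∈ s) :
    scalarCurv (mulFrame Λ e) (mulMetric Λ g) x = scalarCurv e g x := by
  simp only [scalarCurv, h.ricci_mul hΛ hx]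
  exact sum_mulMetric_inv_mul hΛ _

theorem IsRegularOn.einstein_mul (hΛ : IsUnit Λ.det) (h : IsRegularOn e g s) (hx : x ∈ s)
    (μ ν : Fin n) :
    einstein (mulFrame Λ e) (mulMetric Λ g) μ ν x
      = ∑ α, ∑ β, Λ μ α * Λ ν β * einstein e g α β x := by
  simp only [einstein, h.ricci_mul hΛ hx, h.scalarCurv_mul hΛ hx, mulMetric_apply, mul_sub,
    Finset.sum_sub_distrib, Finset.mul_sum]
  congr 1
  exact Finset.sum_congr rfl fun _ _ => Finset.sum_congr rfl fun _ _ => by ring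

end ChangeOfFrame

end ShearFree

/-! ### Forms, stress tensors and Lie derivatives under a constant change of frame. -/

namespace ShearFree

section Forms

variable {n : ℕ} {Λ : Matrix (Fin n) (Fin n) ℝ} {e : Fin n → Pt n → Pt n}
  {g : Pt n → Matrix (Fin n) (Fin n) ℝ} {s : Set (Pt n)} {x : Pt n} {k : ℕ}

/-- Components of a covariant tensor field in the frame `mulFrame Λ e`. -/
def mulTensor (Λ : Matrix (Fin n) (Fin n) ℝ) (T : (Fin k → Fin n) → Pt n → ℝ)
    (J : Fin k → Fin n) (x : Pt n) : ℝ :=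
  mulForm Λ (fun K => T K x) J

theorem sum_fin_fun_succ (i : Fin (k + 1)) (f : (Fin (k + 1) → Fin n) → ℝ) :
    ∑ K, f K = ∑ a, ∑ K : Fin k → Fin n, f (i.insertNth a K) := by
  rw [← Fintype.sum_prod_type' (f := fun a K => f (i.insertNth a K))]
  exact (Fintype.sum_equiv (Fin.insertNthEquiv (fun _ => Fin n) i) _ _ fun p => rfl).symm

theorem sum_fin_fun_cons (f : (Fin (k + 1) → Fin n) → ℝ) :
    ∑ K, f K = ∑ a, ∑ K : Fin k → Fin n, f (Fin.cons a K) := by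
  rw [sum_fin_fun_succ 0]
  simp

theorem mulForm_zero (J : Fin k → Fin n) : mulForm Λ (0 : (Fin k → Fin n) → ℝ) J = 0 := by
  simp [mulForm]

theorem mulForm_cons (F : (Fin (k + 1) → Fin n) → ℝ) (μ : Fin n) (J : Fin k → Fin n) :
    mulForm Λ F (Fin.cons μ J) = ∑ ν, Λ μ ν * mulForm Λ (fun K => F (Fin.cons ν K)) J := by
  simp only [mulForm, sum_fin_fun_cons, Finset.mul_sum, Fin.prod_univ_succ, Fin.cons_zero,
    Fin.cons_succ]
  exact Finset.sum_congr rfl fun _ _ => Finset.sum_congr rfl fun _ _ => by ring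

theorem prod_update_eq (f : Fin k → Fin n → ℝ) (J : Fin k → Fin n) (i : Fin k) (κ : Fin n) :
    ∏ j, f j (Function.update J i κ j) = f i κ * ∏ j ∈ Finset.univ.erase i, f j (J j) := by
  rw [← Finset.mul_prod_erase _ _ (Finset.mem_univ i), Function.update_self]
  congr 1
  exact Finset.prod_congr rfl fun j hj => by
    rw [Function.update_of_ne (Finset.ne_of_mem_erase hj)]

/-- Exchanging the entry `K i` with `κ` is an involution of the pairs `(K, κ)`. It moves a
connection coefficient from one slot of a tensor to the transformed slot. -/
theorem sum_update_comm (i : Fin k) (f : (Fin k → Fin n) → Fin n → ℝ) :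
    ∑ K : Fin k → Fin n, ∑ κ, f K κ
      = ∑ K : Fin k → Fin n, ∑ κ, f (Function.update K i κ) (K i) := by
  rw [← Fintype.sum_prod_type', ← Fintype.sum_prod_type'
    (f := fun K κ => f (Function.update K i κ) (K i))]
  refine (Fintype.sum_equiv ⟨fun p => (Function.update p.1 i p.2, p.1 i),
    fun p => (Function.update p.1 i p.2, p.1 i), fun p => ?_, fun p => ?_⟩ _ _ fun p => ?_).symm
  · simp
  · simp
  · rfl

theorem IsRegularOn.covD_mul (hΛ : IsUnit Λ.det) (h : IsRegularOn e g s) (hx : x ∈ s)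
    {T : (Fin k → Fin n) → Pt n → ℝ} (hT : ∀ K, DifferentiableAt ℝ (T K) x) (μ : Fin n)
    (J : Fin k → Fin n) :
    covD (mulFrame Λ e) (mulMetric Λ g) (mulTensor Λ T) μ J x
      = ∑ ν, Λ μ ν * mulForm Λ (fun K => covD e g T ν K x) J := by
  have h1 : frameDeriv (mulFrame Λ e) (mulTensor Λ T J) μ x
      = ∑ ν, Λ μ ν * mulForm Λ (fun K => frameDeriv e (T K) ν x) J := by
    rw [frameDeriv_mulFrame]
    refine Finset.sum_congr rfl fun ν _ => ?_
    congr 1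
    exact frameDeriv_sum Finset.univ (fun K => ∏ i, Λ (J i) (K i)) (fun K _ => hT K) ν
  have h2 : ∀ i, ∑ κ, conn (mulFrame Λ e) (mulMetric Λ g) κ μ (J i) x
        * mulTensor Λ T (Function.update J i κ) x
      = ∑ ν, Λ μ ν * mulForm Λ
        (fun K => ∑ κ, conn e g κ ν (K i) x * T (Function.update K i κ) x) J := fun i => by
    have h3 : ∀ κ, mulTensor Λ T (Function.update J i κ) x
        = ∑ K : Fin k → Fin n, Λ κ (K i) * ((∏ j ∈ Finset.univ.erase i, Λ (J j) (K j)) * T K x) :=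
      fun κ => by
      simp only [mulTensor, mulForm]
      refine Finset.sum_congr rfl fun K _ => ?_
      rw [prod_update_eq (fun j a => Λ a (K j)) J i κ, mul_assoc]
    have h4 : ∑ κ, conn (mulFrame Λ e) (mulMetric Λ g) κ μ (J i) x
        * mulTensor Λ T (Function.update J i κ) x
        = ∑ K : Fin k → Fin n, (∑ κ, conn (mulFrame Λ e) (mulMetric Λ g) κ μ (J i) x * Λ κ (K i))
          * ((∏ j ∈ Finset.univ.erase i, Λ (J j) (K j)) * T K x) := by
      simp only [h3, Finset.mul_sum, Finset.sum_mul]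
      rw [Finset.sum_comm]
      exact Finset.sum_congr rfl fun _ _ => Finset.sum_congr rfl fun _ _ => by ring
    rw [h4]
    simp only [h.conn_mul hΛ hx, Finset.sum_mul]
    rw [sum_comm₃, ]
    rw [show (∑ b, ∑ c, ∑ a : Fin k → Fin n, Λ μ b * Λ (J i) c * conn e g (a i) b c x
        * ((∏ j ∈ Finset.univ.erase i, Λ (J j) (a j)) * T a x))
      = ∑ b, Λ μ b * ∑ a : Fin k → Fin n, ∑ c, Λ (J i) c * conn e g (a i) b c x
        * ((∏ j ∈ Finset.univ.erase i, Λ (J j) (a j)) * T a x) from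
      Finset.sum_congr rfl fun b _ => by
        rw [Finset.sum_comm, Finset.mul_sum]
        refine Finset.sum_congr rfl fun _ _ => ?_
        rw [Finset.mul_sum]
        exact Finset.sum_congr rfl fun _ _ => by ring]
    refine Finset.sum_congr rfl fun ν _ => ?_
    congr 1
    rw [sum_update_comm i]
    simp only [mulForm, Finset.mul_sum]
    refine Finset.sum_congr rfl fun K _ => Finset.sum_congr rfl fun κ _ => ?_
    rw [Function.update_self, ← Finset.mul_prod_erase _ _ (Finset.mem_univ i)]
    have h5 : ∏ j ∈ Finset.univ.erase i, Λ (J j) (Function.update K i κ j)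
        = ∏ j ∈ Finset.univ.erase i, Λ (J j) (K j) :=
      Finset.prod_congr rfl fun j hj => by
        rw [Function.update_of_ne (Finset.ne_of_mem_erase hj)]
    rw [h5]
    ring
  rw [covD, h1]
  simp only [h2]
  rw [Finset.sum_comm, ← Finset.sum_sub_distrib]
  refine Finset.sum_congr rfl fun ν _ => ?_
  rw [← Finset.mul_sum, ← mul_sub]
  congr 1
  simp only [mulForm, covD, mul_sub, Finset.sum_sub_distrib, Finset.mul_sum]
  congr 1
  rw [Finset.sum_comm]

theorem IsRegularOn.extD_mul (hΛ : IsUnit Λ.det) (h : IsRegularOn e g s) (hx : x ∈ s)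
    {T : (Fin k → Fin n) → Pt n → ℝ} (hT : ∀ K, DifferentiableAt ℝ (T K) x)
    (I : Fin (k + 1) → Fin n) :
    extD (mulFrame Λ e) (mulMetric Λ g) (mulTensor Λ T) I x
      = mulForm Λ (fun K => extD e g T K x) I := by
  simp only [extD, h.covD_mul hΛ hx hT, mulForm, Finset.mul_sum]
  rw [Finset.sum_comm (t := (Finset.univ : Finset (Fin (k + 1))))]
  refine Finset.sum_congr rfl fun i _ => ?_
  -- The summed tuple is split at slot `i`, the one taken by the direction of differentiation in the
  -- `i`-th term.
  rw [sum_fin_fun_succ i]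
  refine Finset.sum_congr rfl fun a _ => Finset.sum_congr rfl fun K _ => ?_
  rw [Fin.prod_univ_succAbove _ i]
  simp only [Fin.insertNth_apply_same, Fin.insertNth_apply_succAbove]
  ring

theorem mulForm_linear {ι : Type*} (t : Finset ι) (c : ι → ℝ) (F : ι → (Fin k → Fin n) → ℝ)
    (J : Fin k → Fin n) :
    ∑ i ∈ t, c i * mulForm Λ (F i) J = mulForm Λ (fun K => ∑ i ∈ t, c i * F i K) J := by
  simp only [mulForm, Finset.mul_sum]
  rw [Finset.sum_comm]
  exact Finset.sum_congr rfl fun _ _ => Finset.sum_congr rfl fun _ _ => by ring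

theorem IsRegularOn.diverg_mul (hΛ : IsUnit Λ.det) (h : IsRegularOn e g s) (hx : x ∈ s)
    {T : (Fin (k + 1) → Fin n) → Pt n → ℝ} (hT : ∀ K, DifferentiableAt ℝ (T K) x)
    (J : Fin k → Fin n) :
    diverg (mulFrame Λ e) (mulMetric Λ g) (mulTensor Λ T) J x
      = mulForm Λ (fun K => diverg e g T K x) J := by
  have h1 : ∀ μ ν, covD (mulFrame Λ e) (mulMetric Λ g) (mulTensor Λ T) μ (Fin.cons ν J) x
      = ∑ α, ∑ β, Λ μ α * Λ ν β * mulForm Λ (fun K => covD e g T α (Fin.cons β K) x) J :=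
    fun μ ν => by
    rw [h.covD_mul hΛ hx hT]
    simp only [mulForm_cons, Finset.mul_sum, mul_assoc]
  simp only [diverg, h1]
  rw [sum_mulMetric_inv_mul hΛ]
  simp only [mulForm_linear]
  have := mulForm_linear (Λ := Λ) Finset.univ (fun _ : Fin n => 1)
    (fun α K => ∑ β, (g x)⁻¹ α β * covD e g T α (Fin.cons β K) x) J
  simpa using this

/-- Every pair of slots contributes one factor `Λᵀ g'⁻¹ Λ = g⁻¹`; the full contraction is the
product of these over the slots. -/
theorem contract_mulForm {g : Matrix (Fin 4) (Fin 4) ℝ} {Λ : Matrix (Fin 4) (Fin 4) ℝ}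
    (hΛ : IsUnit Λ.det) (F G : (Fin k → Fin 4) → ℝ) :
    contract (Λ * g * Λᵀ) (mulForm Λ F) (mulForm Λ G) = contract g F G := by
  have h0 : Λᵀ * (Λ * g * Λᵀ)⁻¹ * Λ = g⁻¹ := by
    have := mulMetric_inv (g := fun _ => g) hΛ 0
    rw [mulMetric] at this
    rw [this, Matrix.mul_assoc, Matrix.nonsing_inv_mul _ hΛ, Matrix.mul_one]
  have h1 : ∀ K L : Fin k → Fin 4, ∑ I : Fin k → Fin 4, ∑ J : Fin k → Fin 4,
      (∏ i, (Λ * g * Λᵀ)⁻¹ (I i) (J i)) * (∏ i, Λ (I i) (K i)) * ∏ i, Λ (J i) (L i)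
      = ∏ i, g⁻¹ (K i) (L i) := fun K L => by
    have h2 : ∀ i, g⁻¹ (K i) (L i)
        = ∑ a, ∑ b, (Λ * g * Λᵀ)⁻¹ a b * Λ a (K i) * Λ b (L i) := fun i => by
      rw [← h0]
      simp only [Matrix.mul_apply (M := Λᵀ * _), Matrix.mul_apply (M := Λᵀ),
        Matrix.transpose_apply, Finset.sum_mul]
      rw [Finset.sum_comm]
      exact Finset.sum_congr rfl fun _ _ => Finset.sum_congr rfl fun _ _ => by ring
    simp only [h2]
    -- A product of sums over the slots becomes a sum over index tuples, first for `I` and then for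
    -- `J`.
    rw [Finset.prod_univ_sum, Fintype.piFinset_univ]
    refine Finset.sum_congr rfl fun I _ => ?_
    rw [Finset.prod_univ_sum, Fintype.piFinset_univ]
    exact Finset.sum_congr rfl fun J _ => by simp only [Finset.prod_mul_distrib]
  unfold contract
  simp only [← h1]
  simp only [mulForm, Finset.mul_sum, Finset.sum_mul]
  rw [sum_comm₄]
  have h3 : ∀ (K L I J : Fin k → Fin 4),
      (∏ i, (Λ * g * Λᵀ)⁻¹ (I i) (J i)) * ((∏ i, Λ (I i) (K i)) * F K)
        * ((∏ i, Λ (J i) (L i)) * G L)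
      = (∏ i, (Λ * g * Λᵀ)⁻¹ (I i) (J i)) * (∏ i, Λ (I i) (K i)) * (∏ i, Λ (J i) (L i))
        * F K * G L := fun _ _ _ _ => by ring
  simp only [h3]
  rw [Finset.sum_comm]

theorem contract_sum_left {ι : Type*} [Fintype ι] (g : Matrix (Fin 4) (Fin 4) ℝ) (c : ι → ℝ)
    (F : ι → (Fin k → Fin 4) → ℝ) (G : (Fin k → Fin 4) → ℝ) :
    contract g (fun I => ∑ i, c i * F i I) G = ∑ i, c i * contract g (F i) G := by
  simp only [contract, Finset.mul_sum, Finset.sum_mul]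
  symm
  rw [sum_comm₃]
  exact Finset.sum_congr rfl fun _ _ => Finset.sum_congr rfl fun _ _ =>
    Finset.sum_congr rfl fun _ _ => by ring

theorem contract_sum_right {ι : Type*} [Fintype ι] (g : Matrix (Fin 4) (Fin 4) ℝ) (c : ι → ℝ)
    (F : (Fin k → Fin 4) → ℝ) (G : ι → (Fin k → Fin 4) → ℝ) :
    contract g F (fun I => ∑ i, c i * G i I) = ∑ i, c i * contract g F (G i) := by
  simp only [contract, Finset.mul_sum]
  symm
  rw [sum_comm₃]
  exact Finset.sum_congr rfl fun _ _ => Finset.sum_congr rfl fun _ _ =>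
    Finset.sum_congr rfl fun _ _ => by ring

/-- Stated for any invertible `Λ`, since it serves both for spatial changes of frame and for the
Lorentz boosts in the weak energy condition. -/
theorem emt_mulForm {g Λ : Matrix (Fin 4) (Fin 4) ℝ} (hΛ : IsUnit Λ.det) (p : ℕ) (α : ℝ)
    (F : (Fin (p + 1) → Fin 4) → ℝ) (μ ν : Fin 4) :
    emt p α (Λ * g * Λᵀ) (mulForm Λ F) μ ν = ∑ a, ∑ b, Λ μ a * Λ ν b * emt p α g F a b := by
  have h1 : contract (Λ * g * Λᵀ) (fun I : Fin p → Fin 4 => mulForm Λ F (Fin.cons μ I))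
      (fun I => mulForm Λ F (Fin.cons ν I))
      = ∑ a, ∑ b, Λ μ a * Λ ν b * contract g (fun I : Fin p → Fin 4 => F (Fin.cons a I))
        (fun I => F (Fin.cons b I)) := by
    simp only [mulForm_cons]
    rw [contract_sum_left]
    simp only [contract_sum_right, contract_mulForm hΛ]
    simp only [Finset.mul_sum, mul_assoc]
  have h2 := mulMetric_apply (Λ := Λ) (g := fun _ => g) 0 μ ν
  simp only [mulMetric] at h2
  simp only [emt, h1, h2, contract_mulForm hΛ, Finset.mul_sum, Finset.sum_mul, mul_sub,
    Finset.sum_sub_distrib]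
  congr 1 <;>
  exact Finset.sum_congr rfl fun _ _ => Finset.sum_congr rfl fun _ _ => by ring

theorem sum_frameCoord_lieBracket_mul (hΛ : IsUnit Λ.det)
    (hi : LinearIndependent ℝ fun μ => e μ x) (he : ∀ μ, DifferentiableAt ℝ (e μ) x)
    (ξ : Pt n → Pt n) (μ ν : Fin n) :
    ∑ κ, frameCoord (mulFrame Λ e) x (VectorField.lieBracket ℝ ξ (mulFrame Λ e μ) x) κ
        * mulMetric Λ g x κ ν
      = ∑ α, ∑ β, Λ μ α * Λ ν β
        * ∑ κ, frameCoord e x (VectorField.lieBracket ℝ ξ (e α) x) κ * g x κ β := by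
  have h5 : ∑ κ, frameCoord (mulFrame Λ e) x
      (VectorField.lieBracket ℝ ξ (mulFrame Λ e μ) x) κ * mulMetric Λ g x κ ν
      = ∑ γ, (∑ κ, frameCoord (mulFrame Λ e) x
      (VectorField.lieBracket ℝ ξ (mulFrame Λ e μ) x) κ * Λ κ γ) * ∑ δ, g x γ δ * Λ ν δ := by
    simp only [mulMetric_apply, Finset.mul_sum, Finset.sum_mul]
    rw [Finset.sum_comm]
    refine Finset.sum_congr rfl fun γ _ => ?_
    rw [Finset.sum_comm]
    exact Finset.sum_congr rfl fun _ _ => Finset.sum_congr rfl fun _ _ => by ring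
  rw [h5]
  simp only [frameCoord_mulFrame hΛ hi]
  simp only [lieBracket_mulFrame_right _ he, frameCoord_sum, frameCoord_smul]
  have h6 : ∀ γ, (∑ α, Λ μ α * frameCoord e x (VectorField.lieBracket ℝ ξ (e α) x) γ)
      * ∑ δ, g x γ δ * Λ ν δ = ∑ α, ∑ δ, Λ μ α * Λ ν δ
        * (frameCoord e x (VectorField.lieBracket ℝ ξ (e α) x) γ * g x γ δ) := fun γ => by
    rw [Finset.sum_mul]
    refine Finset.sum_congr rfl fun _ _ => ?_
    rw [Finset.mul_sum]
    exact Finset.sum_congr rfl fun _ _ => by ring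
  simp only [h6]
  rw [sum_comm₃]
  simp only [Finset.mul_sum]

theorem IsRegularOn.lieMetric_mul (hΛ : IsUnit Λ.det) (h : IsRegularOn e g s) (hx : x ∈ s)
    (ξ : Pt n → Pt n) (μ ν : Fin n) :
    lieMetric (mulFrame Λ e) (mulMetric Λ g) ξ μ ν x
      = ∑ α, ∑ β, Λ μ α * Λ ν β * lieMetric e g ξ α β x := by
  have hg := h.differentiableAt_metric hx
  have he := h.differentiableAt_frame hx
  have hi := h.indep x hx
  have h1 : fderiv ℝ (fun y => mulMetric Λ g y μ ν) x (ξ x)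
      = ∑ α, ∑ β, Λ μ α * Λ ν β * fderiv ℝ (fun y => g y α β) x (ξ x) := by
    have h2 : (fun y => mulMetric Λ g y μ ν)
        = fun y => ∑ p : Fin n × Fin n, (Λ μ p.1 * Λ ν p.2) * g y p.1 p.2 := by
      funext y
      rw [mulMetric_apply, Fintype.sum_prod_type]
    have h3 := frameDeriv_sum (e := fun _ => ξ) Finset.univ
      (fun p : Fin n × Fin n => Λ μ p.1 * Λ ν p.2) (fun p _ => hg p.1 p.2) μ
    simp only [frameDeriv] at h3
    rw [h2, h3, Fintype.sum_prod_type]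
  have h2 := fun μ ν => sum_frameCoord_lieBracket_mul hΛ hi he ξ (g := g) μ ν
  -- The second slot of the metric is treated as the first slot of the transpose, so that symmetry
  -- of `g` is not needed.
  have h3 := fun μ ν => sum_frameCoord_lieBracket_mul hΛ hi he ξ (g := fun y => (g y)ᵀ) μ ν
  have h4 : ∀ κ, mulMetric Λ (fun y => (g y)ᵀ) x κ μ = mulMetric Λ g x μ κ := fun κ => by
    have : mulMetric Λ (fun y => (g y)ᵀ) x = (mulMetric Λ g x)ᵀ := by
      simp [mulMetric, Matrix.transpose_mul, Matrix.mul_assoc]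
    rw [this, Matrix.transpose_apply]
  simp only [lieMetric, h1, Finset.sum_add_distrib, h2]
  have h5 := h3 ν μ
  simp only [h4, Matrix.transpose_apply] at h5
  rw [h5]
  simp only [mul_sub, mul_add, Finset.sum_sub_distrib, Finset.sum_add_distrib]
  congr 2
  rw [Finset.sum_comm]
  exact Finset.sum_congr rfl fun _ _ => Finset.sum_congr rfl fun _ _ => by ring

end Forms

end ShearFree

/-! ### Models described in a changed spatial frame. -/

namespace ShearFree

/-- The block diagonal matrix with blocks `c` and `h`. -/
def timeBlock (c : ℝ) (h : Matrix (Fin 3) (Fin 3) ℝ) : Matrix (Fin 4) (Fin 4) ℝ :=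
  Matrix.of fun μ ν => Fin.cases (motive := fun _ => ℝ)
    (Fin.cases (motive := fun _ => ℝ) c (fun _ => 0) ν)
    (fun a => Fin.cases (motive := fun _ => ℝ) 0 (fun b => h a b) ν) μ

section TimeBlock

variable (c d : ℝ) (h k : Matrix (Fin 3) (Fin 3) ℝ) (a b : Fin 3)

@[simp] theorem timeBlock_zero_zero : timeBlock c h 0 0 = c := rfl

@[simp] theorem timeBlock_zero_succ : timeBlock c h 0 a.succ = 0 := rfl

@[simp] theorem timeBlock_succ_zero : timeBlock c h a.succ 0 = 0 := rfl

@[simp] theorem timeBlock_succ_succ : timeBlock c h a.succ b.succ = h a b := rfl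

theorem timeBlock_mul : timeBlock c h * timeBlock d k = timeBlock (c * d) (h * k) := by
  ext μ ν
  refine Fin.cases ?_ (fun a => ?_) μ <;> refine Fin.cases ?_ (fun b => ?_) ν <;>
    simp [Matrix.mul_apply, Fin.sum_univ_succ (n := 3)]

theorem timeBlock_transpose : (timeBlock c h)ᵀ = timeBlock c hᵀ := by
  ext μ ν
  refine Fin.cases ?_ (fun a => ?_) μ <;> refine Fin.cases ?_ (fun b => ?_) ν <;> simp

theorem timeBlock_one : timeBlock 1 1 = 1 := by
  ext μ ν
  refine Fin.cases ?_ (fun a => ?_) μ <;> refine Fin.cases ?_ (fun b => ?_) ν <;>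
    simp [Matrix.one_apply, (Fin.succ_ne_zero _).symm]

variable {c h}

theorem timeBlock_mul_inv (hc : c ≠ 0) (hh : IsUnit h.det) :
    timeBlock c h * timeBlock c⁻¹ h⁻¹ = 1 := by
  rw [timeBlock_mul, mul_inv_cancel₀ hc, Matrix.mul_nonsing_inv _ hh, timeBlock_one]

theorem timeBlock_inv (hc : c ≠ 0) (hh : IsUnit h.det) :
    (timeBlock c h)⁻¹ = timeBlock c⁻¹ h⁻¹ :=
  Matrix.inv_eq_right_inv (timeBlock_mul_inv hc hh)

theorem timeBlock_isUnit_det (hc : c ≠ 0) (hh : IsUnit h.det) : IsUnit (timeBlock c h).det :=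
  Matrix.isUnit_det_of_right_inverse (timeBlock_mul_inv hc hh)

end TimeBlock

/-- `T` is recovered as `Λ⁻¹ (Λ T Λᵀ) (Λᵀ)⁻¹`. This is how a tensor equation found in a convenient
frame returns to the original one. -/
theorem eq_zero_of_sum_mul_mul {n : ℕ} {Λ : Matrix (Fin n) (Fin n) ℝ} (hΛ : IsUnit Λ.det)
    {T : Fin n → Fin n → ℝ} (h : ∀ μ ν, ∑ α, ∑ β, Λ μ α * Λ ν β * T α β = 0) (α β : Fin n) :
    T α β = 0 := by
  have h1 : Λ * Matrix.of T * Λᵀ = 0 := by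
    ext μ ν
    have := mulMetric_apply (Λ := Λ) (g := fun _ => Matrix.of T) 0 μ ν
    simp only [mulMetric] at this
    rw [this]
    simpa using h μ ν
  have h2 : Matrix.of T = Λ⁻¹ * (Λ * Matrix.of T * Λᵀ) * (Λᵀ)⁻¹ := by
    rw [Matrix.mul_assoc Λ⁻¹, Matrix.mul_assoc (Λ * _),
      Matrix.mul_nonsing_inv _ (by rwa [Matrix.det_transpose]), Matrix.mul_one,
      ← Matrix.mul_assoc, Matrix.nonsing_inv_mul _ hΛ, Matrix.one_mul]
  rw [h1] at h2
  simpa using congrFun (congrFun h2 α) β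

theorem IsAlternating.mulForm {k n : ℕ} {F : (Fin k → Fin n) → ℝ} (hF : IsAlternating F)
    (Λ : Matrix (Fin n) (Fin n) ℝ) : IsAlternating (mulForm Λ F) := by
  intro J σ
  simp only [ShearFree.mulForm, Finset.mul_sum]
  refine Fintype.sum_equiv (σ.arrowCongr (Equiv.refl _)) _ _ fun K => ?_
  have h1 : K = fun i => (σ.arrowCongr (Equiv.refl _)) K (σ i) := by
    funext i; simp [Equiv.arrowCongr]
  set K' := (σ.arrowCongr (Equiv.refl _)) K with hK
  rw [h1, hF, Equiv.prod_comp σ (fun i => Λ (J i) (K' i))]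
  ring

namespace SpatialFrame

/-- The frame `L_a^b E_b`. -/
def changeFrame (S : SpatialFrame) (L : Matrix (Fin 3) (Fin 3) ℝ) (hL : IsUnit L.det) :
    SpatialFrame where
  U := S.U
  isOpen := S.isOpen
  isConnected := S.isConnected
  E := mulFrame L S.E
  smooth := mulFrame_contDiffOn S.smooth
  indep x hx := mulFrame_linearIndependent hL (S.indep x hx)

variable (S : SpatialFrame)

theorem e_zero (x : Pt 4) : S.e 0 x = Pi.single 0 1 := rfl

theorem e_succ (a : Fin 3) (x : Pt 4) : S.e a.succ x = Fin.cons (0 : ℝ) (S.E a (Fin.tail x)) := rfl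

theorem differentiableAt_E (a : Fin 3) {y : Pt 3} (hy : y ∈ S.U) : DifferentiableAt ℝ (S.E a) y :=
  differentiableAt_of_contDiffOn S.isOpen (S.smooth a) hy

/-- A spatial change of frame leaves `∂_t` alone, so it acts on spacetime by a block matrix with
entry `1` for time; four-dimensional covariance then applies. -/
theorem changeFrame_e (L : Matrix (Fin 3) (Fin 3) ℝ) (hL : IsUnit L.det) :
    (S.changeFrame L hL).e = mulFrame (timeBlock 1 L) S.e := by
  funext μ x i
  refine Fin.cases ?_ (fun a => ?_) μ <;>
    refine Fin.cases ?_ (fun b => ?_) i <;>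
    simp [mulFrame, Fin.sum_univ_succ (n := 3), e_zero, e_succ, changeFrame]

theorem e_contDiffOn (μ : Fin 4) : ContDiffOn ℝ ∞ (S.e μ) {x | Fin.tail x ∈ S.U} := by
  refine Fin.cases ?_ (fun a => ?_) μ
  · exact contDiffOn_const
  · rw [contDiffOn_pi]
    refine Fin.cases ?_ (fun b => ?_)
    · exact contDiffOn_const
    · have h : ContDiffOn ℝ ∞ (fun x : Pt 4 => S.E a (Fin.tail x)) {x | Fin.tail x ∈ S.U} := by
        refine (S.smooth a).comp (t := S.U) (f := fun x : Pt 4 => Fin.tail x) ?_ fun x hx => hx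
        exact (contDiff_pi.2 fun i => contDiff_apply ℝ ℝ (Fin.succ i)).contDiffOn
      exact contDiffOn_pi.1 h b

theorem e_linearIndependent {x : Pt 4} (hx : Fin.tail x ∈ S.U) :
    LinearIndependent ℝ fun μ => S.e μ x := by
  rw [Fintype.linearIndependent_iff]
  intro c hc
  have h0 : c 0 = 0 := by
    have := congrFun hc 0
    simpa [Fin.sum_univ_succ (n := 3), e_zero, e_succ] using this
  have h1 := Fintype.linearIndependent_iff.1 (S.indep _ hx) (fun a => c a.succ) (by
    funext i
    have := congrFun hc i.succ
    simpa [Fin.sum_univ_succ (n := 3), e_zero, e_succ] using this)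
  exact fun i => Fin.cases h0 h1 i

theorem isRegularOn {h : Matrix (Fin 3) (Fin 3) ℝ} (hh : h.det ≠ 0) :
    IsRegularOn S.E (fun _ => h) S.U where
  isOpen := S.isOpen
  frame := S.smooth
  indep := S.indep
  metric _ _ := contDiffOn_const
  det_ne _ _ := hh

theorem changeFrame_changeFrame_inv (L : Matrix (Fin 3) (Fin 3) ℝ) (hL : IsUnit L.det)
    (hL' : IsUnit (L⁻¹).det) : (S.changeFrame L hL).changeFrame L⁻¹ hL' = S := by
  have : mulFrame L⁻¹ (mulFrame L S.E) = S.E := mulFrame_inv_mulFrame hL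
  cases S
  simp only [changeFrame, this]

/-- Commutators of the frame `L_a^b E_b` of a Bianchi model. -/
theorem IsBianchi.changeFrame {S : SpatialFrame} {C C' : Fin 3 → Fin 3 → Fin 3 → ℝ}
    (hS : S.IsBianchi C) {L : Matrix (Fin 3) (Fin 3) ℝ} (hL : IsUnit L.det)
    (hC : ∀ a b k, ∑ c, C' a b c * L c k = ∑ i, ∑ j, L a i * L b j * C i j k) :
    (S.changeFrame L hL).IsBianchi C' := by
  intro y hy a b c
  have h1 := fun γ => commCoeff_mulFrame hL (S.indep y hy)
    (fun a => S.differentiableAt_E a hy) a b γ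
  have h2 : (fun c => commCoeff (mulFrame L S.E) a b c y) = fun c => - C' a b c :=
    eq_of_sum_mul_eq hL fun γ => by
      rw [h1]
      simp only [hS y hy, neg_mul, Finset.sum_neg_distrib, hC, mul_neg]
  exact congrFun h2 c

/-- The structure constants in the frame `L_a^b E_b`. -/
theorem exists_structureConst (C : Fin 3 → Fin 3 → Fin 3 → ℝ) {L : Matrix (Fin 3) (Fin 3) ℝ}
    (hL : IsUnit L.det) : ∃ C' : Fin 3 → Fin 3 → Fin 3 → ℝ,
      ∀ a b k, ∑ c, C' a b c * L c k = ∑ i, ∑ j, L a i * L b j * C i j k := by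
  refine ⟨fun a b c => ∑ k, (∑ i, ∑ j, L a i * L b j * C i j k) * L⁻¹ k c, fun a b k => ?_⟩
  simp only [Finset.sum_mul (s := Finset.univ) (f := fun k => _ * L⁻¹ k _)]
  rw [Finset.sum_comm]
  have h : ∀ l, ∑ c, (∑ i, ∑ j, L a i * L b j * C i j l) * L⁻¹ l c * L c k
      = (∑ i, ∑ j, L a i * L b j * C i j l) * if l = k then 1 else 0 := fun l => by
    rw [← sum_inv_mul_apply hL, Finset.mul_sum]
    exact Finset.sum_congr rfl fun _ _ => by ring
  simp [h]

end SpatialFrame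

namespace Cosmology

variable {S : SpatialFrame} {n : ℕ} (M : Cosmology S n)

theorem h_det_isUnit {t : ℝ} (ht : t ∈ M.I) : IsUnit (M.h t).det :=
  (Matrix.isUnit_iff_isUnit_det _).1 (M.h_posDef t ht).isUnit

theorem g_eq (x : Pt 4) : M.g x = timeBlock (-1) (M.h (x 0)) := rfl

theorem isOpen_region : IsOpen M.region := by
  have h1 : IsOpen {x : Pt 4 | x 0 ∈ M.I} := M.isOpen.preimage (continuous_apply 0)
  have h2 : IsOpen {x : Pt 4 | Fin.tail x ∈ S.U} :=
    S.isOpen.preimage (continuous_pi fun i => continuous_apply (Fin.succ i))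
  exact h1.inter h2

theorem contDiffOn_comp_time {f : ℝ → ℝ} (hf : ContDiffOn ℝ ∞ f M.I) :
    ContDiffOn ℝ ∞ (fun x : Pt 4 => f (x 0)) M.region :=
  hf.comp (contDiff_apply ℝ ℝ 0).contDiffOn fun _ hx => hx.1

theorem isRegularOn : IsRegularOn S.e M.g M.region where
  isOpen := M.isOpen_region
  frame μ := (S.e_contDiffOn μ).mono fun _ hx => hx.2
  indep _ hx := S.e_linearIndependent hx.2
  metric μ ν := by
    simp only [g_eq]
    refine Fin.cases ?_ (fun a => ?_) μ <;> refine Fin.cases ?_ (fun b => ?_) ν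
    · exact contDiffOn_const
    · exact contDiffOn_const
    · exact contDiffOn_const
    · exact M.contDiffOn_comp_time (M.h_smooth a b)
  det_ne _ hx := (timeBlock_isUnit_det (by norm_num) (M.h_det_isUnit hx.1)).ne_zero

theorem fieldStrength_differentiableAt (i : Fin n) (J : Fin ((M.field i).p + 1) → Fin 4) {x : Pt 4}
    (hx : x ∈ M.region) : DifferentiableAt ℝ (M.fieldStrength i J) x :=
  differentiableAt_of_contDiffOn M.isOpen_region (M.contDiffOn_comp_time (M.F_smooth i J)) hx

/-- The same model described in the frame `L_a^b E_b`. -/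
def changeFrame (L : Matrix (Fin 3) (Fin 3) ℝ) (hL : IsUnit L.det) :
    Cosmology (S.changeFrame L hL) n where
  I := M.I
  h t := L * M.h t * Lᵀ
  field i := { M.field i with F := fun t => mulForm (timeBlock 1 L) ((M.field i).F t) }
  m := M.m
  ρ := M.ρ
  P := M.P
  isOpen := M.isOpen
  isConnected := M.isConnected
  h_posDef t ht := by
    have h1 : IsUnit L := (Matrix.isUnit_iff_isUnit_det L).2 hL
    have h2 := (M.h_posDef t ht).mul_mul_conjTranspose_same (B := L)
      (Matrix.vecMul_injective_of_isUnit h1)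
    simpa using h2
  h_smooth a b := by
    simp only [Matrix.mul_apply, Matrix.transpose_apply]
    exact ContDiffOn.sum fun i _ => (ContDiffOn.sum fun j _ =>
      contDiffOn_const.mul (M.h_smooth j i)).mul contDiffOn_const
  F_alternating i t ht := (M.F_alternating i t ht).mulForm _
  F_smooth i J := ContDiffOn.sum fun K _ => contDiffOn_const.mul (M.F_smooth i K)
  ρ_smooth := M.ρ_smooth
  P_smooth := M.P_smooth

section ChangeFrame

variable (L : Matrix (Fin 3) (Fin 3) ℝ) (hL : IsUnit L.det)

theorem changeFrame_g : (M.changeFrame L hL).g = mulMetric (timeBlock 1 L) M.g := by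
  funext x
  simp [g_eq, mulMetric, timeBlock_transpose, timeBlock_mul, changeFrame]

theorem isUnit_timeBlock (hL : IsUnit L.det) : IsUnit (timeBlock 1 L).det :=
  timeBlock_isUnit_det one_ne_zero hL

theorem mulTensor_uLower :
    mulTensor (timeBlock 1 L) (fun J : Fin 1 → Fin 4 => fun _ => uLower (J 0))
      = fun J : Fin 1 → Fin 4 => fun _ => uLower (J 0) := by
  funext J x
  have h : ∀ μ, ∑ ν, timeBlock 1 L μ ν * uLower ν = uLower μ := fun μ => by
    refine Fin.cases ?_ (fun a => ?_) μ <;>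
      simp [uLower, Fin.sum_univ_succ (n := 3), Fin.succ_ne_zero]
  rw [← h (J 0)]
  simp [mulTensor, mulForm, sum_fin_fun_cons]

theorem mulForm_singleton {k : ℕ} {Λ : Matrix (Fin k) (Fin k) ℝ} (F : (Fin 1 → Fin k) → ℝ)
    (ν : Fin k) : mulForm Λ F ![ν] = ∑ β, Λ ν β * F ![β] := by
  simp only [mulForm, sum_fin_fun_cons, Finset.univ_unique, Finset.sum_singleton]
  refine Finset.sum_congr rfl fun β _ => ?_
  have : (Fin.cons β (default : Fin 0 → Fin k) : Fin 1 → Fin k) = ![β] := by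
    funext i; fin_cases i; rfl
  rw [this, Finset.prod_singleton]
  rfl

variable {x : Pt 4}

theorem changeFrame_gradU (hx : x ∈ M.region) (μ ν : Fin 4) :
    (M.changeFrame L hL).gradU μ ν x
      = ∑ α, ∑ β, timeBlock 1 L μ α * timeBlock 1 L ν β * M.gradU α β x := by
  have h := M.isRegularOn.covD_mul (isUnit_timeBlock L hL) hx
    (T := fun J : Fin 1 → Fin 4 => fun _ => uLower (J 0)) (fun _ => differentiableAt_const _) μ ![ν]
  rw [mulTensor_uLower] at h
  rw [gradU, SpatialFrame.changeFrame_e, changeFrame_g, h]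
  simp only [mulForm_singleton, Finset.mul_sum, mul_assoc]
  rfl

theorem changeFrame_hubble (hx : x ∈ M.region) : (M.changeFrame L hL).hubble x = M.hubble x := by
  simp only [hubble, M.changeFrame_gradU L hL hx, changeFrame_g]
  rw [sum_mulMetric_inv_mul (isUnit_timeBlock L hL)]

theorem sum_timeBlock_uLower (μ : Fin 4) : ∑ ν, timeBlock 1 L μ ν * uLower ν = uLower μ := by
  refine Fin.cases ?_ (fun a => ?_) μ <;>
    simp [uLower, Fin.sum_univ_succ (n := 3), Fin.succ_ne_zero]

theorem sum_timeBlock_uLower_mul (μ ν : Fin 4) :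
    ∑ α, ∑ β, timeBlock 1 L μ α * timeBlock 1 L ν β * (uLower α * uLower β)
      = uLower μ * uLower ν := by
  rw [← sum_timeBlock_uLower L μ, ← sum_timeBlock_uLower L ν, Finset.sum_mul_sum]
  exact Finset.sum_congr rfl fun _ _ => Finset.sum_congr rfl fun _ _ => by ring

theorem changeFrame_proj (x : Pt 4) (μ ν : Fin 4) :
    (M.changeFrame L hL).proj μ ν x
      = ∑ α, ∑ β, timeBlock 1 L μ α * timeBlock 1 L ν β * M.proj α β x := by
  simp only [proj, mul_add, Finset.sum_add_distrib, changeFrame_g, mulMetric_apply,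
    sum_timeBlock_uLower_mul]

theorem changeFrame_shear (hx : x ∈ M.region) (μ ν : Fin 4) :
    (M.changeFrame L hL).shear μ ν x
      = ∑ α, ∑ β, timeBlock 1 L μ α * timeBlock 1 L ν β * M.shear α β x := by
  have h1 : ∑ α, ∑ β, timeBlock 1 L ν α * timeBlock 1 L μ β * M.gradU α β x
      = ∑ α, ∑ β, timeBlock 1 L μ α * timeBlock 1 L ν β * M.gradU β α x := by
    rw [Finset.sum_comm]
    exact Finset.sum_congr rfl fun _ _ => Finset.sum_congr rfl fun _ _ => by ring
  simp only [shear, M.changeFrame_gradU L hL hx, M.changeFrame_hubble L hL hx, changeFrame_proj,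
    h1, mul_sub, mul_add, Finset.sum_sub_distrib, Finset.sum_add_distrib, Finset.mul_sum]
  congr 1
  · congr 1 <;>
    exact Finset.sum_congr rfl fun _ _ => Finset.sum_congr rfl fun _ _ => by ring
  · exact Finset.sum_congr rfl fun _ _ => Finset.sum_congr rfl fun _ _ => by ring

theorem changeFrame_fieldEMT (i : Fin n) (x : Pt 4) (μ ν : Fin 4) :
    (M.changeFrame L hL).fieldEMT i μ ν x
      = ∑ α, ∑ β, timeBlock 1 L μ α * timeBlock 1 L ν β * M.fieldEMT i α β x := by
  have h := emt_mulForm (g := M.g x) (isUnit_timeBlock L hL) (M.field i).p (M.field i).α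
    ((M.field i).F (x 0)) μ ν
  rw [fieldEMT, changeFrame_g]
  exact h

/-- The comoving observers do not depend on the spatial frame; this allows signs of the energy
density to be discussed in an orthonormal frame. -/
theorem changeFrame_fieldEMT_zero_zero (i : Fin n) (x : Pt 4) :
    (M.changeFrame L hL).fieldEMT i 0 0 x = M.fieldEMT i 0 0 x := by
  rw [changeFrame_fieldEMT]
  simp [Fin.sum_univ_succ (n := 3)]

theorem changeFrame_tracelessRicci {t : ℝ} (ht : t ∈ M.I) {y : Pt 3} (hy : y ∈ S.U)
    (a b : Fin 3) :
    (M.changeFrame L hL).tracelessRicci t a b y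
      = ∑ c, ∑ d, L a c * L b d * M.tracelessRicci t c d y := by
  have h := S.isRegularOn (M.h_det_isUnit ht).ne_zero
  have h1 : (fun _ : Pt 3 => (M.changeFrame L hL).h t) = mulMetric L fun _ => M.h t := rfl
  have h2 := mulMetric_apply (Λ := L) (g := fun _ => M.h t) y a b
  have h3 : (M.changeFrame L hL).h t a b = ∑ α, ∑ β, L a α * L b β * M.h t α β := h2
  have h4 : (S.changeFrame L hL).E = mulFrame L S.E := rfl
  simp only [tracelessRicci, h4, h1, h.ricci_mul hL hy, h.scalarCurv_mul hL hy, h3, mul_sub,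
    Finset.sum_sub_distrib, Finset.mul_sum]
  congr 1
  exact Finset.sum_congr rfl fun _ _ => Finset.sum_congr rfl fun _ _ => by ring

end ChangeFrame

/-- The conditions for a shear-free solution that do not refer to the choice of spatial frame. -/
structure IsShearFreeModel : Prop where
  anisotropic : ∃ t ∈ M.I, ∃ y ∈ S.U, ∃ a b, M.tracelessRicci t a b y ≠ 0
  shear_eq_zero : ∀ x ∈ M.region, ∀ μ ν, M.shear μ ν x = 0
  not_static : ∃ x ∈ M.region, M.hubble x ≠ 0
  closed : ∀ i, ∀ x ∈ M.region, ∀ J, extD S.e M.g (M.fieldStrength i) J x = 0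
  coclosed : ∀ i, ∀ x ∈ M.region, ∀ J, diverg S.e M.g (M.fieldStrength i) J x = 0
  no_flux : ∀ i, ∀ x ∈ M.region, ∀ a : Fin 3, M.fieldEMT i 0 a.succ x = 0
  fluid : ∀ x ∈ M.region,
    deriv M.totalρ (x 0) + 3 * M.hubble x * (M.totalρ (x 0) + M.totalP (x 0)) = 0
  einstein_eq : ∀ x ∈ M.region, ∀ μ ν, einstein S.e M.g μ ν x
    = M.totalρ (x 0) * uLower μ * uLower ν + M.totalP (x 0) * M.proj μ ν x
      + ∑ i, M.fieldEMT i μ ν x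

theorem isShearFreeSolution_iff :
    M.IsShearFreeSolution ↔ M.IsHomogeneous ∧ M.IsShearFreeModel :=
  ⟨fun h => ⟨h.homogeneous, ⟨h.anisotropic, h.shear_eq_zero, h.not_static, h.closed, h.coclosed,
    h.no_flux, h.fluid, h.einstein_eq⟩⟩,
   fun ⟨h0, h⟩ => ⟨h0, h.anisotropic, h.shear_eq_zero, h.not_static, h.closed, h.coclosed,
    h.no_flux, h.fluid, h.einstein_eq⟩⟩

variable {M}

/-- All conditions are tensor equations, except the two existence statements: the Hubble scalar is
invariant, and a nonzero tensor stays nonzero because `L` is invertible. -/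
theorem IsShearFreeModel.changeFrame (hM : M.IsShearFreeModel) (L : Matrix (Fin 3) (Fin 3) ℝ)
    (hL : IsUnit L.det) : (M.changeFrame L hL).IsShearFreeModel where
  anisotropic := by
    obtain ⟨t, ht, y, hy, a, b, hab⟩ := hM.anisotropic
    refine ⟨t, ht, y, hy, ?_⟩
    by_contra! hcon
    refine hab (eq_zero_of_sum_mul_mul (T := fun a b => M.tracelessRicci t a b y) hL (fun c d => ?_) a b)
    rw [← M.changeFrame_tracelessRicci L hL ht hy]
    exact hcon c d
  shear_eq_zero x hx μ ν := by
    rw [M.changeFrame_shear L hL hx]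
    simp [hM.shear_eq_zero x hx]
  not_static := by
    obtain ⟨x, hx, h⟩ := hM.not_static
    exact ⟨x, hx, by rwa [M.changeFrame_hubble L hL hx]⟩
  closed i x hx J := by
    have h := M.isRegularOn.extD_mul (isUnit_timeBlock L hL) hx
      (fun K => M.fieldStrength_differentiableAt i K hx) J
    rw [SpatialFrame.changeFrame_e, changeFrame_g]
    refine h.trans ?_
    simp [mulForm, hM.closed i x hx]
  coclosed i x hx J := by
    have h := M.isRegularOn.diverg_mul (isUnit_timeBlock L hL) hx
      (fun K => M.fieldStrength_differentiableAt i K hx) J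
    rw [SpatialFrame.changeFrame_e, changeFrame_g]
    refine h.trans ?_
    simp [mulForm, hM.coclosed i x hx]
  no_flux i x hx a := by
    rw [changeFrame_fieldEMT]
    have h := hM.no_flux i x hx
    simp [Fin.sum_univ_succ (n := 3), h]
  fluid x hx := by
    rw [M.changeFrame_hubble L hL hx]
    exact hM.fluid x hx
  einstein_eq x hx μ ν := by
    have h1 : ∀ (r : ℝ) (T : Fin 4 → Fin 4 → ℝ),
        r * ∑ α, ∑ β, timeBlock 1 L μ α * timeBlock 1 L ν β * T α β
        = ∑ α, ∑ β, timeBlock 1 L μ α * timeBlock 1 L ν β * (r * T α β) := fun r T => by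
      simp only [Finset.mul_sum]
      exact Finset.sum_congr rfl fun _ _ => Finset.sum_congr rfl fun _ _ => by ring
    rw [SpatialFrame.changeFrame_e, changeFrame_g,
      M.isRegularOn.einstein_mul (isUnit_timeBlock L hL) hx]
    simp only [hM.einstein_eq x hx, changeFrame_fieldEMT, changeFrame_proj, mul_assoc]
    rw [← sum_timeBlock_uLower_mul L μ ν]
    simp only [← mul_assoc (timeBlock 1 L μ _) (timeBlock 1 L ν _)]
    rw [h1, h1, sum_comm₃ (fun i α β => timeBlock 1 L μ α * timeBlock 1 L ν β
      * M.fieldEMT i α β x)]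
    simp only [← Finset.sum_add_distrib, Finset.mul_sum, mul_add]
    rfl

end Cosmology

end ShearFree

/-! ### The product structure of the spacetime frame, and the consequence of vanishing shear. -/

namespace ShearFree

/-- The projection `(t, y) ↦ y`. -/
def tailL : Pt 4 →L[ℝ] Pt 3 := ContinuousLinearMap.pi fun i => ContinuousLinearMap.proj i.succ

/-- The inclusion `y ↦ (0, y)`. -/
def consL : Pt 3 →L[ℝ] Pt 4 :=
  ContinuousLinearMap.pi fun μ => Fin.cases (motive := fun _ => Pt 3 →L[ℝ] ℝ) 0
    (fun i => ContinuousLinearMap.proj i) μ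

theorem tailL_apply (x : Pt 4) : tailL x = Fin.tail x := rfl

theorem consL_apply (y : Pt 3) : consL y = Fin.cons (0 : ℝ) y := by
  funext μ
  refine Fin.cases ?_ (fun i => ?_) μ <;> rfl

theorem tailL_consL (y : Pt 3) : tailL (consL y) = y := by
  rw [consL_apply, tailL_apply, Fin.tail_cons]

theorem tailL_single : tailL (Pi.single 0 1) = 0 := by
  funext i
  simp [tailL_apply, Fin.tail]

/-- Differentiating a function pulled back by `(t, y) ↦ y`. -/
theorem fderiv_comp_tail (f : Pt 3 → ℝ) (x v : Pt 4) :
    fderiv ℝ (fun z : Pt 4 => f (Fin.tail z)) x v = fderiv ℝ f (Fin.tail x) (Fin.tail v) := by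
  by_cases hf : DifferentiableAt ℝ f (Fin.tail x)
  · have h : HasFDerivAt (fun z : Pt 4 => f (tailL z)) ((fderiv ℝ f (tailL x)).comp tailL) x :=
      HasFDerivAt.comp x (f := fun z => tailL z) (g := f) hf.hasFDerivAt tailL.hasFDerivAt
    exact congrArg (fun A => A v) h.fderiv
  -- Restricting to the affine slice through `x` shows that differentiability of the pullback
  -- implies that of `f`. Otherwise both derivatives take the default value zero, so no hypothesis
  -- on `f` is needed.
  · have h : ¬ DifferentiableAt ℝ (fun z : Pt 4 => f (Fin.tail z)) x := fun h => by
      refine hf ?_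
      have h1 : DifferentiableAt ℝ (fun y : Pt 3 => x + consL (y - tailL x)) (tailL x) := by
        fun_prop
      have h2 : (fun y : Pt 3 => f y) = fun y => f (Fin.tail (x + consL (y - tailL x))) := by
        funext y
        rw [← tailL_apply, map_add, tailL_consL]
        simp
      have h3 : x + consL (tailL x - tailL x) = x := by simp
      have h4 := DifferentiableAt.comp (tailL x) (f := fun y : Pt 3 => x + consL (y - tailL x))
        (g := fun z : Pt 4 => f (Fin.tail z)) (by rw [h3]; exact h) h1
      have h5 : DifferentiableAt ℝ (fun y => f y) (tailL x) := by rw [h2]; exact h4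
      exact h5
    rw [fderiv_zero_of_not_differentiableAt h, fderiv_zero_of_not_differentiableAt hf]
    rfl

namespace SpatialFrame

variable (S : SpatialFrame) {x : Pt 4}

theorem hasFDerivAt_e_succ (a : Fin 3) (hx : Fin.tail x ∈ S.U) :
    HasFDerivAt (S.e a.succ) (consL.comp ((fderiv ℝ (S.E a) (Fin.tail x)).comp tailL)) x := by
  have h : S.e a.succ = fun z => consL (S.E a (tailL z)) := by
    funext z
    rw [consL_apply]; rfl
  rw [h]
  have h1 : HasFDerivAt (S.E a) (fderiv ℝ (S.E a) (Fin.tail x)) (tailL x) :=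
    (S.differentiableAt_E a hx).hasFDerivAt
  exact consL.hasFDerivAt.comp x (h1.comp x tailL.hasFDerivAt)

theorem fderiv_e_zero (x : Pt 4) : fderiv ℝ (S.e 0) x = 0 := by
  have : S.e 0 = fun _ => Pi.single 0 1 := rfl
  rw [this]
  simp

theorem lieBracket_e_succ_succ (a b : Fin 3) (hx : Fin.tail x ∈ S.U) :
    VectorField.lieBracket ℝ (S.e a.succ) (S.e b.succ) x
      = consL (VectorField.lieBracket ℝ (S.E a) (S.E b) (Fin.tail x)) := by
  simp only [VectorField.lieBracket, (S.hasFDerivAt_e_succ a hx).fderiv,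
    (S.hasFDerivAt_e_succ b hx).fderiv, ContinuousLinearMap.comp_apply, map_sub, e_succ,
    ← consL_apply, tailL_consL]

theorem lieBracket_e_zero (a : Fin 3) (hx : Fin.tail x ∈ S.U) :
    VectorField.lieBracket ℝ (S.e 0) (S.e a.succ) x = 0 := by
  simp only [VectorField.lieBracket, (S.hasFDerivAt_e_succ a hx).fderiv, fderiv_e_zero,
    ContinuousLinearMap.comp_apply, e_zero, tailL_single]
  simp

theorem commCoeff_succ_succ_succ (a b c : Fin 3) (hx : Fin.tail x ∈ S.U) :
    commCoeff S.e a.succ b.succ c.succ x = commCoeff S.E a b c (Fin.tail x) := by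
  rw [commCoeff, lieBracket_e_succ_succ S a b hx]
  refine frameCoord_eq (S.e_linearIndependent hx) (c := Fin.cons 0
    fun c => commCoeff S.E a b c (Fin.tail x)) ?_ c.succ
  have h := sum_frameCoord_smul (S.indep _ hx)
    (VectorField.lieBracket ℝ (S.E a) (S.E b) (Fin.tail x))
  conv_lhs => rw [← h]
  rw [map_sum, Fin.sum_univ_succ (n := 3)]
  simp only [map_smul, Fin.cons_zero, zero_smul, zero_add, Fin.cons_succ, e_succ, ← consL_apply]
  rfl

theorem commCoeff_succ_succ_zero (a b : Fin 3) (hx : Fin.tail x ∈ S.U) :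
    commCoeff S.e a.succ b.succ 0 x = 0 := by
  rw [commCoeff, lieBracket_e_succ_succ S a b hx]
  refine frameCoord_eq (S.e_linearIndependent hx) (c := Fin.cons 0
    fun c => commCoeff S.E a b c (Fin.tail x)) ?_ 0
  have h := sum_frameCoord_smul (S.indep _ hx)
    (VectorField.lieBracket ℝ (S.E a) (S.E b) (Fin.tail x))
  conv_lhs => rw [← h]
  rw [map_sum, Fin.sum_univ_succ (n := 3)]
  simp only [map_smul, Fin.cons_zero, zero_smul, zero_add, Fin.cons_succ, e_succ, ← consL_apply]
  rfl

theorem commCoeff_zero_left (μ κ : Fin 4) (hx : Fin.tail x ∈ S.U) :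
    commCoeff S.e 0 μ κ x = 0 := by
  refine Fin.cases ?_ (fun a => ?_) μ
  · simp [commCoeff, frameCoord]
  · rw [commCoeff, lieBracket_e_zero S a hx]
    simp [frameCoord]

theorem commCoeff_zero_right (μ κ : Fin 4) (hx : Fin.tail x ∈ S.U) :
    commCoeff S.e μ 0 κ x = 0 := by
  have h := S.commCoeff_zero_left μ κ hx
  rw [commCoeff, VectorField.lieBracket_swap]
  rw [commCoeff] at h
  have := frameCoord_smul S.e x (VectorField.lieBracket ℝ (S.e 0) (S.e μ) x) (-1) κ
  simpa [h] using this

theorem frameDeriv_succ_comp_time (f : ℝ → ℝ) (a : Fin 3) (x : Pt 4)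
    (hf : DifferentiableAt ℝ f (x 0)) :
    frameDeriv S.e (fun y => f (y 0)) a.succ x = 0 := by
  have h : HasFDerivAt (fun y : Pt 4 => f (y 0))
      ((fderiv ℝ f (x 0)).comp (ContinuousLinearMap.proj (R := ℝ) (φ := fun _ : Fin 4 => ℝ) 0)) x :=
    HasFDerivAt.comp x (f := fun y : Pt 4 => y 0) hf.hasFDerivAt (hasFDerivAt_apply 0 x)
  rw [frameDeriv, h.fderiv]
  simp [e_succ]

theorem frameDeriv_zero_comp_time (f : ℝ → ℝ) (x : Pt 4) (hf : DifferentiableAt ℝ f (x 0)) :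
    frameDeriv S.e (fun y => f (y 0)) 0 x = deriv f (x 0) := by
  have h : HasFDerivAt (fun y : Pt 4 => f (y 0))
      ((fderiv ℝ f (x 0)).comp (ContinuousLinearMap.proj (R := ℝ) (φ := fun _ : Fin 4 => ℝ) 0)) x :=
    HasFDerivAt.comp x (f := fun y : Pt 4 => y 0) hf.hasFDerivAt (hasFDerivAt_apply 0 x)
  rw [frameDeriv, h.fderiv]
  simp [e_zero]

theorem frameDeriv_succ_comp_tail (f : Pt 3 → ℝ) (a : Fin 3) (x : Pt 4) :
    frameDeriv S.e (fun y => f (Fin.tail y)) a.succ x = frameDeriv S.E f a (Fin.tail x) := by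
  rw [frameDeriv, fderiv_comp_tail, e_succ, Fin.tail_cons, frameDeriv]

theorem frameDeriv_zero_comp_tail (f : Pt 3 → ℝ) (x : Pt 4) :
    frameDeriv S.e (fun y => f (Fin.tail y)) 0 x = 0 := by
  rw [frameDeriv, fderiv_comp_tail, e_zero, ← tailL_apply (Pi.single 0 1), tailL_single, map_zero]

theorem frameDeriv_congr {n : ℕ} {e : Fin n → Pt n → Pt n} {f f' : Pt n → ℝ} {x : Pt n}
    (h : f =ᶠ[nhds x] f') (μ : Fin n) : frameDeriv e f μ x = frameDeriv e f' μ x := by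
  rw [frameDeriv, h.fderiv_eq, frameDeriv]

theorem frameDeriv_const {n : ℕ} {e : Fin n → Pt n → Pt n} (c : ℝ) (μ : Fin n) (x : Pt n) :
    frameDeriv e (fun _ => c) μ x = 0 := by
  simp [frameDeriv]

end SpatialFrame

namespace Cosmology

variable {S : SpatialFrame} {n : ℕ} (M : Cosmology S n)

theorem h_differentiableAt {t : ℝ} (ht : t ∈ M.I) (a b : Fin 3) :
    DifferentiableAt ℝ (fun t => M.h t a b) t :=
  differentiableAt_of_contDiffOn M.isOpen (M.h_smooth a b) ht

variable {x : Pt 4}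

theorem frameDeriv_g_zero (hx : x ∈ M.region) (a b : Fin 3) :
    frameDeriv S.e (fun y => M.g y a.succ b.succ) 0 x = deriv (fun t => M.h t a b) (x 0) :=
  S.frameDeriv_zero_comp_time (fun t => M.h t a b) x (M.h_differentiableAt hx.1 a b)

theorem frameDeriv_g_succ (hx : x ∈ M.region) (a b c : Fin 3) :
    frameDeriv S.e (fun y => M.g y a.succ b.succ) c.succ x = 0 :=
  S.frameDeriv_succ_comp_time (fun t => M.h t a b) c x (M.h_differentiableAt hx.1 a b)

theorem frameDeriv_g_zero_left (μ ν : Fin 4) (x : Pt 4) :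
    frameDeriv S.e (fun y => M.g y 0 ν) μ x = 0 := by
  refine Fin.cases ?_ (fun a => ?_) ν <;> exact SpatialFrame.frameDeriv_const _ _ _

theorem frameDeriv_g_zero_right (μ ν : Fin 4) (x : Pt 4) :
    frameDeriv S.e (fun y => M.g y ν 0) μ x = 0 := by
  refine Fin.cases ?_ (fun a => ?_) ν <;> exact SpatialFrame.frameDeriv_const _ _ _

theorem g_inv (hx : x ∈ M.region) : (M.g x)⁻¹ = timeBlock (-1) (M.h (x 0))⁻¹ := by
  rw [g_eq, timeBlock_inv (by norm_num) (M.h_det_isUnit hx.1)]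
  norm_num

theorem connLower_zero_succ_succ (hx : x ∈ M.region) (a b : Fin 3) :
    connLower S.e M.g 0 a.succ b.succ x = -(1 / 2) * deriv (fun t => M.h t a b) (x 0) := by
  rw [connLower, frameDeriv_g_zero_right, frameDeriv_g_zero_right, frameDeriv_g_zero M hx]
  simp [Fin.sum_univ_succ (n := 3), S.commCoeff_zero_right _ _ hx.2,
    S.commCoeff_succ_succ_zero _ _ hx.2, g_eq]

theorem gradU_eq (x : Pt 4) (μ ν : Fin 4) :
    M.gradU μ ν x = conn S.e M.g 0 μ ν x := by
  have h : ∀ κ, Function.update ![ν] 0 κ 0 = κ := fun κ => by simp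
  simp only [gradU, covD, SpatialFrame.frameDeriv_const, Finset.univ_unique, Finset.sum_singleton]
  simp [Fin.sum_univ_succ (n := 3), uLower, Fin.succ_ne_zero]

theorem gradU_succ_succ (hx : x ∈ M.region) (a b : Fin 3) :
    M.gradU a.succ b.succ x = (1 / 2) * deriv (fun t => M.h t a b) (x 0) := by
  rw [gradU_eq M, conn, Fin.sum_univ_succ, g_inv M hx, connLower_zero_succ_succ M hx]
  simp

theorem h_symm {t : ℝ} (ht : t ∈ M.I) (a b : Fin 3) : M.h t a b = M.h t b a := by
  have := (M.h_posDef t ht).isHermitian.apply a b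
  simpa using this.symm

theorem deriv_h_symm {t : ℝ} (ht : t ∈ M.I) (a b : Fin 3) :
    deriv (fun t => M.h t a b) t = deriv (fun t => M.h t b a) t := by
  apply Filter.EventuallyEq.deriv_eq
  filter_upwards [M.isOpen.mem_nhds ht] with u hu using M.h_symm hu a b

/-- The symmetrised gradient of `u` is half the time derivative of the spatial metric, and vanishing
shear says that it is pure trace. -/
theorem deriv_h_of_shear_eq_zero (hx : x ∈ M.region) (h : ∀ μ ν, M.shear μ ν x = 0) (a b : Fin 3) :
    deriv (fun t => M.h t a b) (x 0) = 2 * M.hubble x * M.h (x 0) a b := by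
  have h1 := h a.succ b.succ
  simp only [shear, gradU_succ_succ M hx, proj, uLower, Fin.succ_ne_zero, if_false, g_eq,
    timeBlock_succ_succ, M.deriv_h_symm hx.1 b a] at h1
  linarith

/-- The spatial metric of a shear-free model is a time dependent multiple of a constant one. -/
theorem exists_scale (h : ∀ x ∈ M.region, ∀ μ ν, M.shear μ ν x = 0) :
    ∃ (s : ℝ → ℝ) (k : Matrix (Fin 3) (Fin 3) ℝ), ContDiffOn ℝ ∞ s M.I ∧ (∀ t ∈ M.I, 0 < s t) ∧
      k.PosDef ∧ ∀ t ∈ M.I, M.h t = s t • k := by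
  obtain ⟨t₀, ht₀⟩ := M.isConnected.nonempty
  obtain ⟨y₀, hy₀⟩ := S.isConnected.nonempty
  have hpos : ∀ t ∈ M.I, 0 < M.h t 0 0 := fun t ht => (M.h_posDef t ht).diag_pos
  have hmem : ∀ t ∈ M.I, (Fin.cons t y₀ : Pt 4) ∈ M.region := fun t ht => ⟨ht, hy₀⟩
  have hconst : ∀ a b, ∀ t ∈ M.I, M.h t a b / M.h t 0 0 = M.h t₀ a b / M.h t₀ 0 0 := by
    intro a b t ht
    -- All components have the same logarithmic derivative `2H`, so their quotients by the positive
    -- component `h 0 0` are constant on the interval.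
    have hd : ∀ u ∈ M.I, HasDerivAt (fun t => M.h t a b / M.h t 0 0) 0 u := fun u hu => by
      have h1 := (M.h_differentiableAt hu a b).hasDerivAt
      have h2 := (M.h_differentiableAt hu 0 0).hasDerivAt
      have h3 := h1.div h2 (hpos u hu).ne'
      have h4 := M.deriv_h_of_shear_eq_zero (hmem u hu) (h _ (hmem u hu))
      have h5 : (Fin.cons u y₀ : Pt 4) 0 = u := rfl
      simp only [h5] at h4
      rw [h4, h4] at h3
      refine h3.congr_deriv ?_
      rw [div_eq_zero_iff]
      left
      ring
    exact M.isOpen.is_const_of_deriv_eq_zero M.isConnected.isPreconnected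
      (fun u hu => (hd u hu).differentiableAt.differentiableWithinAt)
      (fun u hu => (hd u hu).deriv) ht ht₀
  refine ⟨fun t => M.h t 0 0 / M.h t₀ 0 0, M.h t₀, (M.h_smooth 0 0).div_const _,
    fun t ht => div_pos (hpos t ht) (hpos t₀ ht₀), M.h_posDef t₀ ht₀, fun t ht => ?_⟩
  ext a b
  have h1 := hconst a b t ht
  have h2 := (hpos t ht).ne'
  have h3 := (hpos t₀ ht₀).ne'
  rw [div_eq_div_iff h2 h3] at h1
  simp only [Matrix.smul_apply, smul_eq_mul]
  field_simp
  linarith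

end Cosmology

/-- Every inner product has an orthonormal basis. -/
theorem exists_orthonormalizing {k : Matrix (Fin 3) (Fin 3) ℝ} (hk : k.PosDef) :
    ∃ L : Matrix (Fin 3) (Fin 3) ℝ, IsUnit L.det ∧ L * k * Lᵀ = 1 := by
  -- A positive definite matrix is `Bᵀ * B` with `B` invertible; the rows of `(Bᵀ)⁻¹` are then
  -- orthonormal.
  open scoped MatrixOrder in
  obtain ⟨B, hB⟩ := CStarAlgebra.nonneg_iff_eq_star_mul_self.mp hk.posSemidef.nonneg
  have hB' : k = Bᵀ * B := by
    rw [hB, Matrix.star_eq_conjTranspose, Matrix.conjTranspose_eq_transpose_of_trivial]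
  have hdet : IsUnit B.det := by
    have h1 : IsUnit k.det := (Matrix.isUnit_iff_isUnit_det _).1 hk.isUnit
    rw [hB', Matrix.det_mul] at h1
    exact isUnit_of_mul_isUnit_right h1
  have hdet' : IsUnit (Bᵀ).det := by rwa [Matrix.det_transpose]
  refine ⟨(Bᵀ)⁻¹, Matrix.isUnit_nonsing_inv_det _ hdet', ?_⟩
  rw [hB', ← Matrix.mul_assoc, Matrix.nonsing_inv_mul _ hdet', Matrix.one_mul,
    Matrix.transpose_nonsing_inv, Matrix.transpose_transpose, Matrix.mul_nonsing_inv _ hdet]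

end ShearFree

/-! ### Curvature of a model whose spatial metric is a multiple of the unit matrix. -/

namespace ShearFree

namespace SpatialFrame

variable (S : SpatialFrame)

/-- Connection coefficients of an orthonormal frame in terms of its commutation functions. -/
def orthoConn (c a b : Fin 3) (y : Pt 3) : ℝ :=
  (1 / 2) * (commCoeff S.E a b c y - commCoeff S.E a c b y - commCoeff S.E b c a y)

theorem smul_one_inv {r : ℝ} (hr : r ≠ 0) :
    (r • (1 : Matrix (Fin 3) (Fin 3) ℝ))⁻¹ = r⁻¹ • (1 : Matrix (Fin 3) (Fin 3) ℝ) := by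
  apply Matrix.inv_eq_right_inv
  simp [smul_smul, hr]

theorem smul_one_apply (r : ℝ) (a b : Fin 3) :
    (r • (1 : Matrix (Fin 3) (Fin 3) ℝ)) a b = if a = b then r else 0 := by
  simp [Matrix.one_apply]

/-- A homothety does not change the Levi-Civita connection. Hence the spatial Ricci components do
not depend on time. -/
theorem conn_smul_one {r : ℝ} (hr : r ≠ 0) (c a b : Fin 3) :
    conn S.E (fun _ => r • 1) c a b = S.orthoConn c a b := by
  funext y
  simp only [conn, smul_one_inv hr, smul_one_apply, connLower, frameDeriv_const, orthoConn,
    Finset.sum_sub_distrib, ite_mul, zero_mul, Finset.sum_ite_eq, Finset.mem_univ, if_true,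
    mul_ite, mul_zero, Finset.sum_ite_eq']
  field_simp
  ring

theorem ricci_smul_one {r : ℝ} (hr : r ≠ 0) (a b : Fin 3) (y : Pt 3) :
    ricci S.E (fun _ => r • 1) a b y = ricci S.E (fun _ => 1) a b y := by
  have h := S.conn_smul_one (one_ne_zero)
  simp only [one_smul] at h
  simp only [ricci, riemann, S.conn_smul_one hr, h]

theorem commCoeff_antisymm (a b c : Fin 3) (y : Pt 3) :
    commCoeff S.E a b c y = - commCoeff S.E b a c y := by
  rw [commCoeff, VectorField.lieBracket_swap]
  simpa [commCoeff] using frameCoord_smul S.E y (VectorField.lieBracket ℝ (S.E b) (S.E a) y) (-1) c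

theorem orthoConn_sub (c a b : Fin 3) (y : Pt 3) :
    S.orthoConn c a b y - S.orthoConn c b a y = commCoeff S.E a b c y := by
  rw [orthoConn, orthoConn, S.commCoeff_antisymm b a c]
  ring

end SpatialFrame

namespace Cosmology

variable {S : SpatialFrame} {n : ℕ} (M : Cosmology S n)

/-- The spatial metric is `s(t)` times the unit matrix. -/
structure IsConformallyOrthonormal (s : ℝ → ℝ) : Prop where
  smooth : ContDiffOn ℝ ∞ s M.I
  pos : ∀ t ∈ M.I, 0 < s t
  h_eq : ∀ t ∈ M.I, M.h t = s t • 1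

/-- Every shear-free model is conformally orthonormal in a suitable frame. -/
theorem exists_isConformallyOrthonormal (h : ∀ x ∈ M.region, ∀ μ ν, M.shear μ ν x = 0) :
    ∃ (s : ℝ → ℝ) (k L : Matrix (Fin 3) (Fin 3) ℝ), (∀ t ∈ M.I, 0 < s t) ∧ k.PosDef ∧
      (∀ t ∈ M.I, M.h t = s t • k) ∧ L * k * Lᵀ = 1 ∧
      ∀ (L : Matrix (Fin 3) (Fin 3) ℝ) (hL : IsUnit L.det), L * k * Lᵀ = 1 →
        (M.changeFrame L hL).IsConformallyOrthonormal s := by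
  obtain ⟨s, k, hs, hpos, hk, hh⟩ := M.exists_scale h
  obtain ⟨L, hL, hLk⟩ := exists_orthonormalizing hk
  refine ⟨s, k, L, hpos, hk, hh, hLk, fun L hL hLk => ⟨hs, hpos, fun t ht => ?_⟩⟩
  change L * M.h t * Lᵀ = _
  rw [hh t ht, Matrix.mul_smul, Matrix.smul_mul, hLk]

variable {M} {s : ℝ → ℝ} {x : Pt 4}

namespace IsConformallyOrthonormal

theorem differentiableAt (hM : M.IsConformallyOrthonormal s) {t : ℝ} (ht : t ∈ M.I) :
    DifferentiableAt ℝ s t :=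
  differentiableAt_of_contDiffOn M.isOpen hM.smooth ht

theorem contDiffOn_deriv (hM : M.IsConformallyOrthonormal s) : ContDiffOn ℝ ∞ (deriv s) M.I :=
  hM.smooth.deriv_of_isOpen M.isOpen (by simp)

theorem differentiableAt_deriv (hM : M.IsConformallyOrthonormal s) {t : ℝ} (ht : t ∈ M.I) :
    DifferentiableAt ℝ (deriv s) t :=
  differentiableAt_of_contDiffOn M.isOpen hM.contDiffOn_deriv ht

theorem deriv_h (hM : M.IsConformallyOrthonormal s) {t : ℝ} (ht : t ∈ M.I) (a b : Fin 3) :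
    deriv (fun t => M.h t a b) t = if a = b then deriv s t else 0 := by
  have h : (fun t => M.h t a b) =ᶠ[nhds t] fun t => if a = b then s t else 0 := by
    filter_upwards [M.isOpen.mem_nhds ht] with u hu
    rw [hM.h_eq u hu, SpatialFrame.smul_one_apply]
  rw [h.deriv_eq]
  split_ifs <;> simp

theorem g_eq (hM : M.IsConformallyOrthonormal s) (hx : x ∈ M.region) :
    M.g x = timeBlock (-1) (s (x 0) • 1) := by
  rw [Cosmology.g_eq, hM.h_eq _ hx.1]

theorem g_inv (hM : M.IsConformallyOrthonormal s) (hx : x ∈ M.region) :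
    (M.g x)⁻¹ = timeBlock (-1) ((s (x 0))⁻¹ • 1) := by
  rw [Cosmology.g_inv M hx, hM.h_eq _ hx.1, SpatialFrame.smul_one_inv (hM.pos _ hx.1).ne']

theorem g_inv_diag (hM : M.IsConformallyOrthonormal s) (hx : x ∈ M.region) :
    (M.g x)⁻¹ = Matrix.diagonal (Fin.cons (-1) fun _ => (s (x 0))⁻¹) := by
  rw [hM.g_inv hx]
  ext μ ν
  refine Fin.cases ?_ (fun a => ?_) μ <;> refine Fin.cases ?_ (fun b => ?_) ν <;>
    simp [Matrix.diagonal_apply, Matrix.one_apply, (Fin.succ_ne_zero _).symm]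

theorem conn_zero_zero_left (hM : M.IsConformallyOrthonormal s) (hx : x ∈ M.region) (μ : Fin 4) :
    conn S.e M.g 0 0 μ x = 0 := by
  rw [conn, Fin.sum_univ_succ, hM.g_inv hx]
  refine Fin.cases ?_ (fun a => ?_) μ <;>
    simp [connLower, frameDeriv_g_zero_right, frameDeriv_g_zero_left,
      S.commCoeff_zero_right _ _ hx.2, S.commCoeff_zero_left _ _ hx.2]

theorem conn_zero_zero_right (hM : M.IsConformallyOrthonormal s) (hx : x ∈ M.region) (μ : Fin 4) :
    conn S.e M.g 0 μ 0 x = 0 := by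
  rw [conn, Fin.sum_univ_succ, hM.g_inv hx]
  refine Fin.cases ?_ (fun a => ?_) μ <;>
    simp [connLower, frameDeriv_g_zero_right, frameDeriv_g_zero_left,
      S.commCoeff_zero_right _ _ hx.2, S.commCoeff_zero_left _ _ hx.2]

theorem conn_succ_zero_zero (hM : M.IsConformallyOrthonormal s) (hx : x ∈ M.region) (c : Fin 3) :
    conn S.e M.g c.succ 0 0 x = 0 := by
  rw [conn, Fin.sum_univ_succ, hM.g_inv hx]
  simp [connLower, frameDeriv_g_zero_right, frameDeriv_g_zero_left,
      S.commCoeff_zero_right _ _ hx.2, S.commCoeff_zero_left _ _ hx.2]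

theorem conn_zero_succ_succ (hM : M.IsConformallyOrthonormal s) (hx : x ∈ M.region)
    (a b : Fin 3) :
    conn S.e M.g 0 a.succ b.succ x = if a = b then deriv s (x 0) / 2 else 0 := by
  rw [conn, Fin.sum_univ_succ, hM.g_inv hx, connLower_zero_succ_succ M hx, hM.deriv_h hx.1]
  split_ifs <;> simp
  ring

theorem conn_succ_zero_succ (hM : M.IsConformallyOrthonormal s) (hx : x ∈ M.region)
    (c a : Fin 3) :
    conn S.e M.g c.succ 0 a.succ x = if c = a then deriv s (x 0) / (2 * s (x 0)) else 0 := by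
  rw [conn, Fin.sum_univ_succ, hM.g_inv hx]
  simp only [connLower, frameDeriv_g_zero_right, frameDeriv_g_zero_left, frameDeriv_g_zero M hx,
    S.commCoeff_zero_right _ _ hx.2, S.commCoeff_zero_left _ _ hx.2, hM.deriv_h hx.1,
    Fin.sum_univ_succ (n := 3), timeBlock_succ_succ, timeBlock_succ_zero,
    S.commCoeff_succ_succ_zero _ _ hx.2, SpatialFrame.smul_one_apply, hM.g_eq hx]
  simp
  split_ifs
  · ring
  · rfl

theorem conn_succ_succ_zero (hM : M.IsConformallyOrthonormal s) (hx : x ∈ M.region)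
    (c a : Fin 3) :
    conn S.e M.g c.succ a.succ 0 x = if c = a then deriv s (x 0) / (2 * s (x 0)) else 0 := by
  rw [conn, Fin.sum_univ_succ, hM.g_inv hx]
  simp only [connLower, frameDeriv_g_zero_right, frameDeriv_g_zero_left, frameDeriv_g_zero M hx,
    S.commCoeff_zero_right _ _ hx.2, S.commCoeff_zero_left _ _ hx.2, hM.deriv_h hx.1,
    Fin.sum_univ_succ (n := 3), timeBlock_succ_succ, timeBlock_succ_zero,
    S.commCoeff_succ_succ_zero _ _ hx.2, SpatialFrame.smul_one_apply, hM.g_eq hx]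
  simp
  split_ifs
  · ring
  · rfl

/-- The spatial derivatives of the metric vanish and `s` cancels against its inverse, so these
coefficients are pulled back from the sections. -/
theorem conn_succ_succ_succ (hM : M.IsConformallyOrthonormal s) (hx : x ∈ M.region)
    (c a b : Fin 3) :
    conn S.e M.g c.succ a.succ b.succ x = S.orthoConn c a b (Fin.tail x) := by
  have hs := (hM.pos _ hx.1).ne'
  rw [conn, Fin.sum_univ_succ, hM.g_inv hx]
  simp only [connLower, frameDeriv_g_succ M hx, timeBlock_succ_zero, zero_mul, zero_add,
    timeBlock_succ_succ, SpatialFrame.smul_one_apply, ite_mul, Finset.sum_ite_eq, Finset.mem_univ,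
    if_true]
  rw [Fin.sum_univ_succ]
  simp only [S.commCoeff_succ_succ_zero _ _ hx.2, S.commCoeff_succ_succ_succ _ _ _ hx.2,
    hM.g_eq hx, timeBlock_succ_succ, SpatialFrame.smul_one_apply, Finset.sum_sub_distrib, mul_ite,
    mul_zero, zero_mul, Finset.sum_ite_eq', Finset.mem_univ, if_true, SpatialFrame.orthoConn]
  field_simp
  ring

theorem hubble_eq (hM : M.IsConformallyOrthonormal s) (hx : x ∈ M.region) :
    M.hubble x = deriv s (x 0) / (2 * s (x 0)) := by
  have hs := (hM.pos _ hx.1).ne'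
  simp only [hubble, gradU_eq, hM.g_inv hx]
  rw [Fin.sum_univ_succ]
  simp only [Fin.sum_univ_succ (n := 3), hM.conn_zero_zero_left hx, hM.conn_zero_zero_right hx,
    hM.conn_zero_succ_succ hx, timeBlock_succ_succ, SpatialFrame.smul_one_apply, mul_zero,
    Finset.sum_const_zero, zero_add, ite_mul, zero_mul, mul_ite, Finset.sum_ite_eq,
    Finset.mem_univ, if_true]
  simp
  field_simp

theorem gradU_eq_ite (hM : M.IsConformallyOrthonormal s) (hx : x ∈ M.region) (μ ν : Fin 4) :
    M.gradU μ ν x = timeBlock 0 ((deriv s (x 0) / 2) • 1) μ ν := by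
  rw [gradU_eq]
  refine Fin.cases ?_ (fun a => ?_) μ <;> refine Fin.cases ?_ (fun b => ?_) ν
  · rw [hM.conn_zero_zero_left hx]; rfl
  · rw [hM.conn_zero_zero_left hx]; rfl
  · rw [hM.conn_zero_zero_right hx]; rfl
  · rw [hM.conn_zero_succ_succ hx, timeBlock_succ_succ, SpatialFrame.smul_one_apply]

theorem shear_eq_zero (hM : M.IsConformallyOrthonormal s) (hx : x ∈ M.region) (μ ν : Fin 4) :
    M.shear μ ν x = 0 := by
  have hs := (hM.pos _ hx.1).ne'
  rw [shear, hM.gradU_eq_ite hx, hM.gradU_eq_ite hx, hM.hubble_eq hx, proj, hM.g_eq hx]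
  refine Fin.cases ?_ (fun a => ?_) μ <;> refine Fin.cases ?_ (fun b => ?_) ν <;>
    simp only [timeBlock_zero_zero, timeBlock_zero_succ, timeBlock_succ_zero, timeBlock_succ_succ,
      SpatialFrame.smul_one_apply, uLower, Fin.succ_ne_zero, if_true, if_false]
  · ring
  · ring
  · ring
  · rcases eq_or_ne a b with rfl | hab
    · simp
      field_simp
      ring
    · simp [hab, hab.symm]

section Curvature

/-- The derivative of the Hubble scalar. -/
def hubbleDeriv (s : ℝ → ℝ) (t : ℝ) : ℝ := deriv (fun t => deriv s t / (2 * s t)) t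

theorem eventually_region (hx : x ∈ M.region) : ∀ᶠ y in nhds x, y ∈ M.region :=
  M.isOpen_region.mem_nhds hx

theorem frameDeriv_conn_zero_zero_left (hM : M.IsConformallyOrthonormal s) (hx : x ∈ M.region)
    (μ ν : Fin 4) : frameDeriv S.e (conn S.e M.g 0 0 μ) ν x = 0 := by
  have : conn S.e M.g 0 0 μ =ᶠ[nhds x] fun _ => 0 := by
    filter_upwards [eventually_region hx] with y hy using hM.conn_zero_zero_left hy μ
  rw [SpatialFrame.frameDeriv_congr this, SpatialFrame.frameDeriv_const]

theorem frameDeriv_conn_zero_zero_right (hM : M.IsConformallyOrthonormal s) (hx : x ∈ M.region)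
    (μ ν : Fin 4) : frameDeriv S.e (conn S.e M.g 0 μ 0) ν x = 0 := by
  have : conn S.e M.g 0 μ 0 =ᶠ[nhds x] fun _ => 0 := by
    filter_upwards [eventually_region hx] with y hy using hM.conn_zero_zero_right hy μ
  rw [SpatialFrame.frameDeriv_congr this, SpatialFrame.frameDeriv_const]

theorem frameDeriv_conn_succ_zero_zero (hM : M.IsConformallyOrthonormal s) (hx : x ∈ M.region)
    (c : Fin 3) (ν : Fin 4) : frameDeriv S.e (conn S.e M.g c.succ 0 0) ν x = 0 := by
  have : conn S.e M.g c.succ 0 0 =ᶠ[nhds x] fun _ => 0 := by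
    filter_upwards [eventually_region hx] with y hy using hM.conn_succ_zero_zero hy c
  rw [SpatialFrame.frameDeriv_congr this, SpatialFrame.frameDeriv_const]

theorem frameDeriv_conn_zero_succ_succ (hM : M.IsConformallyOrthonormal s) (hx : x ∈ M.region)
    (a b : Fin 3) : frameDeriv S.e (conn S.e M.g 0 a.succ b.succ) 0 x
      = if a = b then deriv (deriv s) (x 0) / 2 else 0 := by
  have : conn S.e M.g 0 a.succ b.succ =ᶠ[nhds x] fun y =>
      (fun t => if a = b then deriv s t / 2 else 0) (y 0) := by
    filter_upwards [eventually_region hx] with y hy using hM.conn_zero_succ_succ hy a b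
  have hd := hM.differentiableAt_deriv hx.1
  rw [SpatialFrame.frameDeriv_congr this, S.frameDeriv_zero_comp_time
    (fun t => if a = b then deriv s t / 2 else 0)]
  · split_ifs <;> simp
  · split_ifs <;> fun_prop

theorem frameDeriv_conn_succ_zero_succ (hM : M.IsConformallyOrthonormal s) (hx : x ∈ M.region)
    (c a b : Fin 3) : frameDeriv S.e (conn S.e M.g c.succ 0 a.succ) b.succ x = 0 := by
  have : conn S.e M.g c.succ 0 a.succ =ᶠ[nhds x] fun y =>
      (fun t => if c = a then deriv s t / (2 * s t) else 0) (y 0) := by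
    filter_upwards [eventually_region hx] with y hy using hM.conn_succ_zero_succ hy c a
  have hd := hM.differentiableAt_deriv hx.1
  have hd' := hM.differentiableAt hx.1
  have hs := (hM.pos _ hx.1).ne'
  rw [SpatialFrame.frameDeriv_congr this, S.frameDeriv_succ_comp_time
    (fun t => if c = a then deriv s t / (2 * s t) else 0)]
  split_ifs
  · exact hd.div (hd'.const_mul 2) (by positivity)
  · fun_prop

theorem frameDeriv_conn_succ_succ_zero (hM : M.IsConformallyOrthonormal s) (hx : x ∈ M.region)
    (c a b : Fin 3) : frameDeriv S.e (conn S.e M.g c.succ a.succ 0) b.succ x = 0 := by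
  have : conn S.e M.g c.succ a.succ 0 =ᶠ[nhds x] conn S.e M.g c.succ 0 a.succ := by
    filter_upwards [eventually_region hx] with y hy
    rw [hM.conn_succ_zero_succ hy c a, hM.conn_succ_succ_zero hy c a]
  rw [SpatialFrame.frameDeriv_congr this, hM.frameDeriv_conn_succ_zero_succ hx]

theorem frameDeriv_zero_conn_succ_succ_zero (hM : M.IsConformallyOrthonormal s)
    (hx : x ∈ M.region) (c a : Fin 3) : frameDeriv S.e (conn S.e M.g c.succ a.succ 0) 0 x
      = if c = a then hubbleDeriv s (x 0) else 0 := by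
  have : conn S.e M.g c.succ a.succ 0 =ᶠ[nhds x] fun y =>
      (fun t => if c = a then deriv s t / (2 * s t) else 0) (y 0) := by
    filter_upwards [eventually_region hx] with y hy using hM.conn_succ_succ_zero hy c a
  have hd := hM.differentiableAt_deriv hx.1
  have hd' := hM.differentiableAt hx.1
  have hs := (hM.pos _ hx.1).ne'
  rw [SpatialFrame.frameDeriv_congr this, S.frameDeriv_zero_comp_time
    (fun t => if c = a then deriv s t / (2 * s t) else 0)]
  · split_ifs
    · rfl
    · simp
  · split_ifs
    · exact hd.div (hd'.const_mul 2) (by positivity)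
    · fun_prop

theorem eventuallyEq_conn_succ (hM : M.IsConformallyOrthonormal s) (hx : x ∈ M.region)
    (c a b : Fin 3) : conn S.e M.g c.succ a.succ b.succ
      =ᶠ[nhds x] fun y => S.orthoConn c a b (Fin.tail y) := by
  filter_upwards [eventually_region hx] with y hy using hM.conn_succ_succ_succ hy c a b

theorem frameDeriv_conn_succ (hM : M.IsConformallyOrthonormal s) (hx : x ∈ M.region)
    (c a b d : Fin 3) : frameDeriv S.e (conn S.e M.g c.succ a.succ b.succ) d.succ x
      = frameDeriv S.E (S.orthoConn c a b) d (Fin.tail x) := by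
  rw [SpatialFrame.frameDeriv_congr (hM.eventuallyEq_conn_succ hx c a b),
    S.frameDeriv_succ_comp_tail]

theorem frameDeriv_zero_conn_succ (hM : M.IsConformallyOrthonormal s) (hx : x ∈ M.region)
    (c a b : Fin 3) : frameDeriv S.e (conn S.e M.g c.succ a.succ b.succ) 0 x = 0 := by
  rw [SpatialFrame.frameDeriv_congr (hM.eventuallyEq_conn_succ hx c a b),
    S.frameDeriv_zero_comp_tail]

/-- The spatial components of the Ricci tensor of spacetime. -/
theorem ricci_succ_succ (hM : M.IsConformallyOrthonormal s) (hx : x ∈ M.region) (a b : Fin 3) :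
    ricci S.e M.g a.succ b.succ x = ricci S.E (fun _ => 1) a b (Fin.tail x)
      + if a = b then deriv (deriv s) (x 0) / 2 + deriv s (x 0) ^ 2 / (4 * s (x 0)) else 0 := by
  have hs := (hM.pos _ hx.1).ne'
  have h1 := S.conn_smul_one (one_ne_zero)
  simp only [one_smul] at h1
  simp only [ricci, riemann, h1]
  rw [Fin.sum_univ_succ]
  simp only [Fin.sum_univ_succ (n := 3), hM.frameDeriv_conn_zero_succ_succ hx,
    hM.frameDeriv_conn_zero_zero_left hx, hM.conn_zero_zero_left hx, hM.conn_zero_zero_right hx,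
    hM.conn_succ_zero_succ hx, hM.conn_zero_succ_succ hx, hM.conn_succ_succ_zero hx,
    hM.conn_succ_succ_succ hx, hM.frameDeriv_conn_succ hx, S.commCoeff_zero_left _ _ hx.2,
    S.commCoeff_succ_succ_zero _ _ hx.2, S.commCoeff_succ_succ_succ _ _ _ hx.2]
  fin_cases a <;> fin_cases b <;> simp [Fin.sum_univ_three] <;> field_simp <;> ring

theorem ricci_zero_zero (hM : M.IsConformallyOrthonormal s) (hx : x ∈ M.region) :
    ricci S.e M.g 0 0 x
      = -3 * (hubbleDeriv s (x 0) + (deriv s (x 0) / (2 * s (x 0))) ^ 2) := by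
  have hs := (hM.pos _ hx.1).ne'
  simp only [ricci, riemann]
  rw [Fin.sum_univ_succ]
  simp only [Fin.sum_univ_succ (n := 3), hM.frameDeriv_zero_conn_succ_succ_zero hx,
    hM.frameDeriv_conn_succ_zero_zero hx, hM.conn_succ_zero_zero hx,
    hM.frameDeriv_conn_zero_zero_left hx, hM.conn_zero_zero_left hx, hM.conn_zero_zero_right hx,
    hM.conn_succ_zero_succ hx, hM.conn_zero_succ_succ hx, hM.conn_succ_succ_zero hx,
    hM.conn_succ_succ_succ hx, hM.frameDeriv_conn_succ hx, S.commCoeff_zero_left _ _ hx.2,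
    S.commCoeff_zero_right _ _ hx.2,
    S.commCoeff_succ_succ_zero _ _ hx.2, S.commCoeff_succ_succ_succ _ _ _ hx.2]
  simp [Fin.sum_univ_three]
  ring

theorem ricci_succ_zero (hM : M.IsConformallyOrthonormal s) (hx : x ∈ M.region) (a : Fin 3) :
    ricci S.e M.g a.succ 0 x = 0 := by
  simp only [ricci, riemann]
  rw [Fin.sum_univ_succ]
  simp only [Fin.sum_univ_succ (n := 3), hM.frameDeriv_zero_conn_succ hx,
    hM.frameDeriv_conn_succ_zero_succ hx,
    hM.frameDeriv_conn_zero_zero_left hx, hM.conn_zero_zero_left hx, hM.conn_zero_zero_right hx,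
    hM.conn_succ_zero_succ hx, hM.conn_zero_succ_succ hx, hM.conn_succ_succ_zero hx,
    hM.conn_succ_succ_succ hx, S.commCoeff_zero_left _ _ hx.2,
    S.commCoeff_zero_right _ _ hx.2, hM.conn_succ_zero_zero hx]
  fin_cases a <;> simp [Fin.sum_univ_three] <;> ring

/-- Computed separately from `ricci_succ_zero`, because symmetry of the Ricci tensor is not
available from its definition by components. Here the cancellation uses that the spatial connection
is torsion-free, `orthoConn_sub`. -/
theorem ricci_zero_succ (hM : M.IsConformallyOrthonormal s) (hx : x ∈ M.region) (b : Fin 3) :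
    ricci S.e M.g 0 b.succ x = 0 := by
  simp only [ricci, riemann]
  rw [Fin.sum_univ_succ]
  simp only [Fin.sum_univ_succ (n := 3), hM.frameDeriv_conn_zero_zero_right hx,
    hM.frameDeriv_conn_zero_zero_left hx, hM.frameDeriv_conn_succ_succ_zero hx,
    hM.conn_zero_zero_left hx, hM.conn_zero_zero_right hx,
    hM.conn_succ_zero_succ hx, hM.conn_zero_succ_succ hx, hM.conn_succ_succ_zero hx,
    hM.conn_succ_succ_succ hx, S.commCoeff_zero_left _ _ hx.2, hM.conn_succ_zero_zero hx,
    S.commCoeff_succ_succ_succ _ _ _ hx.2, ← S.orthoConn_sub]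
  fin_cases b <;> simp [Fin.sum_univ_three] <;> ring

end Curvature

end IsConformallyOrthonormal

end Cosmology

end ShearFree

/-! ### Component formulas for forms; the equations of a homogeneous scalar field. -/

namespace ShearFree

section Components

variable {n : ℕ} {e : Fin n → Pt n → Pt n} {g : Pt n → Matrix (Fin n) (Fin n) ℝ} {x : Pt n}

theorem covD_one (T : (Fin 1 → Fin n) → Pt n → ℝ) (μ a : Fin n) :
    covD e g T μ ![a] x = frameDeriv e (T ![a]) μ x - ∑ κ, conn e g κ μ a x * T ![κ] x := by
  have h : ∀ κ, Function.update ![a] 0 κ = ![κ] := fun κ => by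
    funext i; fin_cases i; simp
  simp [covD, h]

theorem covD_two (T : (Fin 2 → Fin n) → Pt n → ℝ) (μ a b : Fin n) :
    covD e g T μ ![a, b] x = frameDeriv e (T ![a, b]) μ x
      - ∑ κ, (conn e g κ μ a x * T ![κ, b] x + conn e g κ μ b x * T ![a, κ] x) := by
  have h0 : ∀ κ, Function.update ![a, b] 0 κ = ![κ, b] := fun κ => by
    funext i; fin_cases i <;> simp [Function.update]
  have h1 : ∀ κ, Function.update ![a, b] 1 κ = ![a, κ] := fun κ => by
    funext i; fin_cases i <;> simp [Function.update]
  rw [covD, Fin.sum_univ_two, ← Finset.sum_add_distrib]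
  simp only [h0, h1]
  simp

theorem covD_three (T : (Fin 3 → Fin n) → Pt n → ℝ) (μ a b c : Fin n) :
    covD e g T μ ![a, b, c] x = frameDeriv e (T ![a, b, c]) μ x
      - ∑ κ, (conn e g κ μ a x * T ![κ, b, c] x + conn e g κ μ b x * T ![a, κ, c] x
        + conn e g κ μ c x * T ![a, b, κ] x) := by
  have h0 : ∀ κ, Function.update ![a, b, c] 0 κ = ![κ, b, c] := fun κ => by
    funext i; fin_cases i <;> simp [Function.update]
  have h1 : ∀ κ, Function.update ![a, b, c] 1 κ = ![a, κ, c] := fun κ => by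
    funext i; fin_cases i <;> simp [Function.update]
  have h2 : ∀ κ, Function.update ![a, b, c] 2 κ = ![a, b, κ] := fun κ => by
    funext i; fin_cases i <;> simp [Function.update]
  rw [covD, Fin.sum_univ_three, ← Finset.sum_add_distrib, ← Finset.sum_add_distrib]
  simp only [h0, h1, h2]
  simp

theorem extD_one (T : (Fin 1 → Fin n) → Pt n → ℝ) (a b : Fin n) :
    extD e g T ![a, b] x = covD e g T a ![b] x - covD e g T b ![a] x := by
  have h0 : (fun j : Fin 1 => ![a, b] ((0 : Fin 2).succAbove j)) = ![b] := by
    funext i; fin_cases i; rfl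
  have h1 : (fun j : Fin 1 => ![a, b] ((1 : Fin 2).succAbove j)) = ![a] := by
    funext i; fin_cases i; rfl
  rw [extD, Fin.sum_univ_two, h0, h1]
  simp
  ring

theorem extD_two (T : (Fin 2 → Fin n) → Pt n → ℝ) (a b c : Fin n) :
    extD e g T ![a, b, c] x
      = covD e g T a ![b, c] x - covD e g T b ![a, c] x + covD e g T c ![a, b] x := by
  have h0 : (fun j : Fin 2 => ![a, b, c] ((0 : Fin 3).succAbove j)) = ![b, c] := by
    funext i; fin_cases i <;> rfl
  have h1 : (fun j : Fin 2 => ![a, b, c] ((1 : Fin 3).succAbove j)) = ![a, c] := by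
    funext i; fin_cases i <;> rfl
  have h2 : (fun j : Fin 2 => ![a, b, c] ((2 : Fin 3).succAbove j)) = ![a, b] := by
    funext i; fin_cases i <;> rfl
  rw [extD, Fin.sum_univ_three, h0, h1, h2]
  simp
  ring

theorem extD_three (T : (Fin 3 → Fin n) → Pt n → ℝ) (a b c d : Fin n) :
    extD e g T ![a, b, c, d] x
      = covD e g T a ![b, c, d] x - covD e g T b ![a, c, d] x + covD e g T c ![a, b, d] x
        - covD e g T d ![a, b, c] x := by
  have h0 : (fun j : Fin 3 => ![a, b, c, d] ((0 : Fin 4).succAbove j)) = ![b, c, d] := by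
    funext i; fin_cases i <;> rfl
  have h1 : (fun j : Fin 3 => ![a, b, c, d] ((1 : Fin 4).succAbove j)) = ![a, c, d] := by
    funext i; fin_cases i <;> rfl
  have h2 : (fun j : Fin 3 => ![a, b, c, d] ((2 : Fin 4).succAbove j)) = ![a, b, d] := by
    funext i; fin_cases i <;> rfl
  have h3 : (fun j : Fin 3 => ![a, b, c, d] ((3 : Fin 4).succAbove j)) = ![a, b, c] := by
    funext i; fin_cases i <;> rfl
  rw [extD, Fin.sum_univ_four, h0, h1, h2, h3]
  simp
  ring

theorem sum_fin_zero_fun (f : (Fin 0 → Fin n) → ℝ) : ∑ K, f K = f ![] := by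
  simp only [Finset.univ_unique, Finset.sum_singleton]
  congr

theorem sum_fin_one_fun (f : (Fin 1 → Fin n) → ℝ) : ∑ K, f K = ∑ a, f ![a] := by
  rw [sum_fin_fun_cons]
  simp only [sum_fin_zero_fun]
  rfl

theorem sum_fin_two_fun (f : (Fin 2 → Fin n) → ℝ) : ∑ K, f K = ∑ a, ∑ b, f ![a, b] := by
  rw [sum_fin_fun_cons]
  simp only [sum_fin_one_fun]
  rfl

theorem sum_fin_three_fun (f : (Fin 3 → Fin n) → ℝ) :
    ∑ K, f K = ∑ a, ∑ b, ∑ c, f ![a, b, c] := by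
  rw [sum_fin_fun_cons]
  simp only [sum_fin_two_fun]
  rfl

/-- Contraction with respect to a diagonal metric. -/
theorem contract_of_inv_diagonal {k : ℕ} {g : Matrix (Fin 4) (Fin 4) ℝ} {d : Fin 4 → ℝ}
    (hg : g⁻¹ = Matrix.diagonal d) (F G : (Fin k → Fin 4) → ℝ) :
    contract g F G = ∑ I : Fin k → Fin 4, (∏ i, d (I i)) * F I * G I := by
  rw [contract, hg]
  refine Finset.sum_congr rfl fun I _ => ?_
  rw [Finset.sum_eq_single I]
  · simp
  · intro J _ hJ
    obtain ⟨i, hi⟩ := Function.ne_iff.1 hJ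
    rw [Finset.prod_eq_zero (Finset.mem_univ i)]
    · ring
    · rw [Matrix.diagonal_apply_ne _ (Ne.symm hi)]
  · simp

theorem contract_zero {g : Matrix (Fin 4) (Fin 4) ℝ} {d : Fin 4 → ℝ}
    (hg : g⁻¹ = Matrix.diagonal d) (F G : (Fin 0 → Fin 4) → ℝ) :
    contract g F G = F ![] * G ![] := by
  rw [contract_of_inv_diagonal hg, sum_fin_zero_fun]
  simp

theorem contract_one {g : Matrix (Fin 4) (Fin 4) ℝ} {d : Fin 4 → ℝ}
    (hg : g⁻¹ = Matrix.diagonal d) (F G : (Fin 1 → Fin 4) → ℝ) :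
    contract g F G = ∑ a, d a * F ![a] * G ![a] := by
  rw [contract_of_inv_diagonal hg, sum_fin_one_fun]
  simp

theorem contract_two {g : Matrix (Fin 4) (Fin 4) ℝ} {d : Fin 4 → ℝ}
    (hg : g⁻¹ = Matrix.diagonal d) (F G : (Fin 2 → Fin 4) → ℝ) :
    contract g F G = ∑ a, ∑ b, d a * d b * F ![a, b] * G ![a, b] := by
  rw [contract_of_inv_diagonal hg, sum_fin_two_fun]
  simp [Fin.prod_univ_succ]

theorem contract_three {g : Matrix (Fin 4) (Fin 4) ℝ} {d : Fin 4 → ℝ}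
    (hg : g⁻¹ = Matrix.diagonal d) (F G : (Fin 3 → Fin 4) → ℝ) :
    contract g F G = ∑ a, ∑ b, ∑ c, d a * d b * d c * F ![a, b, c] * G ![a, b, c] := by
  rw [contract_of_inv_diagonal hg, sum_fin_three_fun]
  simp [Fin.prod_univ_succ, mul_assoc]

theorem IsAlternating.swap₂ {F : (Fin 2 → Fin n) → ℝ} (hF : IsAlternating F) (a b : Fin n) :
    F ![a, b] = - F ![b, a] := by
  have h := hF ![b, a] (Equiv.swap 0 1)
  have h1 : (fun i => ![b, a] (Equiv.swap 0 1 i)) = ![a, b] := by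
    funext i; fin_cases i <;> simp
  rw [h1] at h
  simpa using h

theorem IsAlternating.self₂ {F : (Fin 2 → Fin n) → ℝ} (hF : IsAlternating F) (a : Fin n) :
    F ![a, a] = 0 := by
  have := hF.swap₂ a a
  linarith

theorem IsAlternating.swap₃ {F : (Fin 3 → Fin n) → ℝ} (hF : IsAlternating F) (a b c : Fin n) :
    F ![a, b, c] = - F ![b, a, c] := by
  have h := hF ![b, a, c] (Equiv.swap 0 1)
  have h1 : (fun i => ![b, a, c] (Equiv.swap 0 1 i)) = ![a, b, c] := by
    funext i; fin_cases i <;> simp [Equiv.swap_apply_def]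
  rw [h1] at h
  simpa using h

theorem IsAlternating.swap₃' {F : (Fin 3 → Fin n) → ℝ} (hF : IsAlternating F) (a b c : Fin n) :
    F ![a, b, c] = - F ![a, c, b] := by
  have h := hF ![a, c, b] (Equiv.swap 1 2)
  have h1 : (fun i => ![a, c, b] (Equiv.swap 1 2 i)) = ![a, b, c] := by
    funext i; fin_cases i <;> simp [Equiv.swap_apply_def]
  rw [h1] at h
  simpa using h

theorem IsAlternating.self₃ {F : (Fin 3 → Fin n) → ℝ} (hF : IsAlternating F) (a c : Fin n) :
    F ![a, a, c] = 0 := by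
  have := hF.swap₃ a a c
  linarith

theorem IsAlternating.self₃' {F : (Fin 3 → Fin n) → ℝ} (hF : IsAlternating F) (a b : Fin n) :
    F ![a, b, b] = 0 := by
  have := hF.swap₃' a b b
  linarith

theorem IsAlternating.self₃'' {F : (Fin 3 → Fin n) → ℝ} (hF : IsAlternating F) (a b : Fin n) :
    F ![a, b, a] = 0 := by
  rw [hF.swap₃', hF.self₃, neg_zero]

end Components

/-- The trace `τ_a = D_{ab}^b` of the commutation functions. -/
def SpatialFrame.commTrace (S : SpatialFrame) (a : Fin 3) (y : Pt 3) : ℝ :=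
  ∑ b, commCoeff S.E a b b y

/-- `v` is a constant, closed and coclosed one-form. -/
def SpatialFrame.IsHarmonic (S : SpatialFrame) (v : Fin 3 → ℝ) : Prop :=
  ∀ y ∈ S.U, (∀ a b, ∑ c, commCoeff S.E a b c y * v c = 0) ∧ ∑ c, S.commTrace c y * v c = 0

namespace Cosmology

variable {S : SpatialFrame} {n : ℕ} {M : Cosmology S n} {s : ℝ → ℝ}

theorem mem_region {t : ℝ} (ht : t ∈ M.I) {y : Pt 3} (hy : y ∈ S.U) :
    (Fin.cons t y : Pt 4) ∈ M.region := ⟨ht, hy⟩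

theorem eq_of_deriv_eq_zero {f : ℝ → ℝ} (hf : ∀ t ∈ M.I, HasDerivAt f 0 t) {t u : ℝ}
    (ht : t ∈ M.I) (hu : u ∈ M.I) : f t = f u :=
  M.isOpen.is_const_of_deriv_eq_zero M.isConnected.isPreconnected
    (fun v hv => (hf v hv).differentiableAt.differentiableWithinAt)
    (fun v hv => (hf v hv).deriv) ht hu

namespace IsConformallyOrthonormal

/-- Harmonic one-forms as sources of the anisotropic stress: the spatial stress tensor of a
homogeneous gauge field without energy flux. -/
def StressForm (M : Cosmology S n) (s : ℝ → ℝ) (p : ℕ) (α : ℝ)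
    (F : ℝ → (Fin (p + 1) → Fin 4) → ℝ) (v : Fin 3 → ℝ) (W : Fin 3 → Fin 3 → ℝ) : Prop :=
  S.IsHarmonic v ∧ ∃ l : ℝ → ℝ, ∀ x ∈ M.region, ∀ a b : Fin 3,
    emt p α (M.g x) (F (x 0)) a.succ b.succ
      = (if a = b then l (x 0) else 0) + v a * v b + W a b / s (x 0)

section ZeroForm

variable {α : ℝ} {F : ℝ → (Fin 1 → Fin 4) → ℝ} {x : Pt 4}

theorem frameDeriv_form {k : ℕ} {F : ℝ → (Fin k → Fin 4) → ℝ}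
    (hF : ∀ J, ContDiffOn ℝ ∞ (fun t => F t J) M.I) (hx : x ∈ M.region) (J : Fin k → Fin 4) :
    frameDeriv S.e (fun x => F (x 0) J) 0 x = deriv (fun t => F t J) (x 0) :=
  S.frameDeriv_zero_comp_time (fun t => F t J) x (differentiableAt_of_contDiffOn M.isOpen (hF J) hx.1)

theorem frameDeriv_form_succ {k : ℕ} {F : ℝ → (Fin k → Fin 4) → ℝ}
    (hF : ∀ J, ContDiffOn ℝ ∞ (fun t => F t J) M.I) (hx : x ∈ M.region) (J : Fin k → Fin 4)
    (a : Fin 3) : frameDeriv S.e (fun x => F (x 0) J) a.succ x = 0 :=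
  S.frameDeriv_succ_comp_time (fun t => F t J) a x
    (differentiableAt_of_contDiffOn M.isOpen (hF J) hx.1)

theorem emt_zero (hM : M.IsConformallyOrthonormal s) (hx : x ∈ M.region)
    (F : (Fin 1 → Fin 4) → ℝ) (μ ν : Fin 4) :
    emt 0 α (M.g x) F μ ν = α * (F ![μ] * F ![ν]
      - 1 / 2 * M.g x μ ν * (-F ![0] ^ 2 + (s (x 0))⁻¹ * ∑ a : Fin 3, F ![a.succ] ^ 2)) := by
  have h0 : ∀ μ, F (Fin.cons μ ![]) = F ![μ] := fun μ => rfl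
  rw [emt, contract_zero (hM.g_inv_diag hx), contract_one (hM.g_inv_diag hx),
    Fin.sum_univ_succ (n := 3), h0, h0, Finset.mul_sum]
  simp
  left
  left
  ring_nf

/-- Only the antisymmetric part of the connection survives, which is the commutator; the
coefficients producing `F_0` are symmetric and cancel. -/
theorem extD_zero_form (hM : M.IsConformallyOrthonormal s)
    (hF : ∀ J, ContDiffOn ℝ ∞ (fun t => F t J) M.I) (hx : x ∈ M.region) (a b : Fin 3) :
    extD S.e M.g (fun J x => F (x 0) J) ![a.succ, b.succ] x
      = - ∑ c, commCoeff S.E a b c (Fin.tail x) * F (x 0) ![c.succ] := by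
  rw [extD_one, covD_one, covD_one, frameDeriv_form_succ hF hx, frameDeriv_form_succ hF hx,
    Fin.sum_univ_succ (n := 3), Fin.sum_univ_succ (n := 3)]
  simp only [hM.conn_zero_succ_succ hx, hM.conn_succ_succ_succ hx, ← S.orthoConn_sub, sub_mul,
    Finset.sum_sub_distrib, eq_comm (a := b)]
  ring

theorem extD_zero_form_time (hM : M.IsConformallyOrthonormal s)
    (hF : ∀ J, ContDiffOn ℝ ∞ (fun t => F t J) M.I) (hx : x ∈ M.region) (a : Fin 3) :
    extD S.e M.g (fun J x => F (x 0) J) ![0, a.succ] x = deriv (fun t => F t ![a.succ]) (x 0) := by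
  rw [extD_one, covD_one, covD_one, frameDeriv_form hF hx, frameDeriv_form_succ hF hx,
    Fin.sum_univ_succ (n := 3), Fin.sum_univ_succ (n := 3)]
  simp only [hM.conn_zero_zero_left hx, hM.conn_zero_zero_right hx, hM.conn_succ_zero_succ hx,
    hM.conn_succ_succ_zero hx]
  ring

/-- The wave equation: the damping term `3H` comes from the spatial trace of the connection, and the
divergence of a one-form with constant components is given by the trace of the commutators. -/
theorem diverg_zero_form (hM : M.IsConformallyOrthonormal s)
    (hF : ∀ J, ContDiffOn ℝ ∞ (fun t => F t J) M.I) (hx : x ∈ M.region) :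
    diverg S.e M.g (fun J x => F (x 0) J) ![] x
      = - deriv (fun t => F t ![0]) (x 0) - 3 * M.hubble x * F (x 0) ![0]
        - (s (x 0))⁻¹ * ∑ c, S.commTrace c (Fin.tail x) * F (x 0) ![c.succ] := by
  have h0 : ∀ μ, (Fin.cons μ ![] : Fin 1 → Fin 4) = ![μ] := fun μ => rfl
  have hs := (hM.pos _ hx.1).ne'
  rw [diverg, hM.g_inv_diag hx]
  simp only [Matrix.diagonal_apply, h0, covD_one, ite_mul, zero_mul, Finset.sum_ite_eq,
    Finset.mem_univ, if_true]
  rw [Fin.sum_univ_succ (n := 3)]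
  simp only [Fin.sum_univ_succ (n := 3) (f := fun κ => conn _ _ κ _ _ _ * _), Fin.cons_zero,
    Fin.cons_succ, hM.conn_zero_zero_left hx, hM.conn_succ_zero_zero hx,
    hM.conn_zero_succ_succ hx, hM.conn_succ_succ_succ hx, frameDeriv_form hF hx,
    frameDeriv_form_succ hF hx, hM.hubble_eq hx, SpatialFrame.commTrace, SpatialFrame.orthoConn]
  simp [Fin.sum_univ_three]
  simp only [S.commCoeff_antisymm 1 0, S.commCoeff_antisymm 2 0, S.commCoeff_antisymm 2 1]
  have h1 : ∀ a b, commCoeff S.E a a b (Fin.tail x) = 0 := fun a b => by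
    have := S.commCoeff_antisymm a a b (Fin.tail x)
    linarith
  simp only [h1]
  field_simp
  ring

end ZeroForm

end IsConformallyOrthonormal

end Cosmology

end ShearFree

/-! ### Anisotropic stress of scalar and Maxwell fields. -/

namespace ShearFree

namespace SpatialFrame

variable (S : SpatialFrame)

/-- The curl of one-forms with constant components: the commutation functions `D_{a+1, a+2}^c`. -/
def curl (a c : Fin 3) (y : Pt 3) : ℝ := commCoeff S.E (a + 1) (a + 2) c y

theorem commCoeff_self (a c : Fin 3) (y : Pt 3) : commCoeff S.E a a c y = 0 := by
  have := S.commCoeff_antisymm a a c y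
  linarith

theorem isHarmonic_zero : S.IsHarmonic 0 := fun y _ => by simp

/-- The three cyclic index pairs suffice, since the commutation functions are antisymmetric. -/
theorem isHarmonic_of_curl {v : Fin 3 → ℝ}
    (h : ∀ y ∈ S.U, (∀ a, ∑ c, S.curl a c y * v c = 0) ∧ ∑ c, S.commTrace c y * v c = 0) :
    S.IsHarmonic v := by
  intro y hy
  obtain ⟨h1, h2⟩ := h y hy
  refine ⟨fun a b => ?_, h2⟩
  have h3 := h1 0
  have h4 := h1 1
  have h5 := h1 2
  simp only [curl, Fin.sum_univ_three] at h3 h4 h5 ⊢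
  simp at h3 h4 h5
  fin_cases a <;> fin_cases b <;> simp [commCoeff_self]
  · exact h5
  · rw [S.commCoeff_antisymm 0 2, S.commCoeff_antisymm 0 2, S.commCoeff_antisymm 0 2]; linarith
  · rw [S.commCoeff_antisymm 1 0, S.commCoeff_antisymm 1 0, S.commCoeff_antisymm 1 0]; linarith
  · exact h3
  · exact h4
  · rw [S.commCoeff_antisymm 2 1, S.commCoeff_antisymm 2 1, S.commCoeff_antisymm 2 1]; linarith

end SpatialFrame

namespace Cosmology

namespace IsConformallyOrthonormal

variable {S : SpatialFrame} {n : ℕ} {M : Cosmology S n} {s : ℝ → ℝ} {α : ℝ} {x : Pt 4}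

/-- Covers the fields with negative prefactor that are forced to vanish, for which no square root of
`α` exists. -/
theorem stressForm_of_eq_zero {p : ℕ} {F : ℝ → (Fin (p + 1) → Fin 4) → ℝ}
    (h : ∀ t ∈ M.I, F t = 0) : StressForm M s p α F 0 0 := by
  refine ⟨S.isHarmonic_zero, 0, fun x hx a b => ?_⟩
  rw [h _ hx.1]
  simp [emt, contract]

/-- Closedness makes the spatial gradient constant in time and spatially closed. If it is nonzero,
zero flux eliminates the time derivative of the scalar and the wave equation says that the gradient
is coclosed. The square root of `α` is absorbed into `v`. -/
theorem stressForm_zero (hM : M.IsConformallyOrthonormal s) (hα : 0 < α)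
    {F : ℝ → (Fin 1 → Fin 4) → ℝ} (hF : ∀ J, ContDiffOn ℝ ∞ (fun t => F t J) M.I)
    (hc : ∀ x ∈ M.region, ∀ J, extD S.e M.g (fun J x => F (x 0) J) J x = 0)
    (hd : ∀ x ∈ M.region, ∀ J, diverg S.e M.g (fun J x => F (x 0) J) J x = 0)
    (hf : ∀ x ∈ M.region, ∀ a : Fin 3, emt 0 α (M.g x) (F (x 0)) 0 a.succ = 0) :
    ∃ v W, StressForm M s 0 α F v W := by
  obtain ⟨t₀, ht₀⟩ := M.isConnected.nonempty
  obtain ⟨y₀, hy₀⟩ := S.isConnected.nonempty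
  have hconst : ∀ t ∈ M.I, ∀ a : Fin 3, F t ![a.succ] = F t₀ ![a.succ] := fun t ht a => by
    refine eq_of_deriv_eq_zero (M := M) (f := fun t => F t ![a.succ]) (fun u hu => ?_) ht ht₀
    have h := hM.extD_zero_form_time hF (mem_region hu hy₀) a
    rw [hc _ (mem_region hu hy₀)] at h
    have h1 := (differentiableAt_of_contDiffOn M.isOpen (hF ![a.succ]) hu).hasDerivAt
    have h2 : deriv (fun t => F t ![a.succ]) u = 0 := h.symm
    rwa [h2] at h1
  -- The flux of a scalar field is `α F_0 F_a`.
  have hfl : ∀ t ∈ M.I, ∀ a : Fin 3, F t ![0] * F t₀ ![a.succ] = 0 := fun t ht a => by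
    have h := hf _ (mem_region ht hy₀) a
    rw [hM.emt_zero (mem_region ht hy₀), hM.g_eq (mem_region ht hy₀)] at h
    simp at h
    rw [hconst t ht] at h
    rcases h with h | h | h
    · exact absurd h hα.ne'
    · rw [h, zero_mul]
    · rw [h, mul_zero]
  refine ⟨fun a => Real.sqrt α * F t₀ ![a.succ], 0, ?_, ?_⟩
  · intro y hy
    have hx := mem_region ht₀ hy
    constructor
    · intro a b
      have h := hM.extD_zero_form hF hx a b
      rw [hc _ hx] at h
      have h1 : ∑ c, commCoeff S.E a b c y * F t₀ ![c.succ] = 0 := by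
        have : ∑ c, commCoeff S.E a b c (Fin.tail (Fin.cons t₀ y : Pt 4))
          * F ((Fin.cons t₀ y : Pt 4) 0) ![c.succ] = 0 := by linarith
        exact this
      calc _ = Real.sqrt α * ∑ c, commCoeff S.E a b c y * F t₀ ![c.succ] := by
            rw [Finset.mul_sum]; exact Finset.sum_congr rfl fun _ _ => by ring
        _ = 0 := by rw [h1, mul_zero]
    -- A nonzero component of the gradient is nonzero at all times, so `F_0` vanishes identically
    -- and with it its derivative; a zero gradient is trivially coclosed.
    · by_cases hv : ∀ a : Fin 3, F t₀ ![a.succ] = 0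
      · simp [hv]
      · push Not at hv
        obtain ⟨a, ha⟩ := hv
        have hF0 : ∀ t ∈ M.I, F t ![0] = 0 := fun t ht =>
          (mul_eq_zero.1 (hfl t ht a)).resolve_right ha
        have hF0' : deriv (fun t => F t ![0]) t₀ = 0 := by
          have : (fun t => F t ![0]) =ᶠ[nhds t₀] fun _ => 0 := by
            filter_upwards [M.isOpen.mem_nhds ht₀] with t ht using hF0 t ht
          rw [this.deriv_eq]; simp
        have h := hM.diverg_zero_form hF hx
        have h1 : (Fin.cons t₀ y : Pt 4) 0 = t₀ := rfl
        have h2 : Fin.tail (Fin.cons t₀ y : Pt 4) = y := rfl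
        rw [hd _ hx, h1, h2, hF0', hF0 t₀ ht₀] at h
        have hs := (inv_pos.2 (hM.pos t₀ ht₀)).ne'
        have h3 : ∑ c, S.commTrace c y * F t₀ ![c.succ] = 0 := by
          have : (s t₀)⁻¹ * ∑ c, S.commTrace c y * F t₀ ![c.succ] = 0 := by linarith
          exact (mul_eq_zero.1 this).resolve_left hs
        calc _ = Real.sqrt α * ∑ c, S.commTrace c y * F t₀ ![c.succ] := by
              rw [Finset.mul_sum]; exact Finset.sum_congr rfl fun _ _ => by ring
          _ = 0 := by rw [h3, mul_zero]
  · refine ⟨fun t => α * (- (1 / 2) * s t * (-F t ![0] ^ 2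
      + (s t)⁻¹ * ∑ a : Fin 3, F t ![a.succ] ^ 2)), fun x hx a b => ?_⟩
    have hsq := Real.mul_self_sqrt hα.le
    rw [hM.emt_zero hx, hM.g_eq hx, timeBlock_succ_succ, SpatialFrame.smul_one_apply,
      hconst _ hx.1 a, hconst _ hx.1 b]
    simp only [Pi.zero_apply, zero_div, add_zero]
    split_ifs
    · linear_combination (-F t₀ ![a.succ] * F t₀ ![b.succ]) * hsq
    · linear_combination (-F t₀ ![a.succ] * F t₀ ![b.succ]) * hsq

section OneForm

variable {F : ℝ → (Fin 2 → Fin 4) → ℝ}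

/-- The magnetic part of a two-form. -/
def mag (F : (Fin 2 → Fin 4) → ℝ) (a : Fin 3) : ℝ := F ![(a + 1).succ, (a + 2).succ]

theorem emt_one_succ (hM : M.IsConformallyOrthonormal s) (hx : x ∈ M.region)
    {F : (Fin 2 → Fin 4) → ℝ} (hF : IsAlternating F) (a b : Fin 3) :
    emt 1 α (M.g x) F a.succ b.succ
      = (if a = b then α / 2 * (∑ c : Fin 3, F ![0, c.succ] ^ 2 + (∑ c, mag F c ^ 2) / s (x 0))
          else 0) - α * (F ![0, a.succ] * F ![0, b.succ] + mag F a * mag F b / s (x 0)) := by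
  have hs := (hM.pos _ hx.1).ne'
  have h0 : ∀ μ ν, F (Fin.cons μ ![ν]) = F ![μ, ν] := fun μ ν => rfl
  rw [emt, contract_one (hM.g_inv_diag hx), contract_two (hM.g_inv_diag hx), hM.g_eq hx,
    timeBlock_succ_succ, SpatialFrame.smul_one_apply]
  simp only [h0, Fin.sum_univ_succ (n := 3), Fin.cons_zero, Fin.cons_succ, hF.self₂,
    hF.swap₂ _ 0, mag]
  have h1 := hF.swap₂ 2 1
  have h2 := hF.swap₂ 3 1
  have h3 := hF.swap₂ 3 2
  fin_cases a <;> fin_cases b <;> simp [Fin.sum_univ_three, h1, h2, h3, hF.self₂] <;>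
    field_simp <;> ring

theorem emt_one_zero_succ (hM : M.IsConformallyOrthonormal s) (hx : x ∈ M.region)
    {F : (Fin 2 → Fin 4) → ℝ} (hF : IsAlternating F) (a : Fin 3) :
    emt 1 α (M.g x) F 0 a.succ
      = α / s (x 0) * (F ![0, (a + 1).succ] * mag F (a + 2) - F ![0, (a + 2).succ] * mag F (a + 1)) := by
  have h0 : ∀ μ ν, F (Fin.cons μ ![ν]) = F ![μ, ν] := fun μ ν => rfl
  rw [emt, contract_one (hM.g_inv_diag hx), hM.g_eq hx]
  simp only [h0, Fin.sum_univ_succ (n := 3), Fin.cons_zero, Fin.cons_succ, hF.self₂, mag,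
    timeBlock_zero_succ]
  have h1 := hF.swap₂ 2 1
  have h2 := hF.swap₂ 3 1
  have h3 := hF.swap₂ 3 2
  fin_cases a <;> simp [Fin.sum_univ_three, h1, h2, h3, hF.self₂] <;> ring

/-- Faraday's law: in frame components the magnetic part changes only through the curl of the
electric part, without a Hubble term. -/
theorem extD_one_form (hM : M.IsConformallyOrthonormal s)
    (hF : ∀ J, ContDiffOn ℝ ∞ (fun t => F t J) M.I) (hA : ∀ t ∈ M.I, IsAlternating (F t))
    (hx : x ∈ M.region) (a b : Fin 3) :
    extD S.e M.g (fun J x => F (x 0) J) ![0, a.succ, b.succ] x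
      = deriv (fun t => F t ![a.succ, b.succ]) (x 0)
        + ∑ c, commCoeff S.E a b c (Fin.tail x) * F (x 0) ![0, c.succ] := by
  have hA' := hA _ hx.1
  rw [extD_two, covD_two, covD_two, covD_two, frameDeriv_form hF hx, frameDeriv_form_succ hF hx,
    frameDeriv_form_succ hF hx, Fin.sum_univ_succ (n := 3), Fin.sum_univ_succ (n := 3),
    Fin.sum_univ_succ (n := 3)]
  simp only [hM.conn_zero_zero_left hx, hM.conn_zero_zero_right hx, hM.conn_succ_zero_succ hx,
    hM.conn_succ_succ_zero hx, hM.conn_zero_succ_succ hx, hM.conn_succ_succ_succ hx, hA'.self₂,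
    ← S.orthoConn_sub, sub_mul, Finset.sum_sub_distrib, Finset.sum_add_distrib, ite_mul, zero_mul,
    Finset.sum_ite_eq', Finset.mem_univ, if_true, hA'.swap₂ (Fin.succ _) 0, hA'.swap₂ b.succ a.succ, mul_zero, ite_self]
  ring

/-- Ampère's law; the coefficient of the damping term is `H`, which makes `s E ⊗ E` insensitive to
the expansion. -/
theorem diverg_one_form (hM : M.IsConformallyOrthonormal s)
    (hF : ∀ J, ContDiffOn ℝ ∞ (fun t => F t J) M.I) (hA : ∀ t ∈ M.I, IsAlternating (F t))
    (hx : x ∈ M.region) (a : Fin 3) :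
    diverg S.e M.g (fun J x => F (x 0) J) ![a.succ] x
      = - deriv (fun t => F t ![0, a.succ]) (x 0) - M.hubble x * F (x 0) ![0, a.succ]
        + (s (x 0))⁻¹ * ∑ c, S.curl a c (Fin.tail x) * mag (F (x 0)) c := by
  have h0 : ∀ μ ν, (Fin.cons μ ![ν] : Fin 2 → Fin 4) = ![μ, ν] := fun μ ν => rfl
  have hA' := hA _ hx.1
  have hs := (hM.pos _ hx.1).ne'
  rw [diverg, hM.g_inv_diag hx]
  simp only [Matrix.diagonal_apply, h0, covD_two, ite_mul, zero_mul, Finset.sum_ite_eq,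
    Finset.mem_univ, if_true]
  rw [Fin.sum_univ_succ (n := 3)]
  simp only [Fin.sum_univ_succ (n := 3) (f := fun κ => conn _ _ κ _ _ _ * _ + _), Fin.cons_zero,
    Fin.cons_succ, hM.conn_zero_zero_left hx, hM.conn_succ_zero_zero hx, hM.conn_succ_zero_succ hx,
    hM.conn_zero_succ_succ hx, hM.conn_succ_succ_succ hx, frameDeriv_form hF hx,
    frameDeriv_form_succ hF hx, hM.hubble_eq hx, SpatialFrame.orthoConn, SpatialFrame.curl, mag,
    hA'.swap₂ (Fin.succ _) 0, hA'.self₂]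
  have h1 := hA'.swap₂ 2 1
  have h2 := hA'.swap₂ 3 1
  have h3 := hA'.swap₂ 3 2
  fin_cases a <;> simp [Fin.sum_univ_three, h1, h2, h3, hA'.self₂] <;>
  simp only [S.commCoeff_antisymm 1 0, S.commCoeff_antisymm 2 0, S.commCoeff_antisymm 2 1,
    S.commCoeff_self] <;> field_simp <;> ring

end OneForm

end IsConformallyOrthonormal

end Cosmology

end ShearFree

namespace ShearFree

namespace Cosmology

namespace IsConformallyOrthonormal

variable {S : SpatialFrame} {n : ℕ} {M : Cosmology S n} {s : ℝ → ℝ} {α : ℝ} {x : Pt 4}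

/-- The flux is the Poynting vector `E × B`, whose components are the minors of the pair `E, B`. -/
theorem electric_mul_mag_comm (hM : M.IsConformallyOrthonormal s) (hα : α ≠ 0)
    (hx : x ∈ M.region) {F : (Fin 2 → Fin 4) → ℝ} (hF : IsAlternating F)
    (hf : ∀ a : Fin 3, emt 1 α (M.g x) F 0 a.succ = 0) (a b : Fin 3) :
    F ![0, a.succ] * mag F b = F ![0, b.succ] * mag F a := by
  have hs := (hM.pos _ hx.1).ne'
  have h : ∀ a : Fin 3, F ![0, (a + 1).succ] * mag F (a + 2) = F ![0, (a + 2).succ] * mag F (a + 1) :=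
    fun a => by
      have h1 := hf a
      rw [hM.emt_one_zero_succ hx hF] at h1
      have := (mul_eq_zero.1 h1).resolve_left (div_ne_zero hα hs)
      linarith
  have h0 := h 0
  have h1 := h 1
  have h2 := h 2
  simp at h0 h1 h2
  fin_cases a <;> fin_cases b <;> simp
  · exact h2
  · exact h1.symm
  · exact h2.symm
  · exact h0
  · exact h1
  · exact h0.symm

/-- The conserved matrix is `w = s E ⊗ E + B ⊗ B`. The Hubble terms cancel because `2 H s` is the
derivative of `s`, and the curl terms cancel because `E` and `B` are parallel. The anisotropic
stress is `-α w / s`, so no sign of `α` is required and `v` may be zero. -/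
theorem stressForm_one (hM : M.IsConformallyOrthonormal s) (hα : α ≠ 0)
    {F : ℝ → (Fin 2 → Fin 4) → ℝ} (hF : ∀ J, ContDiffOn ℝ ∞ (fun t => F t J) M.I)
    (hA : ∀ t ∈ M.I, IsAlternating (F t))
    (hc : ∀ x ∈ M.region, ∀ J, extD S.e M.g (fun J x => F (x 0) J) J x = 0)
    (hd : ∀ x ∈ M.region, ∀ J, diverg S.e M.g (fun J x => F (x 0) J) J x = 0)
    (hf : ∀ x ∈ M.region, ∀ a : Fin 3, emt 1 α (M.g x) (F (x 0)) 0 a.succ = 0) :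
    ∃ v W, StressForm M s 1 α F v W := by
  obtain ⟨t₀, ht₀⟩ := M.isConnected.nonempty
  obtain ⟨y₀, hy₀⟩ := S.isConnected.nonempty
  let w : Fin 3 → Fin 3 → ℝ → ℝ := fun a b t =>
    s t * (F t ![0, a.succ] * F t ![0, b.succ]) + mag (F t) a * mag (F t) b
  have hw : ∀ a b, ∀ t ∈ M.I, w a b t = w a b t₀ := fun a b t ht => by
    refine eq_of_deriv_eq_zero (M := M) (f := w a b) (fun u hu => ?_) ht ht₀
    have hx := mem_region hu hy₀
    have hs := (hM.pos u hu).ne'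
    have hder : ∀ J, HasDerivAt (fun t => F t J) (deriv (fun t => F t J) u) u := fun J =>
      (differentiableAt_of_contDiffOn M.isOpen (hF J) hu).hasDerivAt
    have hE : ∀ a : Fin 3, deriv (fun t => F t ![0, a.succ]) u = - (deriv s u / (2 * s u)) *
        F u ![0, a.succ] + (s u)⁻¹ * ∑ c, S.curl a c y₀ * mag (F u) c := fun a => by
      have h := hM.diverg_one_form hF hA hx a
      rw [hd _ hx, hM.hubble_eq hx, show (Fin.cons u y₀ : Pt 4) 0 = u from rfl,
        show Fin.tail (Fin.cons u y₀ : Pt 4) = y₀ from rfl] at h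
      linarith
    have hB : ∀ a : Fin 3, HasDerivAt (fun t => mag (F t) a)
        (- ∑ c, S.curl a c y₀ * F u ![0, c.succ]) u := fun a => by
      have h := hM.extD_one_form hF hA hx (a + 1) (a + 2)
      rw [hc _ hx, show (Fin.cons u y₀ : Pt 4) 0 = u from rfl,
        show Fin.tail (Fin.cons u y₀ : Pt 4) = y₀ from rfl] at h
      have h1 := hder ![(a + 1).succ, (a + 2).succ]
      have h2 : deriv (fun t => F t ![(a + 1).succ, (a + 2).succ]) u
          = - ∑ c, S.curl a c y₀ * F u ![0, c.succ] := by
        simp only [SpatialFrame.curl]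
        linarith
      rwa [h2] at h1
    have hp := hM.electric_mul_mag_comm hα hx (hA u hu) (hf _ hx)
    have h := (((hM.differentiableAt hu).hasDerivAt.mul
      ((hder ![0, a.succ]).mul (hder ![0, b.succ]))).add ((hB a).mul (hB b)))
    refine HasDerivAt.congr_deriv h ?_
    simp only [Pi.mul_apply]
    rw [hE, hE]
    -- Parallelism lets `curl B` times `E` be exchanged for `curl E` times `B`, which makes Ampère's
    -- and Faraday's contributions opposite.
    have e1 : ∀ a b, (∑ c, S.curl a c y₀ * mag (F u) c) * F u ![0, b.succ]
        = (∑ c, S.curl a c y₀ * F u ![0, c.succ]) * mag (F u) b := fun a b => by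
      rw [Finset.sum_mul, Finset.sum_mul]
      exact Finset.sum_congr rfl fun c _ => by rw [mul_assoc, mul_assoc, hp c b]; ring
    have e2 := e1 a b
    have e3 := e1 b a
    field_simp
    linear_combination 2 * e2 + 2 * e3
  refine ⟨0, fun a b => - α * w a b t₀, S.isHarmonic_zero, fun t => α / 2 *
    (∑ c : Fin 3, F t ![0, c.succ] ^ 2 + (∑ c, mag (F t) c ^ 2) / s t), fun x hx a b => ?_⟩
  have hs := (hM.pos _ hx.1).ne'
  rw [hM.emt_one_succ hx (hA _ hx.1)]
  beta_reduce
  rw [← hw a b _ hx.1]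
  simp only [w, Pi.zero_apply]
  field_simp
  ring

/-! ### Anisotropic stress of two-form potentials. -/

section TwoForm

/-- The spatial vector dual to the components `F_{0ab}` of a three-form. -/
def dualVec (F : (Fin 3 → Fin 4) → ℝ) (a : Fin 3) : ℝ := F ![0, (a + 1).succ, (a + 2).succ]

theorem emt_two_succ (hM : M.IsConformallyOrthonormal s) (hx : x ∈ M.region)
    {F : (Fin 3 → Fin 4) → ℝ} (hF : IsAlternating F) (a b : Fin 3) :
    emt 2 α (M.g x) F a.succ b.succ
      = (if a = b then α / 2 * (F ![1, 2, 3] ^ 2 / s (x 0) ^ 2 - (∑ c, dualVec F c ^ 2) / s (x 0))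
          else 0) + α * (dualVec F a * dualVec F b / s (x 0)) := by
  have hs := (hM.pos _ hx.1).ne'
  have h0 : ∀ μ ν κ, F (Fin.cons μ ![ν, κ]) = F ![μ, ν, κ] := fun μ ν κ => rfl
  rw [emt, contract_two (hM.g_inv_diag hx), contract_three (hM.g_inv_diag hx), hM.g_eq hx,
    timeBlock_succ_succ, SpatialFrame.smul_one_apply]
  have h1 : ∀ a b : Fin 3, F ![a.succ, 0, b.succ] = - F ![0, a.succ, b.succ] := fun a b => hF.swap₃ _ _ _
  have h2 : ∀ a b : Fin 3, F ![a.succ, b.succ, 0] = F ![0, a.succ, b.succ] := fun a b => by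
    rw [hF.swap₃', h1, neg_neg]
  simp only [h0, Fin.sum_univ_succ (n := 3), Fin.cons_zero, Fin.cons_succ, hF.self₃, hF.self₃',
    hF.self₃'', h1, h2, dualVec]
  have e1 := hF.swap₃' 0 2 1
  have e2 := hF.swap₃' 0 3 1
  have e3 := hF.swap₃' 0 3 2
  have e4 : F ![1, 3, 2] = - F ![1, 2, 3] := hF.swap₃' _ _ _
  have e5 : F ![2, 1, 3] = - F ![1, 2, 3] := hF.swap₃ _ _ _
  have e6 : F ![2, 3, 1] = F ![1, 2, 3] := by rw [hF.swap₃', e5, neg_neg]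
  have e7 : F ![3, 1, 2] = F ![1, 2, 3] := by rw [hF.swap₃, e4, neg_neg]
  have e8 : F ![3, 2, 1] = - F ![1, 2, 3] := by rw [hF.swap₃', e7]
  fin_cases a <;> fin_cases b <;>
    simp [Fin.sum_univ_three, e1, e2, e3, e4, e5, e6, e7, e8, hF.self₃, hF.self₃', hF.self₃'',
      Nat.factorial, -mul_eq_mul_left_iff] <;>
    field_simp <;> ring

theorem emt_two_zero_succ (hM : M.IsConformallyOrthonormal s) (hx : x ∈ M.region)
    {F : (Fin 3 → Fin 4) → ℝ} (hF : IsAlternating F) (a : Fin 3) :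
    emt 2 α (M.g x) F 0 a.succ = α / s (x 0) ^ 2 * (F ![1, 2, 3] * dualVec F a) := by
  have hs := (hM.pos _ hx.1).ne'
  have h0 : ∀ μ ν κ, F (Fin.cons μ ![ν, κ]) = F ![μ, ν, κ] := fun μ ν κ => rfl
  rw [emt, contract_two (hM.g_inv_diag hx), hM.g_eq hx, timeBlock_zero_succ]
  have h1 : ∀ a b : Fin 3, F ![a.succ, 0, b.succ] = - F ![0, a.succ, b.succ] := fun a b => hF.swap₃ _ _ _
  have h2 : ∀ a b : Fin 3, F ![a.succ, b.succ, 0] = F ![0, a.succ, b.succ] := fun a b => by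
    rw [hF.swap₃', h1, neg_neg]
  simp only [h0, Fin.sum_univ_succ (n := 3), Fin.cons_zero, Fin.cons_succ, hF.self₃, hF.self₃',
    hF.self₃'', h1, h2, dualVec]
  have e1 := hF.swap₃' 0 2 1
  have e2 := hF.swap₃' 0 3 1
  have e3 := hF.swap₃' 0 3 2
  have e4 : F ![1, 3, 2] = - F ![1, 2, 3] := hF.swap₃' _ _ _
  have e5 : F ![2, 1, 3] = - F ![1, 2, 3] := hF.swap₃ _ _ _
  have e6 : F ![2, 3, 1] = F ![1, 2, 3] := by rw [hF.swap₃', e5, neg_neg]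
  have e7 : F ![3, 1, 2] = F ![1, 2, 3] := by rw [hF.swap₃, e4, neg_neg]
  have e8 : F ![3, 2, 1] = - F ![1, 2, 3] := by rw [hF.swap₃', e7]
  fin_cases a <;>
    simp [Fin.sum_univ_three, e1, e2, e3, e4, e5, e6, e7, e8, hF.self₃, hF.self₃', hF.self₃'',
      Nat.factorial, -mul_eq_mul_left_iff] <;>
    field_simp <;> ring

end TwoForm

end IsConformallyOrthonormal

end Cosmology

end ShearFree

namespace ShearFree

/-- The values of an alternating three-form on four-dimensional frames. -/
theorem IsAlternating.threeForm {F : (Fin 3 → Fin 4) → ℝ} (hF : IsAlternating F) :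
    (∀ a b : Fin 3, F ![a.succ, 0, b.succ] = - F ![0, a.succ, b.succ]) ∧
    (∀ a b : Fin 3, F ![a.succ, b.succ, 0] = F ![0, a.succ, b.succ]) ∧
    F ![0, 2, 1] = - F ![0, 1, 2] ∧ F ![0, 3, 1] = - F ![0, 1, 3] ∧
    F ![0, 3, 2] = - F ![0, 2, 3] ∧ F ![1, 3, 2] = - F ![1, 2, 3] ∧
    F ![2, 1, 3] = - F ![1, 2, 3] ∧ F ![2, 3, 1] = F ![1, 2, 3] ∧
    F ![3, 1, 2] = F ![1, 2, 3] ∧ F ![3, 2, 1] = - F ![1, 2, 3] := by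
  have h1 : ∀ a b : Fin 3, F ![a.succ, 0, b.succ] = - F ![0, a.succ, b.succ] :=
    fun a b => hF.swap₃ _ _ _
  have e4 : F ![1, 3, 2] = - F ![1, 2, 3] := hF.swap₃' _ _ _
  have e5 : F ![2, 1, 3] = - F ![1, 2, 3] := hF.swap₃ _ _ _
  have e7 : F ![3, 1, 2] = F ![1, 2, 3] := by rw [hF.swap₃, e4, neg_neg]
  exact ⟨h1, fun a b => by rw [hF.swap₃', h1, neg_neg], hF.swap₃' 0 2 1, hF.swap₃' 0 3 1,
    hF.swap₃' 0 3 2, e4, e5, by rw [hF.swap₃', e5, neg_neg], e7, by rw [hF.swap₃', e7]⟩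

namespace Cosmology

namespace IsConformallyOrthonormal

variable {S : SpatialFrame} {n : ℕ} {M : Cosmology S n} {s : ℝ → ℝ} {α : ℝ} {x : Pt 4}
  {F : ℝ → (Fin 3 → Fin 4) → ℝ}

theorem extD_two_form (hM : M.IsConformallyOrthonormal s) 
    (hF : ∀ J, ContDiffOn ℝ ∞ (fun t => F t J) M.I) (hA : ∀ t ∈ M.I, IsAlternating (F t))
    (hx : x ∈ M.region) :
    extD S.e M.g (fun J x => F (x 0) J) ![0, 1, 2, 3] x
      = deriv (fun t => F t ![1, 2, 3]) (x 0)
        + ∑ c, S.commTrace c (Fin.tail x) * dualVec (F (x 0)) c := by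
  have hA' := hA _ hx.1
  obtain ⟨h1, h2, e1, e2, e3, e4, e5, e6, e7, e8⟩ := hA'.threeForm
  rw [extD_three, covD_three, covD_three, covD_three, covD_three, frameDeriv_form hF hx,
    show (1 : Fin 4) = Fin.succ 0 from rfl, show (2 : Fin 4) = Fin.succ 1 from rfl,
    show (3 : Fin 4) = Fin.succ 2 from rfl,
    frameDeriv_form_succ hF hx, frameDeriv_form_succ hF hx, frameDeriv_form_succ hF hx]
  simp only [Fin.sum_univ_succ (n := 3),
    hM.conn_zero_zero_left hx, hM.conn_zero_zero_right hx, hM.conn_succ_zero_succ hx,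
    hM.conn_succ_succ_zero hx, hM.conn_zero_succ_succ hx, hM.conn_succ_succ_succ hx,
    SpatialFrame.orthoConn, SpatialFrame.commTrace, dualVec, hA'.self₃, hA'.self₃', hA'.self₃'',
    h1, h2]
  simp [Fin.sum_univ_three, e1, e2, e3, e4, e5, e6, e7, e8, hA'.self₃, hA'.self₃', hA'.self₃'']
  simp only [S.commCoeff_antisymm 1 0, S.commCoeff_antisymm 2 0, S.commCoeff_antisymm 2 1,
    S.commCoeff_self]
  ring

/-- This component contains no time derivative: it is the constraint that the dual vector has no
curl. -/
theorem diverg_two_form_time (hM : M.IsConformallyOrthonormal s)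
    (hF : ∀ J, ContDiffOn ℝ ∞ (fun t => F t J) M.I) (hA : ∀ t ∈ M.I, IsAlternating (F t))
    (hx : x ∈ M.region) (a : Fin 3) :
    diverg S.e M.g (fun J x => F (x 0) J) ![0, a.succ] x
      = - (s (x 0))⁻¹ * ∑ c, S.curl a c (Fin.tail x) * dualVec (F (x 0)) c := by
  have h0 : ∀ μ ν κ, (Fin.cons μ ![ν, κ] : Fin 3 → Fin 4) = ![μ, ν, κ] := fun μ ν κ => rfl
  have hA' := hA _ hx.1
  have hs := (hM.pos _ hx.1).ne'
  obtain ⟨h1, h2, e1, e2, e3, e4, e5, e6, e7, e8⟩ := hA'.threeForm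
  have hD : ∀ a, deriv (fun t => F t ![0, 0, a]) (x 0) = 0 := fun a => by
    have : (fun t => F t ![0, 0, a]) =ᶠ[nhds (x 0)] fun _ => 0 := by
      filter_upwards [M.isOpen.mem_nhds hx.1] with t ht using (hA t ht).self₃ _ _
    rw [this.deriv_eq]; simp
  rw [diverg, hM.g_inv_diag hx]
  simp only [Matrix.diagonal_apply, h0, covD_three, ite_mul, zero_mul, Finset.sum_ite_eq,
    Finset.mem_univ, if_true]
  simp only [Fin.sum_univ_succ (n := 3), Fin.cons_zero,
    Fin.cons_succ, hM.conn_zero_zero_left hx, hM.conn_zero_zero_right hx, hM.conn_succ_zero_zero hx,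
    hM.conn_succ_zero_succ hx, hM.conn_succ_succ_zero hx,
    hM.conn_zero_succ_succ hx, hM.conn_succ_succ_succ hx, frameDeriv_form hF hx,
    frameDeriv_form_succ hF hx, SpatialFrame.orthoConn, SpatialFrame.curl, dualVec, hD,
    hA'.self₃, hA'.self₃', hA'.self₃'', h1, h2]
  fin_cases a <;>
  simp [Fin.sum_univ_three, e1, e2, e3, e4, e5, e6, e7, e8, hA'.self₃, hA'.self₃', hA'.self₃''] <;>
  simp only [S.commCoeff_antisymm 1 0, S.commCoeff_antisymm 2 0, S.commCoeff_antisymm 2 1,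
    S.commCoeff_self] <;> field_simp <;> ring

/-- The evolution equation: the dual vector grows at the rate `H`, hence like the square root of
`s`. -/
theorem diverg_two_form (hM : M.IsConformallyOrthonormal s)
    (hF : ∀ J, ContDiffOn ℝ ∞ (fun t => F t J) M.I) (hA : ∀ t ∈ M.I, IsAlternating (F t))
    (hx : x ∈ M.region) (a : Fin 3) :
    diverg S.e M.g (fun J x => F (x 0) J) ![(a + 1).succ, (a + 2).succ] x
      = - deriv (fun t => dualVec (F t) a) (x 0) + M.hubble x * dualVec (F (x 0)) a := by
  have h0 : ∀ μ ν κ, (Fin.cons μ ![ν, κ] : Fin 3 → Fin 4) = ![μ, ν, κ] := fun μ ν κ => rfl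
  have hA' := hA _ hx.1
  have hs := (hM.pos _ hx.1).ne'
  obtain ⟨h1, h2, e1, e2, e3, e4, e5, e6, e7, e8⟩ := hA'.threeForm
  rw [diverg, hM.g_inv_diag hx]
  simp only [Matrix.diagonal_apply, h0, covD_three, ite_mul, zero_mul, Finset.sum_ite_eq,
    Finset.mem_univ, if_true]
  simp only [Fin.sum_univ_succ (n := 3), Fin.cons_zero,
    Fin.cons_succ, hM.conn_zero_zero_left hx, hM.conn_zero_zero_right hx, hM.conn_succ_zero_zero hx,
    hM.conn_succ_zero_succ hx, hM.conn_succ_succ_zero hx, hM.hubble_eq hx,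
    hM.conn_zero_succ_succ hx, hM.conn_succ_succ_succ hx, frameDeriv_form hF hx,
    frameDeriv_form_succ hF hx, SpatialFrame.orthoConn, SpatialFrame.curl, dualVec,
    hA'.self₃, hA'.self₃', hA'.self₃'', h1, h2]
  fin_cases a <;>
  simp [Fin.sum_univ_three, e1, e2, e3, e4, e5, e6, e7, e8, hA'.self₃, hA'.self₃', hA'.self₃''] <;>
  simp only [S.commCoeff_antisymm 1 0, S.commCoeff_antisymm 2 0, S.commCoeff_antisymm 2 1,
    S.commCoeff_self] <;> field_simp <;> ring

/-- The field equations of the three-form are dual to those of a gradient. The stress contains the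
dual vector quadratically over `s`, which is conserved; the constraint makes the vector closed, and
the Bianchi identity makes it coclosed once `F_{123}` is removed by zero flux. -/
theorem stressForm_two (hM : M.IsConformallyOrthonormal s) (hα : 0 < α)
    (hF : ∀ J, ContDiffOn ℝ ∞ (fun t => F t J) M.I) (hA : ∀ t ∈ M.I, IsAlternating (F t))
    (hc : ∀ x ∈ M.region, ∀ J, extD S.e M.g (fun J x => F (x 0) J) J x = 0)
    (hd : ∀ x ∈ M.region, ∀ J, diverg S.e M.g (fun J x => F (x 0) J) J x = 0)
    (hf : ∀ x ∈ M.region, ∀ a : Fin 3, emt 2 α (M.g x) (F (x 0)) 0 a.succ = 0) :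
    ∃ v W, StressForm M s 2 α F v W := by
  obtain ⟨t₀, ht₀⟩ := M.isConnected.nonempty
  obtain ⟨y₀, hy₀⟩ := S.isConnected.nonempty
  have hder : ∀ a, ∀ t ∈ M.I, HasDerivAt (fun t => dualVec (F t) a)
      (deriv s t / (2 * s t) * dualVec (F t) a) t := fun a t ht => by
    have hx := mem_region ht hy₀
    have h := hM.diverg_two_form hF hA hx a
    rw [hd _ hx, hM.hubble_eq hx, show (Fin.cons t y₀ : Pt 4) 0 = t from rfl] at h
    have h1 : HasDerivAt (fun t => dualVec (F t) a) (deriv (fun t => dualVec (F t) a) t) t :=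
      (differentiableAt_of_contDiffOn M.isOpen (hF _) ht).hasDerivAt
    have h2 : deriv (fun t => dualVec (F t) a) t = deriv s t / (2 * s t) * dualVec (F t) a := by
      linarith
    rwa [h2] at h1
  have hconst : ∀ a b, ∀ t ∈ M.I, dualVec (F t) a * dualVec (F t) b / s t
      = dualVec (F t₀) a * dualVec (F t₀) b / s t₀ := fun a b t ht => by
    refine eq_of_deriv_eq_zero (M := M)
      (f := fun t => dualVec (F t) a * dualVec (F t) b / s t) (fun u hu => ?_) ht ht₀
    have hs := (hM.pos u hu).ne'
    have h := ((hder a u hu).mul (hder b u hu)).div (hM.differentiableAt hu).hasDerivAt hs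
    refine HasDerivAt.congr_deriv h ?_
    simp only [Pi.mul_apply]
    field_simp
    ring
  have hs₀ := hM.pos t₀ ht₀
  have hsq := Real.mul_self_sqrt (div_pos hα hs₀).le
  -- The normalisation at `t₀` makes `v ⊗ v` equal to `α` times the conserved quotient.
  refine ⟨fun a => Real.sqrt (α / s t₀) * dualVec (F t₀) a, 0, ?_, fun t =>
    α / 2 * (F t ![1, 2, 3] ^ 2 / s t ^ 2 - (∑ c, dualVec (F t) c ^ 2) / s t), fun x hx a b => ?_⟩
  · have hmul : ∀ f : Fin 3 → ℝ, ∑ c, f c * dualVec (F t₀) c = 0 →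
        ∑ c, f c * (Real.sqrt (α / s t₀) * dualVec (F t₀) c) = 0 := fun f hf => by
      calc _ = Real.sqrt (α / s t₀) * ∑ c, f c * dualVec (F t₀) c := by
            rw [Finset.mul_sum]; exact Finset.sum_congr rfl fun _ _ => by ring
        _ = 0 := by rw [hf, mul_zero]
    refine S.isHarmonic_of_curl fun y hy => ⟨fun a => hmul _ ?_, hmul _ ?_⟩
    · have hx := mem_region ht₀ hy
      have h := hM.diverg_two_form_time hF hA hx a
      rw [hd _ hx] at h
      exact (mul_eq_zero.1 h.symm).resolve_left (neg_ne_zero.2 (inv_ne_zero hs₀.ne'))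
    · have hx := mem_region ht₀ hy
      have h := hM.extD_two_form hF hA hx
      rw [hc _ hx] at h
      by_cases hv : ∀ a : Fin 3, dualVec (F t₀) a = 0
      · simp [hv]
      · push Not at hv
        obtain ⟨a, ha⟩ := hv
        -- By continuity the dual vector is nonzero near `t₀`; there the flux condition kills
        -- `F_{123}`, so its derivative at `t₀` vanishes as well.
        have hF0 : (fun t => F t ![1, 2, 3]) =ᶠ[nhds t₀] fun _ => 0 := by
          filter_upwards [M.isOpen.mem_nhds ht₀,
            (hder a t₀ ht₀).continuousAt.eventually_ne ha] with t ht hta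
          have h1 : emt 2 α (M.g (Fin.cons t y)) (F t) 0 a.succ = 0 := hf _ (mem_region ht hy) a
          rw [hM.emt_two_zero_succ (mem_region ht hy) (hA t ht)] at h1
          have h2 : F t ![1, 2, 3] * dualVec (F t) a = 0 := (mul_eq_zero.1 h1).resolve_left
            (div_ne_zero hα.ne' (pow_ne_zero 2 (hM.pos t ht).ne'))
          exact (mul_eq_zero.1 h2).resolve_right hta
        have h3 : deriv (fun t => F t ![1, 2, 3]) t₀ = 0 := by rw [hF0.deriv_eq]; simp
        have h4 : 0 = deriv (fun t => F t ![1, 2, 3]) t₀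
          + ∑ c, S.commTrace c y * dualVec (F t₀) c := h
        rw [h3, zero_add] at h4
        exact h4.symm
  · rw [hM.emt_two_succ hx (hA _ hx.1), hconst a b _ hx.1]
    simp only [Pi.zero_apply, zero_div, add_zero]
    linear_combination (-dualVec (F t₀) a * dualVec (F t₀) b) * hsq

end IsConformallyOrthonormal

end Cosmology

end ShearFree

/-! ### Top forms, and positivity of the energy density. -/

namespace ShearFree

section TopForm

variable {F : (Fin 4 → Fin 4) → ℝ}

theorem IsAlternating.eq_zero_of_not_injective {k n : ℕ} {F : (Fin k → Fin n) → ℝ}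
    (hF : IsAlternating F) {J : Fin k → Fin n} (hJ : ¬ Function.Injective J) : F J = 0 := by
  obtain ⟨a, b, h, hab⟩ : ∃ a b, J a = J b ∧ a ≠ b := by
    simpa [Function.Injective] using hJ
  have h1 := hF J (Equiv.swap a b)
  have h2 : (fun i => J (Equiv.swap a b i)) = J := by
    funext i
    rw [Equiv.swap_apply_def]
    split_ifs with h3 h4
    · rw [h3, h]
    · rw [h4, h]
    · rfl
  rw [h2, Equiv.Perm.sign_swap hab] at h1
  push_cast at h1
  linarith

/-- An injective tuple of four indices is a permutation, and its sign disappears in the square. -/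
theorem IsAlternating.sq_topForm (hF : IsAlternating F) (J : Fin 4 → Fin 4) :
    F J ^ 2 = if Function.Injective J then F id ^ 2 else 0 := by
  split_ifs with hJ
  · have h := hF id (Equiv.ofBijective J (Finite.injective_iff_bijective.1 hJ))
    have h1 : (fun i => id (Equiv.ofBijective J (Finite.injective_iff_bijective.1 hJ) i)) = J := rfl
    rw [h1] at h
    rw [h, mul_pow, ← Int.cast_pow, ← Units.val_pow_eq_pow_val, Int.units_sq]
    simp
  · rw [hF.eq_zero_of_not_injective hJ]; simp

theorem prod_comp_of_injective (d : Fin 4 → ℝ) {J : Fin 4 → Fin 4} (hJ : Function.Injective J) :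
    ∏ i, d (J i) = ∏ i, d i :=
  (Equiv.ofBijective J (Finite.injective_iff_bijective.1 hJ)).prod_comp d

/-- The orderings of the three remaining indices; with the `24` below they cancel the factorials in
the energy-momentum tensor. -/
theorem card_injective_cons (μ : Fin 4) :
    (Finset.univ.filter fun I : Fin 3 → Fin 4 =>
      Function.Injective (Fin.cons μ I : Fin 4 → Fin 4)).card = 6 := by
  revert μ; decide +kernel

theorem card_injective :
    (Finset.univ.filter fun I : Fin 4 → Fin 4 => Function.Injective I).card = 24 := by
  decide +kernel

/-- The energy-momentum tensor of a top form is proportional to the metric. -/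
theorem emt_three {g : Matrix (Fin 4) (Fin 4) ℝ} {d : Fin 4 → ℝ} (hd : ∀ μ, d μ ≠ 0)
    (hg : g = Matrix.diagonal fun μ => (d μ)⁻¹) (hF : IsAlternating F) (α : ℝ) (μ ν : Fin 4) :
    emt 3 α g F μ ν = α / 2 * (∏ i, d i) * F id ^ 2 * g μ ν := by
  have hg' : g⁻¹ = Matrix.diagonal d := by
    refine Matrix.inv_eq_right_inv ?_
    rw [hg, Matrix.diagonal_mul_diagonal, ← Matrix.diagonal_one]
    congr 1
    funext i
    exact inv_mul_cancel₀ (hd i)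
  have h1 : contract g F F = 24 * (∏ i, d i) * F id ^ 2 := by
    rw [contract_of_inv_diagonal hg']
    have : ∀ J : Fin 4 → Fin 4, (∏ i, d (J i)) * F J * F J
        = if Function.Injective J then (∏ i, d i) * F id ^ 2 else 0 := fun J => by
      rw [mul_assoc, ← sq, hF.sq_topForm]
      split_ifs with hJ
      · rw [prod_comp_of_injective d hJ]
      · rw [mul_zero]
    rw [Finset.sum_congr rfl fun J _ => this J, ← Finset.sum_filter, Finset.sum_const,
      card_injective]
    simp
    ring
  have h2 : contract g (fun I : Fin 3 → Fin 4 => F (Fin.cons μ I)) (fun I => F (Fin.cons ν I))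
      = 6 * (∏ i, d i) * F id ^ 2 * g μ ν := by
    rw [contract_of_inv_diagonal hg']
    by_cases hμν : μ = ν
    · subst hμν
      have : ∀ I : Fin 3 → Fin 4, (∏ i, d (I i)) * F (Fin.cons μ I) * F (Fin.cons μ I)
          = if Function.Injective (Fin.cons μ I : Fin 4 → Fin 4) then
            (d μ)⁻¹ * ((∏ i, d i) * F id ^ 2) else 0 := fun I => by
        rw [mul_assoc, ← sq, hF.sq_topForm]
        split_ifs with hJ
        · rw [← prod_comp_of_injective d hJ, Fin.prod_univ_succ (n := 3)]
          simp only [Fin.cons_zero, Fin.cons_succ]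
          have := hd μ
          field_simp
        · rw [mul_zero]
      rw [Finset.sum_congr rfl fun J _ => this J, ← Finset.sum_filter, Finset.sum_const,
        card_injective_cons, hg, Matrix.diagonal_apply_eq]
      simp
      ring
    · rw [hg, Matrix.diagonal_apply_ne _ hμν, mul_zero]
      refine Finset.sum_eq_zero fun I _ => ?_
      -- If `μ` and `I` exhaust the four indices, then `ν ≠ μ` occurs in `I`, and the other factor
      -- has a repeated index.
      by_cases h : Function.Injective (Fin.cons μ I : Fin 4 → Fin 4)
      · have : ¬ Function.Injective (Fin.cons ν I : Fin 4 → Fin 4) := fun h' => by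
          obtain ⟨i, hi⟩ := (Finite.injective_iff_surjective.1 h) ν
          refine Fin.cases (fun hi => ?_) (fun j hi => ?_) i hi
          · exact hμν hi
          · have h3 : (Fin.cons ν I : Fin 4 → Fin 4) j.succ = (Fin.cons ν I : Fin 4 → Fin 4) 0 := hi
            exact absurd (h' h3) (Fin.succ_ne_zero j)
        rw [hF.eq_zero_of_not_injective this, mul_zero]
      · rw [hF.eq_zero_of_not_injective h]; ring
  rw [emt, h1, h2]
  simp [Nat.factorial]
  ring

end TopForm

section Energy

variable {g : Matrix (Fin 4) (Fin 4) ℝ} {r : ℝ}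

theorem emt_eq_mul (p : ℕ) (α : ℝ) (F : (Fin (p + 1) → Fin 4) → ℝ) (μ ν : Fin 4) :
    emt p α g F μ ν = α * emt p 1 g F μ ν := by
  rw [emt, emt, one_mul]

theorem emt_zero_energy (hg : g⁻¹ = Matrix.diagonal (Fin.cons (-1) fun _ => r)) (hg0 : g 0 0 = -1)
    (F : (Fin 1 → Fin 4) → ℝ) :
    emt 0 1 g F 0 0 = 1 / 2 * (F ![0] ^ 2 + r * ∑ a : Fin 3, F ![a.succ] ^ 2) := by
  have h0 : ∀ μ, F (Fin.cons μ ![]) = F ![μ] := fun μ => rfl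
  rw [emt, contract_zero hg, contract_one hg, Fin.sum_univ_succ (n := 3), h0, hg0]
  simp [Finset.mul_sum, Fin.sum_univ_three]
  ring

theorem emt_one_energy (hg : g⁻¹ = Matrix.diagonal (Fin.cons (-1) fun _ => r)) (hg0 : g 0 0 = -1)
    {F : (Fin 2 → Fin 4) → ℝ} (hF : IsAlternating F) :
    emt 1 1 g F 0 0 = 1 / 2 * (r * ∑ a : Fin 3, F ![0, a.succ] ^ 2 + r ^ 2 *
      (F ![1, 2] ^ 2 + F ![2, 3] ^ 2 + F ![1, 3] ^ 2)) := by
  have h0 : ∀ μ ν, F (Fin.cons μ ![ν]) = F ![μ, ν] := fun μ ν => rfl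
  rw [emt, contract_one hg, contract_two hg, hg0]
  simp only [h0, Fin.sum_univ_succ (n := 3), Fin.cons_zero, Fin.cons_succ, hF.self₂,
    hF.swap₂ (Fin.succ _) 0]
  have h1 := hF.swap₂ 2 1
  have h2 := hF.swap₂ 3 1
  have h3 := hF.swap₂ 3 2
  simp [Fin.sum_univ_three, h1, h2, h3, hF.self₂]
  ring

theorem emt_two_energy (hg : g⁻¹ = Matrix.diagonal (Fin.cons (-1) fun _ => r)) (hg0 : g 0 0 = -1)
    {F : (Fin 3 → Fin 4) → ℝ} (hF : IsAlternating F) :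
    emt 2 1 g F 0 0 = 1 / 2 * (r ^ 2 * (F ![0, 1, 2] ^ 2 + F ![0, 2, 3] ^ 2 + F ![0, 1, 3] ^ 2)
      + r ^ 3 * F ![1, 2, 3] ^ 2) := by
  have h0 : ∀ μ ν κ, F (Fin.cons μ ![ν, κ]) = F ![μ, ν, κ] := fun μ ν κ => rfl
  obtain ⟨h1, h2, e1, e2, e3, e4, e5, e6, e7, e8⟩ := hF.threeForm
  rw [emt, contract_two hg, contract_three hg, hg0]
  simp only [h0, Fin.sum_univ_succ (n := 3), Fin.cons_zero, Fin.cons_succ, hF.self₃, hF.self₃',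
    hF.self₃'', h1, h2]
  simp [Fin.sum_univ_three, e1, e2, e3, e4, e5, e6, e7, e8, hF.self₃, hF.self₃', hF.self₃'',
    Nat.factorial]
  ring

/-- The energy density is `α` times a positive definite quadratic form in the field strength. -/
theorem emt_one_pos {p : ℕ} (hp : p ≤ 3) (hr : 0 < r)
    (hg : g = Matrix.diagonal (Fin.cons (-1) fun _ => r⁻¹)) {F : (Fin (p + 1) → Fin 4) → ℝ}
    (hF : IsAlternating F) :
    0 ≤ emt p 1 g F 0 0 ∧ (emt p 1 g F 0 0 = 0 → F = 0) := by
  have hd : ∀ μ : Fin 4, (Fin.cons (-1) fun _ : Fin 3 => r : Fin 4 → ℝ) μ ≠ 0 :=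
    Fin.cases (by simp) fun a => by simpa using hr.ne'
  have hg1 : g = Matrix.diagonal fun μ => ((Fin.cons (-1) fun _ : Fin 3 => r : Fin 4 → ℝ) μ)⁻¹ := by
    rw [hg]; congr 1; funext μ; refine Fin.cases ?_ (fun a => ?_) μ <;> simp
  have hg' : g⁻¹ = Matrix.diagonal (Fin.cons (-1) fun _ => r) := by
    refine Matrix.inv_eq_right_inv ?_
    rw [hg1, Matrix.diagonal_mul_diagonal, ← Matrix.diagonal_one]
    congr 1
    funext i
    exact inv_mul_cancel₀ (hd i)
  have hg0 : g 0 0 = -1 := by rw [hg]; simp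
  interval_cases p
  · rw [emt_zero_energy hg' hg0]
    refine ⟨by positivity, fun h => funext fun J => ?_⟩
    have h1 : 0 ≤ ∑ a : Fin 3, F ![a.succ] ^ 2 := by positivity
    have h2 : F ![0] ^ 2 = 0 := by nlinarith [sq_nonneg (F ![0]), mul_nonneg hr.le h1]
    have h3 : ∑ a : Fin 3, F ![a.succ] ^ 2 = 0 := by
      have : r * ∑ a : Fin 3, F ![a.succ] ^ 2 = 0 := by linarith
      exact (mul_eq_zero.1 this).resolve_left hr.ne'
    rw [Finset.sum_eq_zero_iff_of_nonneg fun _ _ => sq_nonneg _] at h3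
    have hJ : J = ![J 0] := by funext i; fin_cases i; rfl
    rw [hJ]
    refine Fin.cases ?_ (fun a => ?_) (J 0)
    · simpa using h2
    · simpa using h3 a
  · rw [emt_one_energy hg' hg0 hF]
    refine ⟨by positivity, fun h => funext fun J => ?_⟩
    have h1 : 0 ≤ ∑ a : Fin 3, F ![0, a.succ] ^ 2 := by positivity
    have hr2 := pow_pos hr 2
    have h0 := mul_nonneg hr.le h1
    have h2 : F ![1, 2] ^ 2 + F ![2, 3] ^ 2 + F ![1, 3] ^ 2 = 0 := by
      have := mul_nonneg hr2.le (by positivity : 0 ≤ F ![1, 2] ^ 2 + F ![2, 3] ^ 2 + F ![1, 3] ^ 2)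
      have : r ^ 2 * (F ![1, 2] ^ 2 + F ![2, 3] ^ 2 + F ![1, 3] ^ 2) = 0 := by linarith
      exact (mul_eq_zero.1 this).resolve_left hr2.ne'
    have h3 : ∑ a : Fin 3, F ![0, a.succ] ^ 2 = 0 := by
      rw [h2] at h
      have : r * ∑ a : Fin 3, F ![0, a.succ] ^ 2 = 0 := by linarith
      exact (mul_eq_zero.1 this).resolve_left hr.ne'
    rw [Finset.sum_eq_zero_iff_of_nonneg fun _ _ => sq_nonneg _] at h3
    have h4 : ∀ a : Fin 3, F ![0, a.succ] = 0 := fun a => by simpa using h3 a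
    have e1 : F ![1, 2] = 0 := by nlinarith [sq_nonneg (F ![1, 2]), sq_nonneg (F ![2, 3]), sq_nonneg (F ![1, 3])]
    have e2 : F ![2, 3] = 0 := by nlinarith [sq_nonneg (F ![1, 2]), sq_nonneg (F ![2, 3]), sq_nonneg (F ![1, 3])]
    have e3 : F ![1, 3] = 0 := by nlinarith [sq_nonneg (F ![1, 2]), sq_nonneg (F ![2, 3]), sq_nonneg (F ![1, 3])]
    have hJ : J = ![J 0, J 1] := by funext i; fin_cases i <;> rfl
    rw [hJ]
    generalize J 0 = a
    generalize J 1 = b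
    refine Fin.cases (Fin.cases ?_ (fun b => ?_) b) (fun a => Fin.cases ?_ (fun b => ?_) b) a
    · exact hF.self₂ _
    · exact h4 b
    · rw [hF.swap₂, h4]; simp
    · have e4 := hF.swap₂ 2 1
      have e5 := hF.swap₂ 3 1
      have e6 := hF.swap₂ 3 2
      fin_cases a <;> fin_cases b <;> simp [e1, e2, e3, e4, e5, e6, hF.self₂]
  · rw [emt_two_energy hg' hg0 hF]
    refine ⟨by positivity, fun h => funext fun J => ?_⟩
    have hr2 := pow_pos hr 2
    have hr3 := pow_pos hr 3
    have h1 := mul_nonneg hr2.le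
      (by positivity : 0 ≤ F ![0, 1, 2] ^ 2 + F ![0, 2, 3] ^ 2 + F ![0, 1, 3] ^ 2)
    have h2 := mul_nonneg hr3.le (sq_nonneg (F ![1, 2, 3]))
    have e0 : F ![1, 2, 3] = 0 := by
      have : r ^ 3 * F ![1, 2, 3] ^ 2 = 0 := by linarith
      simpa using (mul_eq_zero.1 this).resolve_left hr3.ne'
    have h3 : F ![0, 1, 2] ^ 2 + F ![0, 2, 3] ^ 2 + F ![0, 1, 3] ^ 2 = 0 := by
      have : r ^ 2 * (F ![0, 1, 2] ^ 2 + F ![0, 2, 3] ^ 2 + F ![0, 1, 3] ^ 2) = 0 := by linarith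
      exact (mul_eq_zero.1 this).resolve_left hr2.ne'
    have f1 : F ![0, 1, 2] = 0 := by
      nlinarith [sq_nonneg (F ![0, 1, 2]), sq_nonneg (F ![0, 2, 3]), sq_nonneg (F ![0, 1, 3])]
    have f2 : F ![0, 2, 3] = 0 := by
      nlinarith [sq_nonneg (F ![0, 1, 2]), sq_nonneg (F ![0, 2, 3]), sq_nonneg (F ![0, 1, 3])]
    have f3 : F ![0, 1, 3] = 0 := by
      nlinarith [sq_nonneg (F ![0, 1, 2]), sq_nonneg (F ![0, 2, 3]), sq_nonneg (F ![0, 1, 3])]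
    obtain ⟨h1, h2, e1, e2, e3, e4, e5, e6, e7, e8⟩ := hF.threeForm
    have h5 : ∀ a b : Fin 3, F ![0, a.succ, b.succ] = 0 := fun a b => by
      fin_cases a <;> fin_cases b <;> simp [f1, f2, f3, e1, e2, e3, hF.self₃']
    have hJ : J = ![J 0, J 1, J 2] := by funext i; fin_cases i <;> rfl
    rw [hJ]
    generalize J 0 = a
    generalize J 1 = b
    generalize J 2 = c
    simp only [Pi.zero_apply]
    refine Fin.cases (Fin.cases ?_ (fun b => Fin.cases ?_ (fun c => ?_) c) b) (fun a =>
      Fin.cases (Fin.cases ?_ (fun c => ?_) c) (fun b => Fin.cases ?_ (fun c => ?_) c) b) a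
    · exact hF.self₃ _ _
    · exact hF.self₃'' _ _
    · exact h5 _ _
    · exact hF.self₃' _ _
    · rw [h1, h5, neg_zero]
    · rw [h2, h5]
    · fin_cases a <;> fin_cases b <;> fin_cases c <;>
        simp [e0, e4, e5, e6, e7, e8, hF.self₃, hF.self₃', hF.self₃'']
  · rw [emt_three hd hg1 hF, hg0, Fin.prod_univ_succ]
    simp only [Fin.cons_zero, Fin.cons_succ, Finset.prod_const, Finset.card_univ, Fintype.card_fin]
    have hr3 := pow_pos hr 3
    refine ⟨by nlinarith [mul_nonneg hr3.le (sq_nonneg (F id))], fun h => funext fun J => ?_⟩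
    have h1 : F id ^ 2 = 0 := by
      have : r ^ 3 * F id ^ 2 = 0 := by linarith
      exact (mul_eq_zero.1 this).resolve_left hr3.ne'
    have h2 := hF.sq_topForm J
    rw [h1, ite_self] at h2
    simpa using h2

end Energy

end ShearFree

/-! ### Einstein's equations: the spatial Ricci tensor as a sum of squares of harmonic one-forms. -/

namespace ShearFree

namespace Cosmology

/-- Every gauge field has a positive prefactor, vanishes, or has spatially isotropic stress. -/
def HasPositiveEnergy {S : SpatialFrame} {n : ℕ} (M : Cosmology S n) : Prop :=
  ∀ i, 0 < (M.field i).α ∨ (∀ t ∈ M.I, (M.field i).F t = 0) ∨ (M.field i).p = 3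

namespace IsConformallyOrthonormal

variable {S : SpatialFrame} {n : ℕ} {M : Cosmology S n} {s : ℝ → ℝ} {x : Pt 4}

theorem g_diag (hM : M.IsConformallyOrthonormal s) (hx : x ∈ M.region) :
    M.g x = Matrix.diagonal (Fin.cons (-1) fun _ => s (x 0)) := by
  rw [hM.g_eq hx]
  ext μ ν
  refine Fin.cases ?_ (fun a => ?_) μ <;> refine Fin.cases ?_ (fun b => ?_) ν <;>
    simp [Matrix.diagonal_apply, Matrix.one_apply, (Fin.succ_ne_zero _).symm]

/-- The energy-momentum tensor of a top form is a multiple of the metric, so it has no anisotropic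
part for either sign of `α`. -/
theorem stressForm_three (hM : M.IsConformallyOrthonormal s) {α : ℝ}
    {F : ℝ → (Fin 4 → Fin 4) → ℝ} (hA : ∀ t ∈ M.I, IsAlternating (F t)) :
    StressForm M s 3 α F 0 0 := by
  refine ⟨S.isHarmonic_zero, fun t => α / 2 * (∏ i, (Fin.cons (-1) fun _ : Fin 3 => (s t)⁻¹ :
    Fin 4 → ℝ) i) * F t id ^ 2 * s t, fun x hx a b => ?_⟩
  have hs := (hM.pos _ hx.1).ne'
  rw [emt_three (d := Fin.cons (-1) fun _ => (s (x 0))⁻¹) (Fin.cases (by simp) fun a => by simpa)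
    ?_ (hA _ hx.1), hM.g_eq hx, timeBlock_succ_succ, SpatialFrame.smul_one_apply]
  · simp
  · rw [hM.g_diag hx]
    congr 1
    funext μ
    refine Fin.cases ?_ (fun a => ?_) μ <;> simp

theorem exists_stressForm_of_field (hM : M.IsConformallyOrthonormal s) {p : ℕ} (hp : p ≤ 3) {α : ℝ}
    {F : ℝ → (Fin (p + 1) → Fin 4) → ℝ}
    (hF : ∀ J, ContDiffOn ℝ ∞ (fun t => F t J) M.I) (hA : ∀ t ∈ M.I, IsAlternating (F t))
    (hc : ∀ x ∈ M.region, ∀ J, extD S.e M.g (fun J x => F (x 0) J) J x = 0)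
    (hd : ∀ x ∈ M.region, ∀ J, diverg S.e M.g (fun J x => F (x 0) J) J x = 0)
    (hf : ∀ x ∈ M.region, ∀ a : Fin 3, emt p α (M.g x) (F (x 0)) 0 a.succ = 0)
    (hpos : 0 < α ∨ (∀ t ∈ M.I, F t = 0) ∨ p = 3) :
    ∃ v W, StressForm M s p α F v W := by
  rcases hpos with hα | hF0 | hp3
  -- Positivity matters only for `p = 0` and `p = 2`, where a square root of `α` is taken.
  · interval_cases p
    · exact hM.stressForm_zero hα hF hc hd hf
    · exact hM.stressForm_one hα.ne' hF hA hc hd hf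
    · exact hM.stressForm_two hα hF hA hc hd hf
    · exact ⟨0, 0, hM.stressForm_three hA⟩
  · exact ⟨0, 0, stressForm_of_eq_zero hF0⟩
  · subst hp3
    exact ⟨0, 0, hM.stressForm_three hA⟩

theorem exists_stressForm (hM : M.IsConformallyOrthonormal s) (hS : M.IsShearFreeModel)
    (hpos : M.HasPositiveEnergy) (i : Fin n) :
    ∃ v W, StressForm M s (M.field i).p (M.field i).α (M.field i).F v W :=
  hM.exists_stressForm_of_field (M.field i).p_le (M.F_smooth i) (M.F_alternating i) (hS.closed i)
    (hS.coclosed i) (hS.no_flux i) (hpos i)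

/-- Were `s` constant, its derivative and therefore the Hubble scalar would vanish. -/
theorem exists_scale_ne (hM : M.IsConformallyOrthonormal s) (hS : M.IsShearFreeModel) :
    ∃ t ∈ M.I, ∃ u ∈ M.I, s t ≠ s u := by
  obtain ⟨x, hx, h⟩ := hS.not_static
  by_contra! hcon
  rw [hM.hubble_eq hx] at h
  have h1 : s =ᶠ[nhds (x 0)] fun _ => s (x 0) := by
    filter_upwards [M.isOpen.mem_nhds hx.1] with t ht using hcon t ht _ hx.1
  rw [h1.deriv_eq] at h
  simp at h

/-- The spatial Ricci tensor of a shear-free solution without fields of negative energy, in an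
orthonormal frame. -/
theorem exists_ricci_eq (hM : M.IsConformallyOrthonormal s) (hS : M.IsShearFreeModel)
    (hpos : M.HasPositiveEnergy) :
    ∃ v : Fin n → Fin 3 → ℝ, (∀ i, S.IsHarmonic (v i)) ∧ ∃ c : Pt 3 → ℝ, ∀ y ∈ S.U, ∀ a b,
      ricci S.E (fun _ => 1) a b y = ∑ i, v i a * v i b + if a = b then c y else 0 := by
  choose v W hv l hl using hM.exists_stressForm hS hpos
  refine ⟨v, hv, ?_⟩
  obtain ⟨t, ht, u, hu, hne⟩ := hM.exists_scale_ne hS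
  have key : ∀ y ∈ S.U, ∃ K : ℝ → ℝ, ∀ τ ∈ M.I, ∀ a b,
      ricci S.E (fun _ => 1) a b y
        = ∑ i, v i a * v i b + (∑ i, W i a b) / s τ + if a = b then K τ else 0 := by
    intro y hy
    -- All multiples of the unit matrix in the spatial equation are collected here; their value
    -- plays no role.
    refine ⟨fun τ => (1 / 2) * scalarCurv S.e M.g (Fin.cons τ y) * s τ + M.totalP τ * s τ
      + ∑ i, l i τ - (deriv (deriv s) τ / 2 + deriv s τ ^ 2 / (4 * s τ)), fun τ hτ a b => ?_⟩
    have hx := mem_region hτ hy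
    have h1 := hS.einstein_eq _ hx a.succ b.succ
    have h2 := hM.ricci_succ_succ hx a b
    have h3 : ∑ i, M.fieldEMT i a.succ b.succ (Fin.cons τ y)
        = (if a = b then ∑ i, l i τ else 0) + ∑ i, v i a * v i b + (∑ i, W i a b) / s τ := by
      have h4 : ∀ i, M.fieldEMT i a.succ b.succ (Fin.cons τ y)
          = (if a = b then l i τ else 0) + v i a * v i b + W i a b / s τ := fun i => hl i _ hx a b
      simp only [h4, Finset.sum_add_distrib, Finset.sum_div]
      split_ifs <;> simp
    rw [einstein, h2, h3, proj, hM.g_eq hx, timeBlock_succ_succ, SpatialFrame.smul_one_apply] at h1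
    have e1 : (Fin.cons τ y : Pt 4) 0 = τ := rfl
    have e2 : Fin.tail (Fin.cons τ y : Pt 4) = y := rfl
    simp only [uLower, Fin.succ_ne_zero, if_false, mul_zero, add_zero, zero_add, e1, e2] at h1
    split_ifs at h1 ⊢ <;> linarith
  have hst := (hM.pos t ht).ne'
  have hsu := (hM.pos u hu).ne'
  -- A quantity `w / s` with the same value at two times where `s` differs must have `w = 0`.
  have hinv : ∀ w d : ℝ, w / s t = d → w / s u = d → w = 0 := fun w d h1 h2 => by
    rw [div_eq_iff hst] at h1
    rw [div_eq_iff hsu] at h2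
    have h3 : d * (s t - s u) = 0 := by linarith
    rw [h1, (mul_eq_zero.1 h3).resolve_right (sub_ne_zero.2 hne), zero_mul]
  refine ⟨fun y => ricci S.E (fun _ => 1) 0 0 y - ∑ i, v i 0 * v i 0, fun y hy a b => ?_⟩
  obtain ⟨K, hK⟩ := key y hy
  split_ifs with hab
  · subst hab
    -- On the diagonal the unknown function `K` is eliminated by subtracting the `0 0` component, so
    -- only the trace-free part of `W` is shown to vanish.
    have h := hinv (∑ i, W i a a - ∑ i, W i 0 0) (ricci S.E (fun _ => 1) a a y
      - ricci S.E (fun _ => 1) 0 0 y - (∑ i, v i a * v i a - ∑ i, v i 0 * v i 0))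
      (by have h1 := hK t ht a a; have h2 := hK t ht 0 0; simp only [if_true] at h1 h2
          rw [sub_div]; linarith)
      (by have h1 := hK u hu a a; have h2 := hK u hu 0 0; simp only [if_true] at h1 h2
          rw [sub_div]; linarith)
    have h1 := hK t ht a a
    have h2 := hK t ht 0 0
    simp only [if_true] at h1 h2
    rw [sub_eq_zero.1 h] at h1
    linarith
  · have h := hinv (∑ i, W i a b) (ricci S.E (fun _ => 1) a b y - ∑ i, v i a * v i b)
      (by have h1 := hK t ht a b; rw [if_neg hab] at h1; linarith)
      (by have h1 := hK u hu a b; rw [if_neg hab] at h1; linarith)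
    have h1 := hK t ht a b
    rw [if_neg hab, h, zero_div] at h1
    linarith

/-- A model all of whose gauge fields have non-negative energy density. -/
theorem hasPositiveEnergy (hM : M.IsConformallyOrthonormal s)
    (h : ∀ i, ∀ x ∈ M.region, 0 ≤ M.fieldEMT i 0 0 x) : M.HasPositiveEnergy := by
  intro i
  rcases lt_or_gt_of_ne (M.field i).α_ne_zero with hα | hα
  -- With `α < 0`, a nonnegative energy density forces the positive definite form to vanish, and
  -- hence the field.
  · right; left
    intro t ht
    obtain ⟨y₀, hy₀⟩ := S.isConnected.nonempty
    have hx := mem_region ht hy₀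
    have hs := hM.pos t ht
    have h1 : 0 ≤ emt (M.field i).p (M.field i).α (M.g (Fin.cons t y₀)) ((M.field i).F t) 0 0 :=
      h i _ hx
    obtain ⟨h2, h3⟩ := emt_one_pos (M.field i).p_le (inv_pos.2 hs)
      (g := M.g (Fin.cons t y₀)) (by rw [hM.g_diag hx, inv_inv]; rfl) (M.F_alternating i t ht)
    refine h3 ?_
    rw [emt_eq_mul] at h1
    nlinarith
  · exact Or.inl hα

end IsConformallyOrthonormal

end Cosmology

end ShearFree

/-! ### Bounded Hamiltonians and the weak energy condition. -/

namespace ShearFree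

theorem minkowski_eq : minkowski = Matrix.diagonal (Fin.cons (-1) fun _ => (1 : ℝ)⁻¹) := by
  rw [minkowski]
  congr 1
  funext μ
  rw [inv_one]
  fin_cases μ <;> rfl

theorem minkowski_inv : minkowski⁻¹ = Matrix.diagonal (Fin.cons (-1) fun _ => 1) := by
  refine Matrix.inv_eq_right_inv ?_
  rw [minkowski_eq, Matrix.diagonal_mul_diagonal, ← Matrix.diagonal_one]
  congr 1
  funext i
  refine Fin.cases ?_ (fun a => ?_) i <;> simp

/-- The Hamiltonian density is the energy density. -/
theorem hamiltonianDensity_eq (p : ℕ) (α : ℝ) {F : (Fin (p + 1) → Fin 4) → ℝ}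
    (hF : IsAlternating F) : hamiltonianDensity p α F = emt p α minkowski F 0 0 := by
  have h : contract minkowski (fun I : Fin p → Fin 4 => F (Fin.cons 0 I))
      (fun I => F (Fin.cons 0 I)) = ∑ J : Fin p → Fin 3, F (Fin.cons 0 fun i => (J i).succ) ^ 2 := by
    rw [contract_of_inv_diagonal minkowski_inv]
    symm
    refine Fintype.sum_of_injective (fun (J : Fin p → Fin 3) i => (J i).succ) (fun J K h => ?_) _ _
      (fun I hI => ?_) fun J => ?_
    · funext i
      exact Fin.succ_injective _ (congrFun h i)
    -- A tuple that is not purely spatial repeats the time index already present, and contributes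
    -- nothing.
    · have h0 : ∃ i, I i = 0 := by
        by_contra! hcon
        exact hI ⟨fun i => (I i).pred (hcon i), funext fun i => Fin.succ_pred _ _⟩
      obtain ⟨i, hi⟩ := h0
      rw [hF.eq_zero_of_not_injective fun hinj => ?_, mul_zero]
      have h1 : (Fin.cons 0 I : Fin (p + 1) → Fin 4) i.succ = (Fin.cons 0 I : Fin (p + 1) → Fin 4) 0 := hi
      exact Fin.succ_ne_zero i (hinj h1)
    · simp [sq]
  rw [hamiltonianDensity, emt, h, minkowski_eq]
  simp

/-- A nonzero form of each degree. -/
theorem exists_isAlternating_ne_zero {p : ℕ} (hp : p ≤ 3) :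
    ∃ F : (Fin (p + 1) → Fin 4) → ℝ, IsAlternating F ∧ F ≠ 0 := by
  have hp' : p + 1 ≤ 4 := by omega
  -- The witness is the exterior product of the first `p + 1` dual basis vectors, written as a
  -- minor.
  refine ⟨fun J => Matrix.det (Matrix.of fun i k : Fin (p + 1) =>
    if J i = Fin.castLE hp' k then (1 : ℝ) else 0), fun J σ => ?_, fun h => ?_⟩
  · have := Matrix.det_permute σ (Matrix.of fun i k : Fin (p + 1) =>
      if J i = Fin.castLE hp' k then (1 : ℝ) else 0)
    exact this
  · have h1 := congrFun h (Fin.castLE hp')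
    have h2 : (Matrix.of fun i k : Fin (p + 1) =>
        if Fin.castLE hp' i = Fin.castLE hp' k then (1 : ℝ) else 0) = 1 := by
      ext i k
      simp [Matrix.one_apply]
    rw [h2] at h1
    simp at h1

theorem IsAlternating.smul {k n : ℕ} {F : (Fin k → Fin n) → ℝ} (hF : IsAlternating F) (c : ℝ) :
    IsAlternating (c • F) := fun I σ => by
  simp only [Pi.smul_apply, smul_eq_mul, hF I σ]
  ring

theorem emt_smul (p : ℕ) (α c : ℝ) (g : Matrix (Fin 4) (Fin 4) ℝ) (F : (Fin (p + 1) → Fin 4) → ℝ)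
    (μ ν : Fin 4) : emt p α g (c • F) μ ν = c ^ 2 * emt p α g F μ ν := by
  have h : ∀ {k : ℕ} (G K : (Fin k → Fin 4) → ℝ),
      contract g (fun I => c * G I) (fun I => c * K I) = c ^ 2 * contract g G K := fun G K => by
    simp only [contract, Finset.mul_sum]
    exact Finset.sum_congr rfl fun _ _ => Finset.sum_congr rfl fun _ _ => by ring
  have h1 : contract g (c • F) (c • F) = c ^ 2 * contract g F F := h F F
  rw [emt, emt, h1]
  simp only [Pi.smul_apply, smul_eq_mul, h]
  ring

theorem exists_energy_pos {p : ℕ} (hp : p ≤ 3) :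
    ∃ F : (Fin (p + 1) → Fin 4) → ℝ, IsAlternating F ∧ 0 < emt p 1 minkowski F 0 0 := by
  obtain ⟨F, hF, hne⟩ := exists_isAlternating_ne_zero hp
  obtain ⟨h1, h2⟩ := emt_one_pos hp one_pos minkowski_eq hF
  exact ⟨F, hF, lt_of_le_of_ne h1 fun h => hne (h2 h.symm)⟩

/-- The density is `α` times a positive definite quadratic form: nonnegative for `0 ≤ α`, and
unbounded below along a ray of field strengths otherwise. -/
theorem hamiltonianBoundedBelow_iff {p : ℕ} (hp : p ≤ 3) (α : ℝ) :
    HamiltonianBoundedBelow p α ↔ 0 ≤ α := by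
  constructor
  · rintro ⟨c, hc⟩
    by_contra! hα
    obtain ⟨F, hF, hpos⟩ := exists_energy_pos hp
    set q := emt p 1 minkowski F 0 0
    have hq : 0 < -α * q := mul_pos (neg_pos.2 hα) hpos
    have hr : 0 ≤ (|c| + 1) / (-α * q) := by positivity
    -- The field is rescaled so that its density is exactly `-(|c| + 1)`, which is below `c`.
    have h := hc _ (hF.smul (Real.sqrt ((|c| + 1) / (-α * q))))
    rw [hamiltonianDensity_eq p α (hF.smul _), emt_smul, emt_eq_mul, Real.sq_sqrt hr] at h
    have h1 : (|c| + 1) / (-α * q) * (α * q) = -(|c| + 1) := by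
      have := hpos.ne'
      have := hα.ne
      field_simp
    have h2 : c ≤ (|c| + 1) / (-α * q) * (α * q) := h
    rw [h1] at h2
    linarith [neg_abs_le c]
  · refine fun hα => ⟨0, fun F hF => ?_⟩
    rw [hamiltonianDensity_eq p α hF, emt_eq_mul]
    exact mul_nonneg hα (emt_one_pos hp one_pos minkowski_eq hF).1

/-- A Lorentz transformation to the rest frame of a unit timelike vector. -/
theorem exists_boost {u : Fin 4 → ℝ} (h0 : 0 < u 0)
    (hu : u 0 ^ 2 = 1 + u 1 ^ 2 + u 2 ^ 2 + u 3 ^ 2) :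
    ∃ Λ : Matrix (Fin 4) (Fin 4) ℝ, IsUnit Λ.det ∧ Λ * minkowski * Λᵀ = minkowski ∧ Λ 0 = u := by
  have h1 : 1 + u 0 ≠ 0 := by positivity
  set w := (1 + u 0)⁻¹
  have hw : w * (1 + u 0) = 1 := inv_mul_cancel₀ h1
  -- The pure boost with first row `u`; its spatial block is the identity plus the dyad of the
  -- spatial part of `u` divided by `1 + u 0`.
  let Λ : Matrix (Fin 4) (Fin 4) ℝ := !![u 0, u 1, u 2, u 3;
    u 1, 1 + u 1 * u 1 * w, u 1 * u 2 * w, u 1 * u 3 * w;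
    u 2, u 2 * u 1 * w, 1 + u 2 * u 2 * w, u 2 * u 3 * w;
    u 3, u 3 * u 1 * w, u 3 * u 2 * w, 1 + u 3 * u 3 * w]
  have key : Λ * minkowski * Λᵀ = minkowski := by
    have hr : u 1 ^ 2 + u 2 ^ 2 + u 3 ^ 2 = u 0 ^ 2 - 1 := by linarith
    have e1 : w * (u 1 ^ 2 + u 2 ^ 2 + u 3 ^ 2) = u 0 - 1 := by
      rw [hr]; linear_combination (u 0 - 1) * hw
    ext i j
    fin_cases i <;> fin_cases j <;>
      simp [Λ, minkowski, Matrix.mul_apply, Fin.sum_univ_four, Matrix.vecMul_diagonal]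
    · linear_combination -hu
    · linear_combination u 1 * e1
    · linear_combination u 2 * e1
    · linear_combination u 3 * e1
    · linear_combination u 1 * e1
    · linear_combination u 1 * u 1 * (w * e1 + hw)
    · linear_combination u 1 * u 2 * (w * e1 + hw)
    · linear_combination u 1 * u 3 * (w * e1 + hw)
    · linear_combination u 2 * e1
    · linear_combination u 2 * u 1 * (w * e1 + hw)
    · linear_combination u 2 * u 2 * (w * e1 + hw)
    · linear_combination u 2 * u 3 * (w * e1 + hw)
    · linear_combination u 3 * e1
    · linear_combination u 3 * u 1 * (w * e1 + hw)
    · linear_combination u 3 * u 2 * (w * e1 + hw)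
    · linear_combination u 3 * u 3 * (w * e1 + hw)
  refine ⟨Λ, ?_, key, ?_⟩
  · have h2 : minkowski * minkowski = 1 := by
      rw [minkowski, Matrix.diagonal_mul_diagonal, ← Matrix.diagonal_one]
      congr 1; funext i; fin_cases i <;> simp
    -- A Lorentz matrix has the inverse `η Λᵀ η`.
    refine Matrix.isUnit_det_of_right_inverse (B := minkowski * Λᵀ * minkowski) ?_
    rw [← Matrix.mul_assoc, ← Matrix.mul_assoc, key, h2]
  · funext i; fin_cases i <;> rfl

/-- A boost takes the normalised observer to the rest frame, where the contraction becomes the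
energy density of the transformed form; conversely the rest observer alone detects the sign of `α`.
-/
theorem weakEnergyCondition_iff {p : ℕ} (hp : p ≤ 3) (α : ℝ) :
    WeakEnergyCondition p α ↔ 0 ≤ α := by
  constructor
  · intro h
    obtain ⟨F, hF, hpos⟩ := exists_energy_pos hp
    have h1 := h F hF (Pi.single 0 1) (by simp [Fin.sum_univ_four, minkowski])
    have h2 : 0 ≤ emt p α minkowski F 0 0 := by simpa [Fin.sum_univ_four] using h1
    rw [emt_eq_mul] at h2
    exact nonneg_of_mul_nonneg_left h2 hpos
  · intro hα F hF V hV
    have hV' : V 1 ^ 2 + V 2 ^ 2 + V 3 ^ 2 < V 0 ^ 2 := by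
      simp [Fin.sum_univ_four, minkowski, Matrix.diagonal_apply] at hV
      linarith
    have hV0 : V 0 ≠ 0 := fun h => by
      rw [h] at hV'
      nlinarith [sq_nonneg (V 1), sq_nonneg (V 2), sq_nonneg (V 3)]
    -- The normalisation carries the sign of `V 0`, making the unit vector future-directed; the
    -- contraction is quadratic in `V`, so the sign is harmless.
    obtain ⟨N, hN0, hN⟩ : ∃ N : ℝ, 0 < V 0 * N ∧
        N ^ 2 * (V 0 ^ 2 - (V 1 ^ 2 + V 2 ^ 2 + V 3 ^ 2)) = 1 := by
      have h1 := sub_pos.2 hV'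
      set d := V 0 ^ 2 - (V 1 ^ 2 + V 2 ^ 2 + V 3 ^ 2)
      have hd := Real.sqrt_pos.2 h1
      have h2 : (Real.sqrt d)⁻¹ ^ 2 * d = 1 := by
        rw [inv_pow, Real.sq_sqrt h1.le, inv_mul_cancel₀ h1.ne']
      rcases lt_or_gt_of_ne hV0 with h | h
      · exact ⟨-(Real.sqrt d)⁻¹, by
          have := mul_pos (neg_pos.2 h) (inv_pos.2 hd); linarith, by rw [neg_sq, h2]⟩
      · exact ⟨(Real.sqrt d)⁻¹, mul_pos h (inv_pos.2 hd), h2⟩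
    obtain ⟨Λ, hΛ, hΛη, hΛ0⟩ := exists_boost (u := fun μ => V μ * N) hN0 (by linear_combination hN)
    have h1 := emt_mulForm (g := minkowski) hΛ p α F 0 0
    rw [hΛη] at h1
    have h2 : 0 ≤ emt p α minkowski (mulForm Λ F) 0 0 := by
      rw [emt_eq_mul]
      exact mul_nonneg hα (emt_one_pos hp one_pos minkowski_eq (hF.mulForm Λ)).1
    have h3 : ∑ a, ∑ b, Λ 0 a * Λ 0 b * emt p α minkowski F a b
        = N ^ 2 * ∑ μ, ∑ ν, emt p α minkowski F μ ν * V μ * V ν := by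
      rw [hΛ0]
      simp only [Finset.mul_sum]
      exact Finset.sum_congr rfl fun _ _ => Finset.sum_congr rfl fun _ _ => by ring
    rw [h1, h3] at h2
    have hN2 : 0 < N ^ 2 := by
      have : N ≠ 0 := fun h => by rw [h] at hN0; simp at hN0
      positivity
    exact nonneg_of_mul_nonneg_right h2 hN2

end ShearFree

/-! ### Rotations of frames, and Ricci tensors built from harmonic one-forms. -/

namespace ShearFree

namespace SpatialFrame

variable {S : SpatialFrame} {C : Fin 3 → Fin 3 → Fin 3 → ℝ} {y : Pt 3}

theorem isUnit_det_of_mul_transpose {R : Matrix (Fin 3) (Fin 3) ℝ} (hR : R * Rᵀ = 1) :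
    IsUnit R.det :=
  Matrix.isUnit_det_of_right_inverse hR

/-- The connection coefficients of an orthonormal frame with structure constants `C`. -/
def structConn (C : Fin 3 → Fin 3 → Fin 3 → ℝ) (c a b : Fin 3) : ℝ :=
  (1 / 2) * (C a c b + C b c a - C a b c)

/-- The connection coefficients are constant, so the derivative terms of the curvature drop out and
an algebraic expression in the structure constants remains. -/
theorem IsBianchi.ricci_eq (hS : S.IsBianchi C) (hy : y ∈ S.U) (σ ν : Fin 3) :
    ricci S.E (fun _ => 1) σ ν y = ∑ μ, ∑ l, (structConn C l ν σ * structConn C μ μ l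
      - structConn C l μ σ * structConn C μ ν l + C μ ν l * structConn C μ l σ) := by
  have h1 := S.conn_smul_one (one_ne_zero)
  simp only [one_smul] at h1
  have h2 : ∀ c a b, ∀ z ∈ S.U, S.orthoConn c a b z = structConn C c a b := fun c a b z hz => by
    rw [orthoConn, hS z hz, hS z hz, hS z hz, structConn]; ring
  have h3 : ∀ c a b d, frameDeriv S.E (S.orthoConn c a b) d y = 0 := fun c a b d => by
    rw [frameDeriv_congr (f' := fun _ => structConn C c a b), frameDeriv_const]
    filter_upwards [S.isOpen.mem_nhds hy] with z hz using h2 c a b z hz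
  simp only [ricci, riemann, h1, h3, h2 _ _ _ y hy, hS y hy]
  refine Finset.sum_congr rfl fun μ _ => ?_
  rw [sub_zero, zero_add]
  exact Finset.sum_congr rfl fun l _ => by ring

theorem IsBianchi.antisymm (hS : S.IsBianchi C) (a b c : Fin 3) : C a b c = - C b a c := by
  obtain ⟨y, hy⟩ := S.isConnected.nonempty
  have h := S.commCoeff_antisymm a b c y
  rw [hS y hy, hS y hy] at h
  linarith

/-- Closedness would survive any constant change of frame; orthogonality is needed for coclosedness,
whose contraction uses the unit matrix as metric. -/
theorem IsHarmonic.changeFrame {v : Fin 3 → ℝ} (hv : S.IsHarmonic v)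
    {L : Matrix (Fin 3) (Fin 3) ℝ} (hL : IsUnit L.det) (hLL : L * Lᵀ = 1) :
    (S.changeFrame L hL).IsHarmonic (L *ᵥ v) := by
  intro y hy
  have hD := fun a b γ => commCoeff_mulFrame hL (S.indep y hy)
    (fun a => S.differentiableAt_E a hy) a b γ
  obtain ⟨h1, h2⟩ := hv y hy
  have h0 : (S.changeFrame L hL).E = mulFrame L S.E := rfl
  constructor
  · intro a b
    calc ∑ c, commCoeff (mulFrame L S.E) a b c y * (L *ᵥ v) c
        = ∑ γ, (∑ c, commCoeff (mulFrame L S.E) a b c y * L c γ) * v γ := by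
          simp only [Matrix.mulVec, dotProduct, Finset.mul_sum, Finset.sum_mul]
          rw [Finset.sum_comm]
          exact Finset.sum_congr rfl fun _ _ => Finset.sum_congr rfl fun _ _ => by ring
      _ = ∑ α, ∑ β, L a α * L b β * ∑ γ, commCoeff S.E α β γ y * v γ := by
          simp only [hD, Finset.mul_sum, Finset.sum_mul]
          rw [sum_comm₃]
          exact Finset.sum_congr rfl fun _ _ => Finset.sum_congr rfl fun _ _ =>
            Finset.sum_congr rfl fun _ _ => by ring
      _ = 0 := by simp [h1]
  · have h3 : ∀ a, (S.changeFrame L hL).commTrace a y = ∑ α, L a α * S.commTrace α y := fun a => by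
      calc ∑ b, commCoeff (mulFrame L S.E) a b b y
          = ∑ b, ∑ γ, (∑ c, commCoeff (mulFrame L S.E) a b c y * L c γ) * L⁻¹ γ b := by
            refine Finset.sum_congr rfl fun b _ => ?_
            have h4 : ∀ c, ∑ γ, commCoeff (mulFrame L S.E) a b c y * L c γ * L⁻¹ γ b
                = commCoeff (mulFrame L S.E) a b c y * if c = b then 1 else 0 := fun c => by
              rw [← sum_mul_inv_apply hL, Finset.mul_sum]
              exact Finset.sum_congr rfl fun _ _ => by ring
            simp only [Finset.sum_mul]
            rw [Finset.sum_comm]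
            simp [h4]
        _ = ∑ α, ∑ β, ∑ γ, L a α * commCoeff S.E α β γ y * ∑ b, L⁻¹ γ b * L b β := by
            simp only [hD, Finset.mul_sum, Finset.sum_mul]
            rw [sum_comm₄]
            refine Finset.sum_congr rfl fun _ _ => Finset.sum_congr rfl fun _ _ => ?_
            rw [Finset.sum_comm]
            exact Finset.sum_congr rfl fun _ _ => Finset.sum_congr rfl fun _ _ => by ring
        _ = ∑ α, L a α * S.commTrace α y := by
            simp [sum_inv_mul_apply hL, commTrace, Finset.mul_sum]
    have h4 : ∀ α β, ∑ a, L a α * L a β = if α = β then 1 else 0 := fun α β => by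
      have e : Lᵀ * L = 1 := mul_eq_one_comm.1 hLL
      have := congrFun (congrFun e α) β
      simpa [Matrix.mul_apply, Matrix.one_apply] using this
    calc ∑ c, (S.changeFrame L hL).commTrace c y * (L *ᵥ v) c
        = ∑ α, ∑ β, S.commTrace α y * v β * ∑ a, L a α * L a β := by
          simp only [h3, Matrix.mulVec, dotProduct, Finset.mul_sum, Finset.sum_mul]
          rw [sum_comm₃, Finset.sum_comm]
          exact Finset.sum_congr rfl fun _ _ => Finset.sum_congr rfl fun _ _ =>
            Finset.sum_congr rfl fun _ _ => by ring
      _ = 0 := by simpa [h4] using h2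

/-- The Ricci tensor of the orthonormal frame is, up to a multiple of the metric, a sum of squares of
harmonic one-forms. -/
def IsHarmonicRicci {n : ℕ} (S : SpatialFrame) (v : Fin n → Fin 3 → ℝ) : Prop :=
  (∀ i, S.IsHarmonic (v i)) ∧ ∃ c : Pt 3 → ℝ, ∀ y ∈ S.U, ∀ a b,
    ricci S.E (fun _ => 1) a b y = ∑ i, v i a * v i b + if a = b then c y else 0

/-- The sum of the squares of the one-forms is not a multiple of the metric. -/
def IsAnisotropic {n : ℕ} (v : Fin n → Fin 3 → ℝ) : Prop :=
  ∀ r : ℝ, ∃ a b, ∑ i, v i a * v i b ≠ if a = b then r else 0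

theorem sum_mulVec_mul {n : ℕ} (v : Fin n → Fin 3 → ℝ) (L : Matrix (Fin 3) (Fin 3) ℝ)
    (a b : Fin 3) : ∑ i, (L *ᵥ v i) a * (L *ᵥ v i) b
      = ∑ α, ∑ β, L a α * L b β * ∑ i, v i α * v i β := by
  simp only [Matrix.mulVec, dotProduct, Finset.mul_sum, Finset.sum_mul]
  rw [sum_comm₃, Finset.sum_comm]
  exact Finset.sum_congr rfl fun _ _ => Finset.sum_congr rfl fun _ _ =>
    Finset.sum_congr rfl fun _ _ => by ring

theorem sum_mul_ite {L : Matrix (Fin 3) (Fin 3) ℝ} (hLL : L * Lᵀ = 1) (r : ℝ) (a b : Fin 3) :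
    ∑ α, ∑ β, L a α * L b β * (if α = β then r else 0) = if a = b then r else 0 := by
  have h := congrFun (congrFun hLL a) b
  simp only [Matrix.mul_apply, Matrix.transpose_apply, Matrix.one_apply] at h
  simp only [mul_ite, mul_zero, Finset.sum_ite_eq, Finset.mem_univ, if_true]
  rw [← Finset.sum_mul, h]
  split_ifs <;> simp

theorem IsHarmonicRicci.changeFrame {n : ℕ} {v : Fin n → Fin 3 → ℝ} (hv : S.IsHarmonicRicci v)
    {L : Matrix (Fin 3) (Fin 3) ℝ} (hL : IsUnit L.det) (hLL : L * Lᵀ = 1) :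
    (S.changeFrame L hL).IsHarmonicRicci fun i => L *ᵥ v i := by
  obtain ⟨h1, c, h2⟩ := hv
  refine ⟨fun i => (h1 i).changeFrame hL hLL, c, fun y hy a b => ?_⟩
  have h := (S.isRegularOn (h := 1) (by simp)).ricci_mul hL hy a b
  have h3 : mulMetric L (fun _ : Pt 3 => (1 : Matrix (Fin 3) (Fin 3) ℝ)) = fun _ => 1 := by
    funext y; rw [mulMetric, Matrix.mul_one, hLL]
  rw [h3] at h
  have h4 : ricci (mulFrame L S.E) (fun _ => 1) a b y
    = ∑ i, (L *ᵥ v i) a * (L *ᵥ v i) b + if a = b then c y else 0 := by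
    rw [h, sum_mulVec_mul, ← sum_mul_ite hLL]
    simp only [h2 y hy, mul_add, Finset.sum_add_distrib]
  exact h4

theorem IsAnisotropic.mulVec {n : ℕ} {v : Fin n → Fin 3 → ℝ} (hv : IsAnisotropic v)
    {L : Matrix (Fin 3) (Fin 3) ℝ} (hL : IsUnit L.det) (hLL : L * Lᵀ = 1) :
    IsAnisotropic fun i => L *ᵥ v i := by
  intro r
  by_contra! hcon
  obtain ⟨a, b, hab⟩ := hv r
  refine hab (sub_eq_zero.1 (eq_zero_of_sum_mul_mul
    (T := fun a b => ∑ i, v i a * v i b - if a = b then r else 0) hL (fun c d => ?_) a b))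
  simp only [mul_sub, Finset.sum_sub_distrib]
  rw [← sum_mulVec_mul, sum_mul_ite hLL, hcon, sub_self]

/-- An orthogonal matrix that maps a given vector to the first axis. -/
theorem exists_rotation (v : Fin 3 → ℝ) :
    ∃ R : Matrix (Fin 3) (Fin 3) ℝ, R * Rᵀ = 1 ∧ (R *ᵥ v) 1 = 0 ∧ (R *ᵥ v) 2 = 0 := by
  by_cases h12 : v 1 = 0 ∧ v 2 = 0
  · exact ⟨1, by simp, by simpa using h12.1, by simpa using h12.2⟩
  set ρ := Real.sqrt (v 1 ^ 2 + v 2 ^ 2)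
  have hpos : 0 < v 1 ^ 2 + v 2 ^ 2 := by
    rcases not_and_or.1 h12 with h | h <;> positivity
  have hρ : 0 < ρ := Real.sqrt_pos.2 hpos
  have hρ2 : ρ ^ 2 = v 1 ^ 2 + v 2 ^ 2 := Real.sq_sqrt hpos.le
  set d := Real.sqrt (v 0 ^ 2 + ρ ^ 2)
  have hd : 0 < d := Real.sqrt_pos.2 (by positivity)
  have hd2 : d ^ 2 = v 0 ^ 2 + ρ ^ 2 := Real.sq_sqrt (by positivity)
  -- The rows are the direction of `v`, a unit vector orthogonal to `v` and to the first axis, and a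
  -- unit vector orthogonal to both.
  refine ⟨!![v 0 / d, v 1 / d, v 2 / d; 0, v 2 / ρ, - v 1 / ρ;
    ρ / d, - v 0 * v 1 / (ρ * d), - v 0 * v 2 / (ρ * d)], ?_, ?_, ?_⟩
  · ext i j
    fin_cases i <;> fin_cases j <;> simp [Matrix.mul_apply, Fin.sum_univ_three, Matrix.vecHead,
      Matrix.vecTail] <;> field_simp
    · linear_combination -hd2 - hρ2
    · ring
    · linear_combination v 0 * hρ2
    · ring
    · linear_combination -hρ2
    · ring
    · linear_combination v 0 * hρ2
    · ring
    · linear_combination (-ρ ^ 2) * hd2 - v 0 ^ 2 * hρ2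
  · simp [Matrix.mulVec, dotProduct, Fin.sum_univ_three]
    ring
  · simp [Matrix.mulVec, dotProduct, Fin.sum_univ_three]
    field_simp
    linear_combination v 0 * hρ2

end SpatialFrame

end ShearFree

/-! ### Algebraic classification of the admissible Bianchi algebras. -/

namespace ShearFree

/-- Structure constants of `ℝ ⊕ r₂` in an adapted basis: `[Y₂, Y₃] = m Y₂`. -/
def adaptedConst (m : ℝ) (a b c : Fin 3) : ℝ :=
  if c = 1 then m * ((if a = 1 ∧ b = 2 then 1 else 0) - if a = 2 ∧ b = 1 then 1 else 0) else 0

/-- The algebraic content of Einstein's equations for an orthonormal frame with commutators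
`[e₁, e₂] = p e₂ + r e₃`, `[e₁, e₃] = q e₂ - p e₃`, `[e₂, e₃] = m e₂`. -/
theorem eq_zero_of_ricci_eq {m p q r k V00 V01 V02 V11 V12 V22 : ℝ}
    (Q0 : V00 + k = -2 * p ^ 2 - (q + r) ^ 2 / 2) (Q1 : V11 + k = (q ^ 2 - r ^ 2) / 2 - m ^ 2)
    (Q2 : V22 + k = (r ^ 2 - q ^ 2) / 2 - m ^ 2) (Q3 : V12 = p * (r - q))
    (R01 : V01 = - m * (q + r)) (R10 : V01 = - m * q) (R02 : V02 = 2 * m * p) (R20 : V02 = m * p)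
    (K11 : p * V11 + r * V12 = 0) (K12 : p * V12 + r * V22 = 0) (K21 : q * V11 - p * V12 = 0)
    (K22 : q * V12 - p * V22 = 0) (K31 : m * V11 = 0) (K42 : m * V22 = 0)
    (P0 : 0 < V00) (P1 : 0 ≤ V11) (P2 : 0 ≤ V22) :
    (m ≠ 0 ∧ p = 0 ∧ q = 0 ∧ r = 0) ∨
      (V01 = 0 ∧ V02 = 0 ∧ V12 = 0 ∧ V11 = V00 ∧ V22 = V00) := by
  by_cases hm0 : m = 0
  · right
    subst hm0
    by_cases hp0 : p = 0
    · subst hp0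
      by_cases hq0 : q = 0
      · by_cases hr0 : r = 0
        -- The abelian algebra: the sections are flat and `V` is isotropic, which the anisotropy
        -- hypothesis excludes later.
        · subst hq0 hr0
          exact ⟨by linarith, by linarith, by linarith, by linarith, by linarith⟩
        · exfalso
          have : V22 = 0 := by
            have : r * V22 = 0 := by linarith
            exact (mul_eq_zero.1 this).resolve_left hr0
          subst hq0
          have := pow_pos (abs_pos.2 hr0) 2
          rw [sq_abs] at this
          linarith
      · exfalso
        have hV11 : V11 = 0 := by
          have : q * V11 = 0 := by linarith
          exact (mul_eq_zero.1 this).resolve_left hq0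
        have hq2 := pow_pos (abs_pos.2 hq0) 2
        rw [sq_abs] at hq2
        by_cases hr0 : r = 0
        · subst hr0
          linarith
        · have hV22 : V22 = 0 := by
            have : r * V22 = 0 := by linarith
            exact (mul_eq_zero.1 this).resolve_left hr0
          linarith [sq_nonneg (q + r)]
    · exfalso
      have hV11 : V11 = - r * (r - q) := by
        have : p * (V11 + r * (r - q)) = 0 := by rw [Q3] at K11; linarith
        linarith [(mul_eq_zero.1 this).resolve_left hp0]
      have hV22 : V22 = q * (r - q) := by
        have : p * (V22 - q * (r - q)) = 0 := by rw [Q3] at K22; linarith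
        linarith [(mul_eq_zero.1 this).resolve_left hp0]
      have hrq : r = q := by
        -- The two diagonal entries sum to `-(r - q) ^ 2`, while sums of squares are nonnegative.
        -- Then both vanish, hence `k = 0`, and the equation for `V00` has the wrong sign.
        have : (r - q) ^ 2 = 0 := le_antisymm (by linarith) (sq_nonneg _)
        exact sub_eq_zero.1 (pow_eq_zero_iff two_ne_zero |>.1 this)
      subst hrq
      have hp2 := pow_pos (abs_pos.2 hp0) 2
      rw [sq_abs] at hp2
      linarith [sq_nonneg (r + r)]
  -- The two expressions for each of `V01` and `V02` give `r = 0` and `p = 0`. Harmonicity removes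
  -- `V11` and `V22`, and the difference of their Ricci equations gives `q = 0`.
  · left
    have hp0 : p = 0 := (mul_eq_zero.1 (by linarith : m * p = 0)).resolve_left hm0
    have hr0 : r = 0 := (mul_eq_zero.1 (by linarith : m * r = 0)).resolve_left hm0
    have hV11 : V11 = 0 := (mul_eq_zero.1 K31).resolve_left hm0
    have hV22 : V22 = 0 := (mul_eq_zero.1 K42).resolve_left hm0
    subst hp0 hr0
    have hq0 : q ^ 2 = 0 := by linarith
    exact ⟨hm0, rfl, by simpa using hq0, rfl⟩

namespace SpatialFrame

variable {S : SpatialFrame} {C : Fin 3 → Fin 3 → Fin 3 → ℝ} {n : ℕ} {v : Fin n → Fin 3 → ℝ}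

theorem IsBianchi.sum_mul_harmonic (hS : S.IsBianchi C) {w : Fin 3 → ℝ} (hw : S.IsHarmonic w) :
    (∀ a b, ∑ c, C a b c * w c = 0) ∧ ∑ c, (∑ b, C c b b) * w c = 0 := by
  obtain ⟨y, hy⟩ := S.isConnected.nonempty
  obtain ⟨h1, h2⟩ := hw y hy
  simp only [commTrace, hS y hy, neg_mul, Finset.sum_neg_distrib, neg_eq_zero] at h1 h2
  exact ⟨h1, h2⟩

set_option maxHeartbeats 1000000 in
-- After the rotations the structure constants are reduced to four numbers `p`, `q`, `r`, `m`.
-- Harmonicity of all `v i` gives linear relations, which are contracted with the `v i` to become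
-- relations for the sums of products, and the components of the Ricci equation complete the system.
theorem IsBianchi.eq_adaptedConst (hS : S.IsBianchi C) (hv : S.IsHarmonicRicci v)
    (hani : IsAnisotropic v) {i₀ : Fin n} (hv0 : v i₀ 0 ≠ 0) (hv1 : v i₀ 1 = 0)
    (hv2 : v i₀ 2 = 0) (hC : C 1 2 2 = 0) :
    ∃ m, m ≠ 0 ∧ ∀ a b c, C a b c = adaptedConst m a b c := by
  obtain ⟨y, hy⟩ := S.isConnected.nonempty
  obtain ⟨hh, c, hric⟩ := hv
  have hanti := hS.antisymm
  have hself : ∀ a c, C a a c = 0 := fun a c => by have := hanti a a c; linarith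
  have hH := fun i => hS.sum_mul_harmonic (hh i)
  -- The form `v i₀` points along the first axis, so its closedness says that the derived algebra
  -- has no component there.
  have h0 : ∀ a b, C a b 0 = 0 := fun a b => by
    have h := (hH i₀).1 a b
    rw [Fin.sum_univ_three, hv1, hv2] at h
    simpa [hv0] using h
  -- Coclosedness of the same form: the adjoint action of the first basis vector is trace-free.
  have ht : C 0 2 2 = - C 0 1 1 := by
    have h := (hH i₀).2
    simp only [Fin.sum_univ_three, hv1, hv2, hself] at h
    have h1 : (C 0 1 1 + C 0 2 2) * v i₀ 0 = 0 := by linarith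
    have := (mul_eq_zero.1 h1).resolve_right hv0
    linarith
  obtain ⟨p, hp⟩ : ∃ p, C 0 1 1 = p := ⟨_, rfl⟩
  obtain ⟨r, hr⟩ : ∃ r, C 0 1 2 = r := ⟨_, rfl⟩
  obtain ⟨q, hq⟩ : ∃ q, C 0 2 1 = q := ⟨_, rfl⟩
  obtain ⟨m, hm⟩ : ∃ m, C 1 2 1 = m := ⟨_, rfl⟩
  rw [hp] at ht
  have e1 : C 1 0 1 = -p := by rw [hanti, hp]
  have e2 : C 1 0 2 = -r := by rw [hanti, hr]
  have e3 : C 2 0 1 = -q := by rw [hanti, hq]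
  have e4 : C 2 0 2 = p := by rw [hanti, ht, neg_neg]
  have e5 : C 2 1 1 = -m := by rw [hanti, hm]
  have e6 : C 2 1 2 = 0 := by rw [hanti, hC, neg_zero]
  have hR : ∀ a b, ∑ i, v i a * v i b + (if a = b then c y else 0) = ∑ μ, ∑ l,
      (structConn C l b a * structConn C μ μ l - structConn C l μ a * structConn C μ b l
        + C μ b l * structConn C μ l a) := fun a b => by
    rw [← hric y hy, hS.ricci_eq hy]
  simp only [structConn] at hR
  have R00 := hR 0 0
  have R01 := hR 0 1
  have R10 := hR 1 0
  have R02 := hR 0 2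
  have R20 := hR 2 0
  have R11 := hR 1 1
  have R12 := hR 1 2
  have R21 := hR 2 1
  have R22 := hR 2 2
  clear hR
  simp [Fin.sum_univ_three, hself, h0, hp, hr, hq, hm, hC, ht, e1, e2, e3, e4, e5, e6]
    at R00 R01 R10 R02 R20 R11 R12 R21 R22
  have hsymm : ∀ a b, ∑ i, v i a * v i b = ∑ i, v i b * v i a := fun a b =>
    Finset.sum_congr rfl fun _ _ => mul_comm _ _
  have H1 : ∀ i, p * v i 1 + r * v i 2 = 0 := fun i => by
    have h := (hH i).1 0 1
    simpa [Fin.sum_univ_three, h0, hp, hr] using h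
  have H2 : ∀ i, q * v i 1 - p * v i 2 = 0 := fun i => by
    have h := (hH i).1 0 2
    simp [Fin.sum_univ_three, h0, hq, ht] at h
    linarith
  have H3 : ∀ i, m * v i 1 = 0 := fun i => by
    have h := (hH i).1 1 2
    simpa [Fin.sum_univ_three, h0, hm, hC] using h
  have H4 : ∀ i, m * v i 2 = 0 := fun i => by
    have h := (hH i).2
    simp [Fin.sum_univ_three, h0, hself, hp, ht, hC, e5] at h
    simpa using h
  have K : ∀ (x y z : ℝ) (a : Fin 3), (∀ i, x * v i 1 + y * v i 2 = 0) →
      x * ∑ i, v i 1 * v i a + y * ∑ i, v i 2 * v i a = 0 := fun x y z a h => by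
    rw [Finset.mul_sum, Finset.mul_sum, ← Finset.sum_add_distrib]
    exact Finset.sum_eq_zero fun i _ => by linear_combination v i a * h i
  have K11 := K p r 0 1 H1
  have K12 := K p r 0 2 H1
  have K21 := K q (-p) 0 1 fun i => by linarith [H2 i]
  have K22 := K q (-p) 0 2 fun i => by linarith [H2 i]
  have K31 := K m 0 0 1 fun i => by linarith [H3 i]
  have K32 := K m 0 0 2 fun i => by linarith [H3 i]
  have K42 := K 0 m 0 2 fun i => by linarith [H4 i]
  have K30 := K m 0 0 0 fun i => by linarith [H3 i]
  have K40 := K 0 m 0 0 fun i => by linarith [H4 i]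
  have P0 : 0 < ∑ i, v i 0 * v i 0 :=
    Finset.sum_pos' (fun i _ => mul_self_nonneg _) ⟨i₀, Finset.mem_univ _, mul_self_pos.2 hv0⟩
  have P1 : 0 ≤ ∑ i, v i 1 * v i 1 := Finset.sum_nonneg fun i _ => mul_self_nonneg _
  have P2 : 0 ≤ ∑ i, v i 2 * v i 2 := Finset.sum_nonneg fun i _ => mul_self_nonneg _
  have S01 := hsymm 0 1
  have S02 := hsymm 0 2
  have S12 := hsymm 1 2
  have hani' : (∑ i, v i 0 * v i 1 = 0) → (∑ i, v i 0 * v i 2 = 0) → (∑ i, v i 1 * v i 2 = 0) →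
      (∑ i, v i 1 * v i 1 = ∑ i, v i 0 * v i 0) → (∑ i, v i 2 * v i 2 = ∑ i, v i 0 * v i 0) →
      False := fun f1 f2 f3 f4 f5 => by
    obtain ⟨a, b, hab⟩ := hani (∑ i, v i 0 * v i 0)
    refine hab ?_
    fin_cases a <;> fin_cases b <;> simp
    · exact f1
    · exact f2
    · rw [← S01, f1]
    · exact f4
    · exact f3
    · rw [← S02, f2]
    · rw [← S12, f3]
    · exact f5
  rcases eq_zero_of_ricci_eq (m := m) (p := p) (q := q) (r := r) (k := c y)
    (V01 := ∑ i, v i 0 * v i 1) (V02 := ∑ i, v i 0 * v i 2)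
    (R00.trans (by ring)) (R11.trans (by ring)) (R22.trans (by ring)) (R12.trans (by ring))
    (R01.trans (by ring)) (S01.trans (R10.trans (by ring))) (R02.trans (by ring))
    (S02.trans (R20.trans (by ring))) (by rw [← S12] at K11; exact K11) K12
    (by rw [← S12] at K21; linarith) (by linarith) (by linarith) (by linarith) P0 P1 P2
    with ⟨hm0, rfl, rfl, rfl⟩ | ⟨f1, f2, f3, f4, f5⟩
  · refine ⟨m, hm0, fun a b c => ?_⟩
    fin_cases a <;> fin_cases b <;> fin_cases c <;>
      simp [adaptedConst, hself, h0, hp, hr, hq, hm, hC, ht, e1, e2, e3, e4, e5, e6]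
  · exact (hani' f1 f2 f3 f4 f5).elim

end SpatialFrame

end ShearFree

/-! ### Rotating a Bianchi frame into an adapted one. -/

namespace ShearFree

theorem mulFrame_mulFrame {n : ℕ} (Λ Λ' : Matrix (Fin n) (Fin n) ℝ) (e : Fin n → Pt n → Pt n) :
    mulFrame Λ (mulFrame Λ' e) = mulFrame (Λ * Λ') e := by
  funext μ x
  simp only [mulFrame, Finset.smul_sum, smul_smul, Matrix.mul_apply, Finset.sum_smul]
  rw [Finset.sum_comm]

namespace SpatialFrame

variable {S : SpatialFrame} {C : Fin 3 → Fin 3 → Fin 3 → ℝ} {n : ℕ} {v : Fin n → Fin 3 → ℝ}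

theorem changeFrame_changeFrame {L L' : Matrix (Fin 3) (Fin 3) ℝ} (hL : IsUnit L.det)
    (hL' : IsUnit L'.det) (hLL : IsUnit (L' * L).det) :
    (S.changeFrame L hL).changeFrame L' hL' = S.changeFrame (L' * L) hLL := by
  have : mulFrame L' (mulFrame L S.E) = mulFrame (L' * L) S.E := mulFrame_mulFrame _ _ _
  simp only [changeFrame, this]

theorem exists_cos_sin (m k : ℝ) : ∃ c s : ℝ, c ^ 2 + s ^ 2 = 1 ∧ c * k - s * m = 0 := by
  by_cases h : m ^ 2 + k ^ 2 = 0
  · have hm : m = 0 := by nlinarith [sq_nonneg m, sq_nonneg k]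
    have hk : k = 0 := by nlinarith [sq_nonneg m, sq_nonneg k]
    exact ⟨1, 0, by simp, by simp [hk]⟩
  · have hpos : 0 < m ^ 2 + k ^ 2 := lt_of_le_of_ne (by positivity) (Ne.symm h)
    have hρ := Real.sqrt_pos.2 hpos
    have hρ2 := Real.sq_sqrt hpos.le
    refine ⟨m / Real.sqrt (m ^ 2 + k ^ 2), k / Real.sqrt (m ^ 2 + k ^ 2), ?_, by ring⟩
    field_simp
    exact hρ2.symm

/-- A Bianchi frame with anisotropic Ricci tensor given by harmonic one-forms can be rotated into an
adapted frame. -/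
theorem IsBianchi.exists_adapted (hS : S.IsBianchi C) (hv : S.IsHarmonicRicci v)
    (hani : IsAnisotropic v) : ∃ R : Matrix (Fin 3) (Fin 3) ℝ, R * Rᵀ = 1 ∧
      ∀ hR : IsUnit R.det, ∃ m, m ≠ 0 ∧ (S.changeFrame R hR).IsBianchi (adaptedConst m) := by
  obtain ⟨i₀, hi₀⟩ : ∃ i, v i ≠ 0 := by
    by_contra! hcon
    obtain ⟨a, b, hab⟩ := hani 0
    simp [hcon] at hab
  obtain ⟨R₁, hR₁, hv1, hv2⟩ := exists_rotation (v i₀)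
  have hu₁ := isUnit_det_of_mul_transpose hR₁
  have hv0 : (R₁ *ᵥ v i₀) 0 ≠ 0 := fun h => by
    have h1 : R₁ *ᵥ v i₀ = 0 := by
      funext a; fin_cases a
      · exact h
      · exact hv1
      · exact hv2
    have h2 : R₁⁻¹ *ᵥ (R₁ *ᵥ v i₀) = v i₀ := by
      rw [Matrix.mulVec_mulVec, Matrix.nonsing_inv_mul _ hu₁, Matrix.one_mulVec]
    rw [h1, Matrix.mulVec_zero] at h2
    exact hi₀ h2.symm
  obtain ⟨C₁, hC₁⟩ := exists_structureConst C hu₁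
  have hS₁ := hS.changeFrame hu₁ hC₁
  obtain ⟨c, s, hcs, hk⟩ := exists_cos_sin (C₁ 1 2 1) (C₁ 1 2 2)
  -- A rotation about the first axis preserves the direction of `v i₀` and rotates the pair `C₁ 1 2
  -- 1, C₁ 1 2 2` as a vector, so its second entry can be made zero.
  let R₂ : Matrix (Fin 3) (Fin 3) ℝ := !![1, 0, 0; 0, c, s; 0, -s, c]
  have hR₂ : R₂ * R₂ᵀ = 1 := by
    ext i j
    fin_cases i <;> fin_cases j <;> simp [R₂, Matrix.mul_apply, Fin.sum_univ_three,
      Matrix.vecHead, Matrix.vecTail]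
    · linear_combination hcs
    · ring
    · ring
    · linear_combination hcs
  have hu₂ := isUnit_det_of_mul_transpose hR₂
  obtain ⟨C₂, hC₂⟩ := exists_structureConst C₁ hu₂
  have hS₂ := hS₁.changeFrame hu₂ hC₂
  have hC122 : C₂ 1 2 2 = 0 := by
    have h1 := hC₂ 1 2 1
    have h2 := hC₂ 1 2 2
    have a1 := hS₁.antisymm 2 1 1
    have a2 := hS₁.antisymm 2 1 2
    have a3 : ∀ a b, C₁ a a b = 0 := fun a b => by have := hS₁.antisymm a a b; linarith
    simp [R₂, Fin.sum_univ_three, a1, a2, a3] at h1 h2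
    linear_combination (-s) * h1 + c * h2 - (C₂ 1 2 2 - (c * C₁ 1 2 2 - s * C₁ 1 2 1)) * hcs + hk
  obtain ⟨m, hm, hmC⟩ := hS₂.eq_adaptedConst ((hv.changeFrame hu₁ hR₁).changeFrame hu₂ hR₂)
    ((hani.mulVec hu₁ hR₁).mulVec hu₂ hR₂) (i₀ := i₀)
    (by simpa [R₂, Matrix.mulVec, dotProduct, Fin.sum_univ_three] using hv0)
    (by have := hv1; have := hv2; simp_all [R₂, Matrix.mulVec, dotProduct, Fin.sum_univ_three])
    (by have := hv1; have := hv2; simp_all [R₂, Matrix.mulVec, dotProduct, Fin.sum_univ_three])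
    hC122
  refine ⟨R₂ * R₁, ?_, fun hR => ⟨m, hm, ?_⟩⟩
  · rw [Matrix.transpose_mul, Matrix.mul_assoc, ← Matrix.mul_assoc R₁, hR₁, Matrix.one_mul, hR₂]
  · rw [← changeFrame_changeFrame hu₁ hu₂ hR]
    exact fun x hx a b d => by rw [hS₂ x hx, hmC]

end SpatialFrame

namespace Cosmology

variable {S : SpatialFrame} {n : ℕ} {M : Cosmology S n} {s : ℝ → ℝ}

/-- If the sum of squares were isotropic, so would be the Ricci tensor of the sections, against the
assumed intrinsic anisotropy. -/
theorem IsConformallyOrthonormal.exists_isHarmonicRicci (hM : M.IsConformallyOrthonormal s)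
    (hS : M.IsShearFreeModel) (hpos : M.HasPositiveEnergy) :
    ∃ v : Fin n → Fin 3 → ℝ, S.IsHarmonicRicci v ∧ SpatialFrame.IsAnisotropic v := by
  obtain ⟨v, hv, c, hc⟩ := hM.exists_ricci_eq hS hpos
  refine ⟨v, ⟨hv, c, hc⟩, fun r => ?_⟩
  by_contra! hcon
  obtain ⟨t, ht, y, hy, a, b, hab⟩ := hS.anisotropic
  have hs := (hM.pos t ht).ne'
  refine hab ?_
  have h : ∀ a b, ricci S.E (fun _ => M.h t) a b y = if a = b then r + c y else 0 := fun a b => by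
    rw [hM.h_eq t ht, S.ricci_smul_one hs, hc y hy, hcon]
    split_ifs <;> simp
  simp only [tracelessRicci, scalarCurv, h]
  rw [hM.h_eq t ht, SpatialFrame.smul_one_inv hs]
  simp only [SpatialFrame.smul_one_apply]
  split_ifs
  · simp
    field_simp
    ring
  · simp

/-- Every Bianchi model among the shear-free solutions without fields of negative energy has an
adapted orthonormal frame. -/
theorem IsShearFreeModel.exists_adapted (hS : M.IsShearFreeModel) (hpos : ∀ (L : Matrix (Fin 3) (Fin 3) ℝ)
    (hL : IsUnit L.det), (M.changeFrame L hL).HasPositiveEnergy)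
    {C : Fin 3 → Fin 3 → Fin 3 → ℝ} (hC : S.IsBianchi C) :
    ∃ (L : Matrix (Fin 3) (Fin 3) ℝ) (hL : IsUnit L.det) (m : ℝ) (s : ℝ → ℝ), m ≠ 0 ∧
      (S.changeFrame L hL).IsBianchi (adaptedConst m) ∧
      (M.changeFrame L hL).IsConformallyOrthonormal s := by
  obtain ⟨s, k, L, -, -, -, hL, hs⟩ := M.exists_isConformallyOrthonormal hS.shear_eq_zero
  have hu : IsUnit L.det :=
    Matrix.isUnit_det_of_right_inverse (B := k * Lᵀ) (by rw [← Matrix.mul_assoc, hL])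
  obtain ⟨v, hv, hani⟩ := (hs L hu hL).exists_isHarmonicRicci (hS.changeFrame L hu) (hpos L hu)
  obtain ⟨C', hC'⟩ := SpatialFrame.exists_structureConst C hu
  obtain ⟨R, hR, h⟩ := (hC.changeFrame hu hC').exists_adapted hv hani
  have hRu := SpatialFrame.isUnit_det_of_mul_transpose hR
  obtain ⟨m, hm, hm'⟩ := h hRu
  have hRL : IsUnit (R * L).det := by rw [Matrix.det_mul]; exact hRu.mul hu
  refine ⟨R * L, hRL, m, s, hm, ?_, hs _ hRL ?_⟩
  · rwa [SpatialFrame.changeFrame_changeFrame hu hRu hRL] at hm'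
  · rw [Matrix.transpose_mul, Matrix.mul_assoc, Matrix.mul_assoc, ← Matrix.mul_assoc k,
      ← Matrix.mul_assoc L, ← Matrix.mul_assoc L, hL, Matrix.one_mul, hR]

end Cosmology

end ShearFree

/-! ### Exclusion of Kantowski–Sachs models. -/

namespace ShearFree

namespace SpatialFrame

variable {S : SpatialFrame} {y : Pt 3}

/-- The nonvanishing commutation functions of a Kantowski-Sachs frame, up to the cotangent. -/
def ksConst (a b c : Fin 3) : ℝ :=
  if c = 2 then (if a = 2 ∧ b = 1 then 1 else 0) - if a = 1 ∧ b = 2 then 1 else 0 else 0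

theorem hasDerivAt_cot {u : ℝ} (hu : Real.sin u ≠ 0) :
    HasDerivAt (fun u => Real.cos u / Real.sin u) (-(1 / Real.sin u ^ 2)) u := by
  refine ((Real.hasDerivAt_cos u).div (Real.hasDerivAt_sin u) hu).congr_deriv ?_
  have := Real.sin_sq_add_cos_sq u
  field_simp
  linarith

theorem IsKantowskiSachs.sin_ne (hS : S.IsKantowskiSachs) (hy : y ∈ S.U) : Real.sin (y 1) ≠ 0 :=
  (Real.sin_pos_of_pos_of_lt_pi (hS y hy).1 (hS y hy).2.1).ne'

theorem hasFDerivAt_comp_one {f : ℝ → ℝ} {f' : ℝ} (hf : HasDerivAt f f' (y 1)) :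
    HasFDerivAt (fun z : Pt 3 => f (z 1)) (f' • ContinuousLinearMap.proj (R := ℝ) (φ := fun _ => ℝ) 1) y :=
  hf.comp_hasFDerivAt y (ContinuousLinearMap.proj (R := ℝ) (φ := fun _ : Fin 3 => ℝ) 1).hasFDerivAt

/-- Only the last frame vector varies, through `1 / sin y`, so the derivative of this factor along
`∂_y` is the sole source of commutators. -/
theorem IsKantowskiSachs.commCoeff_eq (hS : S.IsKantowskiSachs) (hy : y ∈ S.U) (a b c : Fin 3) :
    commCoeff S.E a b c y = ksConst a b c * (Real.cos (y 1) / Real.sin (y 1)) := by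
  have hsin := hS.sin_ne hy
  have hU := S.isOpen.mem_nhds hy
  have h0 : HasFDerivAt (S.E 0) (0 : Pt 3 →L[ℝ] Pt 3) y :=
    (hasFDerivAt_const ![1, 0, 0] y).congr_of_eventuallyEq (by
      filter_upwards [hU] with z hz using (hS z hz).2.2.1)
  have h1 : HasFDerivAt (S.E 1) (0 : Pt 3 →L[ℝ] Pt 3) y :=
    (hasFDerivAt_const ![0, 1, 0] y).congr_of_eventuallyEq (by
      filter_upwards [hU] with z hz using (hS z hz).2.2.2.1)
  have h2 : HasFDerivAt (S.E 2) ((-(Real.cos (y 1) / Real.sin (y 1) ^ 2)) •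
      (ContinuousLinearMap.proj (R := ℝ) (φ := fun _ : Fin 3 => ℝ) 1).smulRight
        (![0, 0, 1] : Pt 3)) y := by
    have hd : HasDerivAt (fun u => 1 / Real.sin u) (-(Real.cos (y 1) / Real.sin (y 1) ^ 2)) (y 1) := by
      refine ((hasDerivAt_const _ (1 : ℝ)).div (Real.hasDerivAt_sin _) hsin).congr_deriv ?_
      ring
    have h3 := (hasFDerivAt_comp_one hd).smul_const (![0, 0, 1] : Pt 3)
    refine (h3.congr_of_eventuallyEq ?_).congr_fderiv ?_
    · filter_upwards [hU] with z hz
      rw [(hS z hz).2.2.2.2]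
      simp
    · ext v i
      fin_cases i <;> simp
  have e0 : S.E 0 y = ![1, 0, 0] := (hS y hy).2.2.1
  have e1 : S.E 1 y = ![0, 1, 0] := (hS y hy).2.2.2.1
  have e2 : S.E 2 y = ![0, 0, 1 / Real.sin (y 1)] := (hS y hy).2.2.2.2
  refine frameCoord_eq (S.indep y hy)
    (c := fun c => ksConst a b c * (Real.cos (y 1) / Real.sin (y 1))) ?_ c
  rw [VectorField.lieBracket]
  fin_cases a <;> fin_cases b <;> funext i <;> fin_cases i <;>
    simp [h0.fderiv, h1.fderiv, h2.fderiv, e0, e1, e2, ksConst, Fin.sum_univ_three] <;> ring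

variable {α β : ℝ}

theorem isUnit_det_diagonal (hα : α ≠ 0) (hβ : β ≠ 0) :
    IsUnit (Matrix.diagonal ![α, β, β]).det := by
  rw [Matrix.det_diagonal, Fin.prod_univ_three]
  simp [hα, hβ]

theorem IsKantowskiSachs.commCoeff_diagonal (hS : S.IsKantowskiSachs) (hα : α ≠ 0) (hβ : β ≠ 0)
    (hy : y ∈ S.U) (a b c : Fin 3) :
    commCoeff (S.changeFrame _ (isUnit_det_diagonal hα hβ)).E a b c y
      = ksConst a b c * (β * (Real.cos (y 1) / Real.sin (y 1))) := by
  have h := commCoeff_mulFrame (isUnit_det_diagonal hα hβ) (S.indep y hy)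
    (fun a => S.differentiableAt_E a hy) a b c
  simp only [hS.commCoeff_eq hy, Matrix.diagonal_apply, ite_mul, mul_ite, zero_mul, mul_zero,
    Finset.sum_ite_eq, Finset.sum_ite_eq', Finset.mem_univ, if_true] at h
  have h1 : commCoeff (mulFrame (Matrix.diagonal ![α, β, β]) S.E) a b c y * ![α, β, β] c
    = ksConst a b c * (β * (Real.cos (y 1) / Real.sin (y 1))) * ![α, β, β] c := by
    rw [h]
    fin_cases a <;> fin_cases b <;> fin_cases c <;> simp [ksConst] <;> ring
  refine mul_right_cancel₀ (b := ![α, β, β] c) ?_ h1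
  fin_cases c <;> simpa

theorem IsKantowskiSachs.ricci_eq (hS : S.IsKantowskiSachs) (hα : α ≠ 0) (hβ : β ≠ 0)
    (hy : y ∈ S.U) :
    ricci (S.changeFrame _ (isUnit_det_diagonal hα hβ)).E (fun _ => 1) 0 0 y = 0 ∧
      ricci (S.changeFrame _ (isUnit_det_diagonal hα hβ)).E (fun _ => 1) 1 1 y = β ^ 2 := by
  have hsin := hS.sin_ne hy
  set S' := S.changeFrame _ (isUnit_det_diagonal hα hβ)
  have h1 := S'.conn_smul_one (one_ne_zero)
  simp only [one_smul] at h1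
  let f : ℝ → ℝ := fun u => β * (Real.cos u / Real.sin u)
  have h2 : ∀ c a b, ∀ z ∈ S.U, S'.orthoConn c a b z
      = (1 / 2) * (ksConst a b c - ksConst a c b - ksConst b c a) * f (z 1) := fun c a b z hz => by
    rw [orthoConn, hS.commCoeff_diagonal hα hβ hz, hS.commCoeff_diagonal hα hβ hz,
      hS.commCoeff_diagonal hα hβ hz]
    ring
  have hf : HasFDerivAt (fun z : Pt 3 => f (z 1)) ((β * -(1 / Real.sin (y 1) ^ 2)) •
      ContinuousLinearMap.proj (R := ℝ) (φ := fun _ => ℝ) 1) y :=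
    hasFDerivAt_comp_one ((hasDerivAt_cot hsin).const_mul β)
  have h3 : ∀ c a b d, frameDeriv S'.E (S'.orthoConn c a b) d y
      = (1 / 2) * (ksConst a b c - ksConst a c b - ksConst b c a)
        * (if d = 1 then -(β ^ 2 / Real.sin (y 1) ^ 2) else 0) := fun c a b d => by
    rw [frameDeriv_congr (f' := fun z => (1 / 2) * (ksConst a b c - ksConst a c b - ksConst b c a)
      * f (z 1))]
    · rw [frameDeriv, (hf.const_mul _).fderiv]
      have e0 : S.E 0 y = ![1, 0, 0] := (hS y hy).2.2.1
      have e1 : S.E 1 y = ![0, 1, 0] := (hS y hy).2.2.2.1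
      have e2 : S.E 2 y = ![0, 0, 1 / Real.sin (y 1)] := (hS y hy).2.2.2.2
      have e3 : S'.E d y = ∑ ν, (Matrix.diagonal ![α, β, β]) d ν • S.E ν y := rfl
      rw [e3]
      fin_cases d <;> simp [Fin.sum_univ_three, e0, e1, e2, -mul_eq_mul_left_iff] <;> ring
    · filter_upwards [S.isOpen.mem_nhds hy] with z hz using h2 c a b z hz
  have hcs := Real.sin_sq_add_cos_sq (y 1)
  have hD : ∀ a b c, commCoeff S'.E a b c y
      = ksConst a b c * (β * (Real.cos (y 1) / Real.sin (y 1))) := hS.commCoeff_diagonal hα hβ hy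
  constructor
  · simp only [ricci, riemann, h1, h3, h2 _ _ _ y hy]
    simp [Fin.sum_univ_three, ksConst]
  · simp only [ricci, riemann, h1, h3, h2 _ _ _ y hy, f, hD]
    simp [Fin.sum_univ_three, ksConst]
    field_simp
    linear_combination (-2) * hcs

/-- Harmonic one-forms of a Kantowski-Sachs frame. -/
theorem IsKantowskiSachs.eq_zero_of_isHarmonic (hS : S.IsKantowskiSachs) (hα : α ≠ 0) (hβ : β ≠ 0)
    {v : Fin 3 → ℝ} (hv : (S.changeFrame _ (isUnit_det_diagonal hα hβ)).IsHarmonic v) :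
    v 1 = 0 := by
  -- If the cosine vanished on the open patch, so would its derivative, but the sine has no zero
  -- there. At the chosen point coclosedness gives `v 1 = 0`.
  obtain ⟨y, hy, hcot⟩ : ∃ y ∈ S.U, Real.cos (y 1) ≠ 0 := by
    obtain ⟨y, hy⟩ := S.isConnected.nonempty
    by_contra! hcon
    have h1 : HasFDerivAt (fun z : Pt 3 => Real.cos (z 1)) _ y :=
      hasFDerivAt_comp_one (Real.hasDerivAt_cos _)
    have h2 : HasFDerivAt (fun z : Pt 3 => Real.cos (z 1)) (0 : Pt 3 →L[ℝ] ℝ) y :=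
      (hasFDerivAt_const 0 y).congr_of_eventuallyEq (by
        filter_upwards [S.isOpen.mem_nhds hy] with z hz using hcon z hz)
    have h3 := congrArg (fun l : Pt 3 →L[ℝ] ℝ => l ![0, 1, 0]) (h1.unique h2)
    simp at h3
    exact hS.sin_ne hy h3
  have hsin := hS.sin_ne hy
  have h := (hv y hy).2
  simp only [commTrace, hS.commCoeff_diagonal hα hβ hy] at h
  simp [Fin.sum_univ_three, ksConst] at h
  rcases h with h | h
  · exact absurd h (by simp [hβ, hsin, hcot])
  · exact h

end SpatialFrame

namespace Cosmology

variable {S : SpatialFrame} {n : ℕ} {M : Cosmology S n}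

/-- There are no Kantowski-Sachs models among the shear-free solutions without fields of negative
energy. -/
theorem IsShearFreeModel.not_isKantowskiSachs (hS : M.IsShearFreeModel)
    (hpos : ∀ (L : Matrix (Fin 3) (Fin 3) ℝ) (hL : IsUnit L.det),
      (M.changeFrame L hL).HasPositiveEnergy)
    (hKS : S.IsKantowskiSachs) {A B : ℝ → ℝ}
    (hAB : ∀ t ∈ M.I, M.h t = Matrix.diagonal ![A t ^ 2, B t ^ 2, B t ^ 2]) : False := by
  obtain ⟨s, k, -, hspos, -, hk, -, hs⟩ := M.exists_isConformallyOrthonormal hS.shear_eq_zero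
  obtain ⟨t, ht⟩ := M.isConnected.nonempty
  obtain ⟨y, hy⟩ := S.isConnected.nonempty
  have hst := hspos t ht
  have hdet := (M.h_det_isUnit ht).ne_zero
  rw [hAB t ht, Matrix.det_diagonal, Fin.prod_univ_three] at hdet
  have hA : A t ≠ 0 := fun h => by simp [h] at hdet
  have hB : B t ≠ 0 := fun h => by simp [h] at hdet
  have hsq := Real.sqrt_pos.2 hst
  have hsq2 := Real.sq_sqrt hst.le
  have hα : Real.sqrt (s t) / A t ≠ 0 := div_ne_zero hsq.ne' hA
  have hβ : Real.sqrt (s t) / B t ≠ 0 := div_ne_zero hsq.ne' hB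
  have hkd : k = Matrix.diagonal ![A t ^ 2 / s t, B t ^ 2 / s t, B t ^ 2 / s t] := by
    have h := hk t ht
    rw [hAB t ht] at h
    have h1 : k = (s t)⁻¹ • (s t • k) := by rw [smul_smul, inv_mul_cancel₀ hst.ne', one_smul]
    rw [h1, ← h]
    ext i j
    fin_cases i <;> fin_cases j <;> simp [div_eq_inv_mul]
  have hM := hs _ (SpatialFrame.isUnit_det_diagonal hα hβ) (by
    rw [hkd, Matrix.diagonal_transpose, Matrix.diagonal_mul_diagonal, Matrix.diagonal_mul_diagonal,
      ← Matrix.diagonal_one]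
    congr 1
    funext i
    fin_cases i <;> simp <;> field_simp <;> exact hsq2)
  obtain ⟨v, ⟨hv, c, hc⟩, -⟩ := hM.exists_isHarmonicRicci (hS.changeFrame _ _) (hpos _ _)
  obtain ⟨h0, h1⟩ := hKS.ricci_eq hα hβ hy
  have c0 := hc y hy 0 0
  have c1 := hc y hy 1 1
  rw [h0, if_pos rfl] at c0
  rw [h1, if_pos rfl] at c1
  -- The direction tangent to the sphere carries no harmonic form, so `c` is the positive curvature
  -- there; along the line the Ricci tensor vanishes, so `c` is minus a sum of squares.
  have hv1 : ∀ i, v i 1 = 0 := fun i => hKS.eq_zero_of_isHarmonic hα hβ (hv i)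
  have h2 : 0 ≤ ∑ i, v i 0 * v i 0 := Finset.sum_nonneg fun i _ => mul_self_nonneg _
  simp [hv1] at c1
  have h3 : 0 < (Real.sqrt (s t) / B t) ^ 2 := by positivity
  linarith

end Cosmology

end ShearFree

/-! ### Structure constants under a change of basis; type III. -/

namespace ShearFree

section StructureConstants

variable {C C' : Fin 3 → Fin 3 → Fin 3 → ℝ} {L : Matrix (Fin 3) (Fin 3) ℝ}

/-- `C'` are the structure constants in the basis `L_a^i Y_i`. -/
def IsBasisChange (C C' : Fin 3 → Fin 3 → Fin 3 → ℝ) (L : Matrix (Fin 3) (Fin 3) ℝ) : Prop :=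
  ∀ a b k, ∑ c, C' a b c * L c k = ∑ i, ∑ j, L a i * L b j * C i j k

theorem IsBasisChange.trans {C'' : Fin 3 → Fin 3 → Fin 3 → ℝ} {L' : Matrix (Fin 3) (Fin 3) ℝ}
    (h : IsBasisChange C C' L) (h' : IsBasisChange C' C'' L') : IsBasisChange C C'' (L' * L) := by
  intro a b k
  calc ∑ c, C'' a b c * (L' * L) c k = ∑ d, (∑ c, C'' a b c * L' c d) * L d k := by
        simp only [Matrix.mul_apply, Finset.mul_sum, Finset.sum_mul]
        rw [Finset.sum_comm]
        exact Finset.sum_congr rfl fun _ _ => Finset.sum_congr rfl fun _ _ => by ring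
    _ = ∑ i, ∑ j, L' a i * L' b j * ∑ d, C' i j d * L d k := by
        simp only [h' a b, Finset.mul_sum, Finset.sum_mul]
        rw [sum_comm₃]
        exact Finset.sum_congr rfl fun _ _ => Finset.sum_congr rfl fun _ _ =>
          Finset.sum_congr rfl fun _ _ => by ring
    _ = ∑ i, ∑ j, (L' * L) a i * (L' * L) b j * C i j k := by
        simp only [h _ _ k, Matrix.mul_apply, Finset.mul_sum, Finset.sum_mul]
        rw [sum_comm₄]
        refine Finset.sum_congr rfl fun _ _ => Finset.sum_congr rfl fun _ _ => ?_
        rw [Finset.sum_comm]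
        exact Finset.sum_congr rfl fun _ _ => Finset.sum_congr rfl fun _ _ => by ring

/-- The structure constants of a Bianchi frame after a constant change of frame. -/
theorem SpatialFrame.IsBianchi.isBasisChange {S : SpatialFrame} (hL : IsUnit L.det)
    (hS : S.IsBianchi C) (hS' : (S.changeFrame L hL).IsBianchi C') : IsBasisChange C C' L := by
  intro a b k
  obtain ⟨y, hy⟩ := S.isConnected.nonempty
  have h := commCoeff_mulFrame hL (S.indep y hy) (fun a => S.differentiableAt_E a hy) a b k
  have h' : ∀ a b c, commCoeff (mulFrame L S.E) a b c y = - C' a b c := hS' y hy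
  simp only [h', hS y hy, neg_mul, mul_neg, Finset.sum_neg_distrib, neg_inj] at h
  exact h

theorem isTypeIII_iff : IsTypeIII C ↔ ∃ M : Matrix (Fin 3) (Fin 3) ℝ, IsUnit M.det ∧
    IsBasisChange C (behrConst (Matrix.diagonal ![0, 1, -1]) ![1, 0, 0]) M := Iff.rfl

theorem IsBasisChange.isTypeIII (hL : IsUnit L.det) (h : IsBasisChange C C' L)
    (hC : IsTypeIII C') : IsTypeIII C := by
  obtain ⟨M, hM, hMC⟩ := isTypeIII_iff.1 hC
  exact isTypeIII_iff.2 ⟨M * L, by rw [Matrix.det_mul]; exact hM.mul hL, h.trans hMC⟩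

theorem sum_eps_mul (L : Matrix (Fin 3) (Fin 3) ℝ) (p q i : Fin 3) :
    ∑ a, ∑ b, ∑ f, eps a b f * L a p * L b q * L f i = L.det * eps p q i := by
  fin_cases p <;> fin_cases q <;> fin_cases i <;>
    simp [eps, Matrix.det_fin_three, Fin.sum_univ_three] <;> ring

/-- The trace `h_{ab} N^{ab}`. -/
theorem sum_mul_behrN {h : Matrix (Fin 3) (Fin 3) ℝ} (hh : ∀ a b, h a b = h b a)
    (C : Fin 3 → Fin 3 → Fin 3 → ℝ) :
    ∑ a, ∑ b, h a b * behrN C a b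
      = (1 / 2) * ∑ f, ∑ d, h f d * ∑ a, ∑ b, eps a b f * C a b d := by
  have h1 : ∑ f, ∑ d, h f d * ∑ a, ∑ b, eps a b d * C a b f
      = ∑ f, ∑ d, h f d * ∑ a, ∑ b, eps a b f * C a b d := by
    rw [Finset.sum_comm]
    exact Finset.sum_congr rfl fun _ _ => Finset.sum_congr rfl fun _ _ => by rw [hh]
  have h2 : ∑ a, ∑ b, h a b * behrN C a b
      = (1 / 4) * (∑ f, ∑ d, h f d * ∑ a, ∑ b, eps a b f * C a b d)
        + (1 / 4) * ∑ f, ∑ d, h f d * ∑ a, ∑ b, eps a b d * C a b f := by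
    rw [← mul_add, ← Finset.sum_add_distrib, Finset.mul_sum]
    refine Finset.sum_congr rfl fun f _ => ?_
    rw [← Finset.sum_add_distrib, Finset.mul_sum]
    refine Finset.sum_congr rfl fun d _ => ?_
    simp only [behrN, Finset.sum_add_distrib]
    ring
  rw [h2, h1]
  ring

/-- `N` is a tensor density: contracting the symbol `ε` with three rows of `L` produces its
determinant. Thus vanishing of `N^a_a` does not depend on the basis. -/
theorem IsBasisChange.sum_mul_behrN {h : Matrix (Fin 3) (Fin 3) ℝ} (hh : ∀ a b, h a b = h b a)
    (hC : IsBasisChange C C' L) :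
    ∑ a, ∑ b, (L * h * Lᵀ) a b * behrN C' a b = L.det * ∑ a, ∑ b, h a b * behrN C a b := by
  have h0 : ∀ a b, (L * h * Lᵀ) a b = ∑ i, ∑ j, L a i * L b j * h i j := fun a b =>
    mulMetric_apply (Λ := L) (g := fun _ : Pt 3 => h) 0 a b
  have hh' : ∀ a b, (L * h * Lᵀ) a b = (L * h * Lᵀ) b a := fun a b => by
    rw [h0, h0, Finset.sum_comm]
    exact Finset.sum_congr rfl fun _ _ => Finset.sum_congr rfl fun _ _ => by rw [hh]; ring
  rw [ShearFree.sum_mul_behrN hh', ShearFree.sum_mul_behrN hh]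
  have h1 : ∀ f, ∑ d, (L * h * Lᵀ) f d * ∑ a, ∑ b, eps a b f * C' a b d
      = ∑ i, ∑ j, h i j * ∑ p, ∑ q, C p q j * ∑ a, ∑ b, eps a b f * L a p * L b q * L f i := by
    intro f
    calc _ = ∑ i, ∑ j, h i j * ∑ a, ∑ b, eps a b f * L f i * ∑ d, C' a b d * L d j := by
          simp only [h0, Finset.mul_sum, Finset.sum_mul]
          rw [sum_comm₃]
          trans ∑ a, ∑ b, ∑ i, ∑ j, ∑ d, eps a b f * L f i * C' a b d * L d j * h i j
          · refine Finset.sum_congr rfl fun _ _ => Finset.sum_congr rfl fun _ _ => ?_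
            rw [sum_comm₃]
            exact Finset.sum_congr rfl fun _ _ => Finset.sum_congr rfl fun _ _ =>
              Finset.sum_congr rfl fun _ _ => by ring
          · rw [sum_comm₄]
            exact Finset.sum_congr rfl fun _ _ => Finset.sum_congr rfl fun _ _ =>
              Finset.sum_congr rfl fun _ _ => Finset.sum_congr rfl fun _ _ =>
              Finset.sum_congr rfl fun _ _ => by ring
      _ = _ := by
          refine Finset.sum_congr rfl fun _ _ => Finset.sum_congr rfl fun _ _ => ?_
          congr 1
          simp only [hC _ _, Finset.mul_sum]
          rw [sum_comm₄]
          exact Finset.sum_congr rfl fun _ _ => Finset.sum_congr rfl fun _ _ =>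
            Finset.sum_congr rfl fun _ _ => Finset.sum_congr rfl fun _ _ => by ring
  simp only [h1]
  rw [sum_comm₃]
  have h2 : ∀ i j, ∑ f, h i j * ∑ p, ∑ q, C p q j * ∑ a, ∑ b, eps a b f * L a p * L b q * L f i
      = L.det * (h i j * ∑ p, ∑ q, eps p q i * C p q j) := fun i j => by
    rw [← Finset.mul_sum, sum_comm₃]
    simp only [← Finset.mul_sum]
    have h3 : ∀ p q, ∑ f, ∑ a, ∑ b, eps a b f * L a p * L b q * L f i = L.det * eps p q i :=
      fun p q => by rw [sum_comm₃, sum_eps_mul]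
    simp only [h3, Finset.mul_sum]
    exact Finset.sum_congr rfl fun _ _ => Finset.sum_congr rfl fun _ _ => by ring
  simp only [h2, ← Finset.mul_sum]
  ring

/-- The canonical basis is adjusted so that the sum of its last two vectors spans the centre and
their difference the derived algebra; the factor `-2 / m` normalises the remaining vector. -/
theorem isTypeIII_adaptedConst {m : ℝ} (hm : m ≠ 0) : IsTypeIII (adaptedConst m) := by
  refine ⟨!![0, 0, -2 / m; 1, 1, 0; 1, -1, 0], ?_, fun a b k => ?_⟩
  · have h : (!![0, 0, -2 / m; 1, 1, 0; 1, -1, 0] : Matrix (Fin 3) (Fin 3) ℝ).det = 4 / m := by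
      simp [Matrix.det_fin_three]
      ring
    rw [h, isUnit_iff_ne_zero]
    exact div_ne_zero (by norm_num) hm
  · fin_cases a <;> fin_cases b <;> fin_cases k <;>
      simp [Fin.sum_univ_three, adaptedConst, behrConst, eps, Matrix.det_fin_three, hm] <;> norm_num

/-- The only nonzero entries of `N` are off-diagonal, pairing the centre with the derived algebra.
-/
theorem sum_behrN_adaptedConst (m : ℝ) : ∑ a, behrN (adaptedConst m) a a = 0 := by
  simp [Fin.sum_univ_three, adaptedConst, behrN, eps, Matrix.det_fin_three]

end StructureConstants

end ShearFree

/-! ### The Poincaré lemma in a frame, and Killing fields. -/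

namespace ShearFree

section Poincare

variable {n : ℕ} {e : Fin n → Pt n → Pt n} {B : Set (Pt n)} {c : Fin n → Pt n → ℝ}

theorem frameCoord_self {x : Pt n} (h : LinearIndependent ℝ fun μ => e μ x) (μ κ : Fin n) :
    frameCoord e x (e μ x) κ = if κ = μ then 1 else 0 :=
  frameCoord_eq h (c := fun κ => if κ = μ then 1 else 0) (by simp) κ

/-- The one-form with components `c_μ` in a frame. -/
def oneForm (e : Fin n → Pt n → Pt n) (c : Fin n → Pt n → ℝ) (y : Pt n) : Pt n →L[ℝ] ℝ :=
  ∑ i, (∑ κ, c κ y * (Matrix.of fun i j => e j y i)⁻¹ κ i) •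
    ContinuousLinearMap.proj (R := ℝ) (φ := fun _ : Fin n => ℝ) i

theorem oneForm_apply (y v : Pt n) : oneForm e c y v = ∑ κ, c κ y * frameCoord e y v κ := by
  simp only [oneForm, sum_apply, smul_apply,
    ContinuousLinearMap.proj_apply, smul_eq_mul, frameCoord, Matrix.mulVec, dotProduct,
    Finset.sum_mul, Finset.mul_sum]
  rw [Finset.sum_comm]
  exact Finset.sum_congr rfl fun _ _ => Finset.sum_congr rfl fun _ _ => by ring

theorem oneForm_frame {y : Pt n} (h : LinearIndependent ℝ fun μ => e μ y) (μ : Fin n) :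
    oneForm e c y (e μ y) = c μ y := by
  simp [oneForm_apply, frameCoord_self h]

theorem contDiffOn_oneForm (he : ∀ μ, ContDiffOn ℝ ∞ (e μ) B)
    (hi : ∀ x ∈ B, LinearIndependent ℝ fun μ => e μ x) (hc : ∀ μ, ContDiffOn ℝ ∞ (c μ) B) :
    ContDiffOn ℝ ∞ (oneForm e c) B := by
  refine ContDiffOn.sum fun i _ => ContDiffOn.smul (ContDiffOn.sum fun κ _ => (hc κ).mul ?_)
    contDiffOn_const
  exact contDiffOn_inv_apply (fun i j => by simpa using contDiffOn_pi.1 (he j) i)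
    (fun x hx => frameMatrix_det_ne (hi x hx)) κ i

/-- The Poincaré lemma for a one-form given by its components in a frame. -/
theorem exists_frameDeriv_eq (hB : IsOpen B) (hconv : Convex ℝ B)
    (he : ∀ μ, ContDiffOn ℝ ∞ (e μ) B)
    (hi : ∀ x ∈ B, LinearIndependent ℝ fun μ => e μ x) (hc : ∀ μ, ContDiffOn ℝ ∞ (c μ) B)
    (hd : ∀ x ∈ B, ∀ μ ν, frameDeriv e (c ν) μ x - frameDeriv e (c μ) ν x
      = ∑ κ, commCoeff e μ ν κ x * c κ x) (y : Pt n) :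
    ∃ f : Pt n → ℝ, f y = 0 ∧ ContDiffOn ℝ ∞ f B ∧ ∀ x ∈ B, ∀ μ, frameDeriv e f μ x = c μ x := by
  have hθ := contDiffOn_oneForm he hi hc
  have hθd : ∀ x ∈ B, DifferentiableAt ℝ (oneForm e c) x := fun x hx =>
    differentiableAt_of_contDiffOn hB hθ hx
  have hed : ∀ x ∈ B, ∀ μ, DifferentiableAt ℝ (e μ) x := fun x hx μ =>
    differentiableAt_of_contDiffOn hB (he μ) hx
  have h1 : ∀ x ∈ B, ∀ μ u, fderiv ℝ (oneForm e c) x u (e μ x)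
      = fderiv ℝ (c μ) x u - oneForm e c x (fderiv ℝ (e μ) x u) := fun x hx μ u => by
    have h2 : (fun z => oneForm e c z (e μ z)) =ᶠ[nhds x] c μ := by
      filter_upwards [hB.mem_nhds hx] with z hz using oneForm_frame (hi z hz) μ
    have h3 := ((hθd x hx).hasFDerivAt.clm_apply (hed x hx μ).hasFDerivAt).fderiv
    rw [h2.fderiv_eq] at h3
    rw [h3]
    simp
  -- The hypothesis on commutators is closedness evaluated on frame vectors: the derivatives of the
  -- frame combine into the Lie bracket, and bilinearity extends symmetry to all vectors.
  have h2 : ∀ x ∈ B, ∀ u v, fderiv ℝ (oneForm e c) x u v = fderiv ℝ (oneForm e c) x v u := by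
    intro x hx u v
    have h3 : ∀ μ ν, fderiv ℝ (oneForm e c) x (e μ x) (e ν x)
        = fderiv ℝ (oneForm e c) x (e ν x) (e μ x) := fun μ ν => by
      have h4 := hd x hx μ ν
      have h5 : ∑ κ, commCoeff e μ ν κ x * c κ x
          = oneForm e c x (VectorField.lieBracket ℝ (e μ) (e ν) x) := by
        rw [oneForm_apply]
        exact Finset.sum_congr rfl fun κ _ => mul_comm _ _
      rw [h5, VectorField.lieBracket, map_sub] at h4
      rw [h1 x hx, h1 x hx]
      simp only [frameDeriv] at h4
      linarith
    rw [← sum_frameCoord_smul (hi x hx) u, ← sum_frameCoord_smul (hi x hx) v]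
    simp only [map_sum, map_smul, sum_apply, smul_apply, smul_eq_mul, Finset.mul_sum]
    rw [Finset.sum_comm]
    exact Finset.sum_congr rfl fun _ _ => Finset.sum_congr rfl fun _ _ => by rw [h3]; ring
  obtain ⟨f, hf⟩ := hconv.exists_forall_hasFDerivAt_of_fderiv_symmetric hB
    (fun x hx => (hθd x hx).differentiableWithinAt) h2
  have hf' : ∀ x ∈ B, HasFDerivAt (fun z => f z - f y) (oneForm e c x) x := fun x hx =>
    (hf x hx).sub_const _
  refine ⟨fun z => f z - f y, sub_self _, ?_, fun x hx μ => ?_⟩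
  · rw [contDiffOn_infty_iff_fderiv_of_isOpen hB]
    exact ⟨fun x hx => (hf' x hx).differentiableAt.differentiableWithinAt,
      hθ.congr fun x hx => (hf' x hx).fderiv⟩
  · rw [frameDeriv, (hf' x hx).fderiv, oneForm_frame (hi x hx)]

end Poincare

section LieDerivative

variable {n : ℕ} {e : Fin n → Pt n → Pt n} {g : Pt n → Matrix (Fin n) (Fin n) ℝ} {x : Pt n}
  {f : Fin n → Pt n → ℝ}

theorem hasFDerivAt_sum_smul (he : ∀ μ, DifferentiableAt ℝ (e μ) x)
    (hf : ∀ μ, DifferentiableAt ℝ (f μ) x) :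
    HasFDerivAt (fun y => ∑ κ, f κ y • e κ y)
      (∑ κ, (f κ x • fderiv ℝ (e κ) x + (fderiv ℝ (f κ) x).smulRight (e κ x))) x :=
  HasFDerivAt.fun_sum fun κ _ => (hf κ).hasFDerivAt.fun_smul (he κ).hasFDerivAt

theorem lieBracket_sum_smul (he : ∀ μ, DifferentiableAt ℝ (e μ) x)
    (hf : ∀ μ, DifferentiableAt ℝ (f μ) x) (μ : Fin n) :
    VectorField.lieBracket ℝ (fun y => ∑ κ, f κ y • e κ y) (e μ) x
      = ∑ κ, (f κ x • VectorField.lieBracket ℝ (e κ) (e μ) x - frameDeriv e (f κ) μ x • e κ x) := by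
  simp only [VectorField.lieBracket, (hasFDerivAt_sum_smul he hf).fderiv, sum_apply,
    add_apply, smul_apply, ContinuousLinearMap.smulRight_apply, map_sum, map_smul, frameDeriv,
    ← Finset.sum_sub_distrib]
  exact Finset.sum_congr rfl fun κ _ => by rw [smul_sub]; abel

theorem frameCoord_lieBracket_sum_smul (hi : LinearIndependent ℝ fun μ => e μ x)
    (he : ∀ μ, DifferentiableAt ℝ (e μ) x) (hf : ∀ μ, DifferentiableAt ℝ (f μ) x) (μ ν : Fin n) :
    frameCoord e x (VectorField.lieBracket ℝ (fun y => ∑ κ, f κ y • e κ y) (e μ) x) ν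
      = ∑ κ, f κ x * commCoeff e κ μ ν x - frameDeriv e (f ν) μ x := by
  rw [lieBracket_sum_smul he hf, frameCoord_sum]
  simp only [sub_eq_add_neg, frameCoord_add, frameCoord_smul, ← neg_smul, frameCoord_self hi,
    Finset.sum_add_distrib]
  simp [commCoeff]

theorem lieMetric_sum_smul (hi : LinearIndependent ℝ fun μ => e μ x)
    (he : ∀ μ, DifferentiableAt ℝ (e μ) x) (hf : ∀ μ, DifferentiableAt ℝ (f μ) x) (μ ν : Fin n) :
    lieMetric e g (fun y => ∑ κ, f κ y • e κ y) μ ν x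
      = ∑ κ, f κ x * frameDeriv e (fun y => g y μ ν) κ x
        - ∑ κ, ((∑ l, f l x * commCoeff e l μ κ x - frameDeriv e (f κ) μ x) * g x κ ν
          + (∑ l, f l x * commCoeff e l ν κ x - frameDeriv e (f κ) ν x) * g x μ κ) := by
  simp only [lieMetric, frameCoord_lieBracket_sum_smul hi he hf, map_sum, map_smul, frameDeriv,
    smul_eq_mul]

end LieDerivative

namespace Cosmology

variable {S : SpatialFrame} {n : ℕ} {M : Cosmology S n} {s : ℝ → ℝ}

/-- A Killing field of the conformal spatial metric is a Killing field of a shear-free model. -/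
theorem IsConformallyOrthonormal.exists_killing (hM : M.IsConformallyOrthonormal s)
    {B : Set (Pt 3)} (hB : IsOpen B) (hBU : B ⊆ S.U) {φ : Fin 3 → Pt 3 → ℝ}
    (hφ : ∀ a, ContDiffOn ℝ ∞ (φ a) B)
    (hK : ∀ y ∈ B, ∀ a b, ∑ d, φ d y * commCoeff S.E d a b y - frameDeriv S.E (φ b) a y
      + (∑ d, φ d y * commCoeff S.E d b a y - frameDeriv S.E (φ a) b y) = 0)
    {x₀ : Pt 4} (hx₀ : x₀ 0 ∈ M.I) (hy₀ : Fin.tail x₀ ∈ B) (h0 : ∀ a, φ a (Fin.tail x₀) = 0)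
    {a₀ b₀ : Fin 3} (h1 : frameDeriv S.E (φ b₀) a₀ (Fin.tail x₀) ≠ 0) :
    ∃ V : Set (Pt 4), IsOpen V ∧ x₀ ∈ V ∧ V ⊆ M.region ∧
      ∃ ξ : Pt 4 → Pt 4, ContDiffOn ℝ ∞ ξ V ∧
        (∀ x ∈ V, ∀ μ ν, lieMetric S.e M.g ξ μ ν x = 0) ∧
        (∀ x ∈ V, VectorField.lieBracket ℝ ξ (S.e 0) x = 0) ∧
        ξ x₀ = 0 ∧ fderiv ℝ ξ x₀ ≠ 0 := by
  -- The field is tangent to the sections and independent of time. The factor `s(t)` then multiplies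
  -- the spatial Killing equation, and the bracket with `∂_t` vanishes.
  let f : Fin 4 → Pt 4 → ℝ := Fin.cons (fun _ => 0) fun a x => φ a (Fin.tail x)
  have f0 : ∀ x, f 0 x = 0 := fun _ => rfl
  have fs : ∀ a : Fin 3, f a.succ = fun x => φ a (Fin.tail x) := fun a => rfl
  let V : Set (Pt 4) := {x | x 0 ∈ M.I ∧ Fin.tail x ∈ B}
  have hVo : IsOpen V :=
    (M.isOpen.preimage (continuous_apply 0)).inter (hB.preimage tailL.continuous)
  have hVr : V ⊆ M.region := fun x hx => ⟨hx.1, hBU hx.2⟩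
  have hf : ∀ μ, ContDiffOn ℝ ∞ (f μ) V := by
    refine Fin.cases contDiffOn_const fun a => ?_
    exact (hφ a).comp (t := B) (f := fun x : Pt 4 => tailL x) tailL.contDiff.contDiffOn
      fun x hx => hx.2
  have he : ∀ μ, ContDiffOn ℝ ∞ (S.e μ) V := fun μ =>
    (S.e_contDiffOn μ).mono fun x hx => hBU hx.2
  have hfd : ∀ x ∈ V, ∀ μ, DifferentiableAt ℝ (f μ) x := fun x hx μ =>
    differentiableAt_of_contDiffOn hVo (hf μ) hx
  have hed : ∀ x ∈ V, ∀ μ, DifferentiableAt ℝ (S.e μ) x := fun x hx μ =>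
    differentiableAt_of_contDiffOn hVo (he μ) hx
  have hi : ∀ x ∈ V, LinearIndependent ℝ fun μ => S.e μ x := fun x hx =>
    S.e_linearIndependent (hBU hx.2)
  have f00 : ∀ μ x, frameDeriv S.e (f 0) μ x = 0 := fun μ x => SpatialFrame.frameDeriv_const 0 μ x
  have fs0 : ∀ (a : Fin 3) x, frameDeriv S.e (f a.succ) 0 x = 0 := fun a x =>
    S.frameDeriv_zero_comp_tail (φ a) x
  have fss : ∀ (a b : Fin 3) x,
      frameDeriv S.e (f b.succ) a.succ x = frameDeriv S.E (φ b) a (Fin.tail x) := fun a b x =>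
    S.frameDeriv_succ_comp_tail (φ b) a x
  refine ⟨V, hVo, ⟨hx₀, hy₀⟩, hVr, fun x => ∑ κ, f κ x • S.e κ x,
    ContDiffOn.sum fun κ _ => (hf κ).smul (he κ), fun x hx μ ν => ?_, fun x hx => ?_, ?_, ?_⟩
  · rw [lieMetric_sum_smul (hi x hx) (hed x hx) (hfd x hx)]
    have hxr := hVr hx
    refine Fin.cases ?_ (fun a => ?_) μ <;> refine Fin.cases ?_ (fun b => ?_) ν
    all_goals
      simp only [Fin.sum_univ_succ (n := 3), M.frameDeriv_g_zero_left, M.frameDeriv_g_zero_right,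
        M.frameDeriv_g_succ hxr, hM.g_eq hxr, timeBlock_zero_zero, timeBlock_zero_succ,
        timeBlock_succ_zero, timeBlock_succ_succ, S.commCoeff_zero_left _ _ hxr.2,
        S.commCoeff_zero_right _ _ hxr.2, S.commCoeff_succ_succ_zero _ _ hxr.2,
        S.commCoeff_succ_succ_succ _ _ _ hxr.2, f00, fs0, fss, f0, SpatialFrame.smul_one_apply]
    · simp
    · simp
    · simp
    · have h := hK _ hx.2 a b
      simp only [fs]
      simp [Finset.sum_add_distrib]
      linear_combination (-s (x 0)) * h
  · rw [lieBracket_sum_smul (hed x hx) (hfd x hx)]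
    simp only [Fin.sum_univ_succ (n := 3), f00, fs0, zero_smul]
    have h2 : ∀ a : Fin 3, VectorField.lieBracket ℝ (S.e a.succ) (S.e 0) x = 0 := fun a => by
      rw [VectorField.lieBracket_swap, S.lieBracket_e_zero a (hBU hx.2), neg_zero]
    simp [h2]
  · simp [Fin.sum_univ_succ (n := 3), f0, fs, h0]
  · have hx : x₀ ∈ V := ⟨hx₀, hy₀⟩
    intro hcon
    have h2 := (hasFDerivAt_sum_smul (hed x₀ hx) (hfd x₀ hx)).fderiv
    -- At a zero of the field its derivative is `∑ df^κ ⊗ e_κ`, so one nonzero frame derivative of a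
    -- component suffices.
    have hf0 : ∀ κ, f κ x₀ = 0 := Fin.cases rfl h0
    rw [hcon] at h2
    have h3 := congrArg (fun A : Pt 4 →L[ℝ] Pt 4 => A (S.e a₀.succ x₀)) h2
    simp only [hf0, zero_smul, zero_add, sum_apply, ContinuousLinearMap.smulRight_apply,
      zero_apply] at h3
    have h4 := Fintype.linearIndependent_iff.1 (hi x₀ hx) _ h3.symm b₀.succ
    exact h1 ((fss a₀ b₀ x₀).symm.trans h4)

end Cosmology

end ShearFree

/-! ### Local rotational symmetry and the uniqueness statement. -/

namespace ShearFree

theorem eq_zero_of_mulForm_eq_zero {k n : ℕ} {Λ : Matrix (Fin n) (Fin n) ℝ} (hΛ : Λ.det ≠ 0)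
    {F : (Fin k → Fin n) → ℝ} (h : mulForm Λ F = 0) : F = 0 := by
  induction k with
  | zero =>
    funext J
    have := congrFun h J
    simpa [mulForm, Subsingleton.elim J default] using this
  | succ k ih =>
    have h1 : ∀ J, (fun ν => mulForm Λ (fun K => F (Fin.cons ν K)) J) = 0 := fun J => by
      refine Matrix.eq_zero_of_mulVec_eq_zero hΛ (funext fun μ => ?_)
      have := congrFun h (Fin.cons μ J)
      rw [mulForm_cons] at this
      exact this
    funext J
    have h2 := ih (F := fun K => F (Fin.cons (J 0) K)) (funext fun K => congrFun (h1 K) (J 0))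
    have h3 := congrFun h2 (Fin.tail J)
    simpa using h3

namespace Cosmology

variable {S : SpatialFrame} {n : ℕ} {M : Cosmology S n} {s : ℝ → ℝ} {m : ℝ}

/-- The sections are locally homothetic to `ℝ × H²`, the first frame vector spanning the line. The
required Killing field is the infinitesimal rotation of the hyperbolic plane about the given point,
written in horocyclic coordinates `X`, `Z` centred there. -/
theorem IsConformallyOrthonormal.isLRS (hM : M.IsConformallyOrthonormal s) (hm : m ≠ 0)
    (hC : S.IsBianchi (adaptedConst m)) : M.IsLRS := by
  intro x₀ hx₀
  obtain ⟨r, hr, hrU⟩ := Metric.isOpen_iff.1 S.isOpen _ hx₀.2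
  set B := Metric.ball (Fin.tail x₀) r with hBdef
  have hB : IsOpen B := Metric.isOpen_ball
  have hconv : Convex ℝ B := convex_ball _ _
  have hy₀ : Fin.tail x₀ ∈ B := Metric.mem_ball_self hr
  have he : ∀ a, ContDiffOn ℝ ∞ (S.E a) B := fun a => (S.smooth a).mono hrU
  have hi : ∀ y ∈ B, LinearIndependent ℝ fun a => S.E a y := fun y hy => S.indep y (hrU hy)
  have hD : ∀ y ∈ B, ∀ a b c, commCoeff S.E a b c y = - adaptedConst m a b c := fun y hy =>
    hC y (hrU hy)
  -- `X` is a coordinate along the third frame vector; its differential is closed because no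
  -- commutator has a component in that direction.
  obtain ⟨X, hX0, hX, hdX⟩ := exists_frameDeriv_eq hB hconv he hi
    (c := ![fun _ => 0, fun _ => 0, fun _ => 1])
    (fun a => by fin_cases a <;> exact contDiffOn_const) (fun y hy a b => by
      simp only [hD y hy]
      have h : ∀ c a, frameDeriv S.E (![fun _ => 0, fun _ => 0, fun _ => 1] c) a y = 0 := fun c a => by
        fin_cases c <;> exact SpatialFrame.frameDeriv_const _ _ _
      simp [h, Fin.sum_univ_three, adaptedConst]) (Fin.tail x₀)
  have hXd : ∀ y ∈ B, DifferentiableAt ℝ X y := fun y hy => differentiableAt_of_contDiffOn hB hX hy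
  have hexp : ∀ k : ℝ, ContDiffOn ℝ ∞ (fun y => Real.exp (k * X y)) B := fun k =>
    (contDiffOn_const.mul hX).exp
  have hdexp : ∀ y ∈ B, ∀ (k : ℝ) a, frameDeriv S.E (fun y => Real.exp (k * X y)) a y
      = Real.exp (k * X y) * (k * frameDeriv S.E X a y) := fun y hy k a => by
    rw [frameDeriv, (((hXd y hy).hasFDerivAt.const_mul k).exp).fderiv]
    simp [frameDeriv]
  -- The integrating factor `exp (m X)` makes the dual of the second frame vector exact.
  obtain ⟨Z, hZ0, hZ, hdZ⟩ := exists_frameDeriv_eq hB hconv he hi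
    (c := ![fun _ => 0, fun y => Real.exp (m * X y), fun _ => 0])
    (fun a => by fin_cases a <;> first | exact contDiffOn_const | exact hexp m) (fun y hy a b => by
      simp only [hD y hy]
      have h0 : ∀ a, frameDeriv S.E (fun _ => 0) a y = 0 := fun a =>
        SpatialFrame.frameDeriv_const _ _ _
      have h1 := hdexp y hy m
      fin_cases a <;> fin_cases b <;>
        simp [h0, h1, hdX y hy, Fin.sum_univ_three, adaptedConst] <;> ring) (Fin.tail x₀)
  have hZd : ∀ y ∈ B, DifferentiableAt ℝ Z y := fun y hy => differentiableAt_of_contDiffOn hB hZ hy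
  -- With `Z` as third component, the Killing equations determine the second one up to this
  -- integration; the constants make it vanish at the centre.
  let b : Pt 3 → ℝ := fun y => (1 / 2) * m * (Z y ^ 2 * Real.exp (-m * X y))
    - (1 / (2 * m)) * (Real.exp (m * X y) - Real.exp (-m * X y))
  have hb : ContDiffOn ℝ ∞ b B := (contDiffOn_const.mul ((hZ.pow 2).mul (hexp (-m)))).sub
    (contDiffOn_const.mul ((hexp m).sub (hexp (-m))))
  have hdb : ∀ y ∈ B, ∀ a, frameDeriv S.E b a y = m * Z y * frameDeriv S.E Z a y
      * Real.exp (-m * X y) - (1 / 2) * (m ^ 2 * Z y ^ 2 * Real.exp (-m * X y)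
        + Real.exp (m * X y) + Real.exp (-m * X y)) * frameDeriv S.E X a y := fun y hy a => by
    have e1 := fun k : ℝ => ((hXd y hy).hasFDerivAt.const_mul k).exp
    have e2 := (((((hZd y hy).hasFDerivAt.pow 2).mul (e1 (-m))).const_mul ((1 / 2) * m)).sub
      (((e1 m).sub (e1 (-m))).const_mul (1 / (2 * m))))
    have e3 : fderiv ℝ b y = _ := HasFDerivAt.fderiv e2
    rw [frameDeriv, e3]
    simp [frameDeriv]
    field_simp
    ring
  have hφ0 : ∀ y a, frameDeriv S.E (fun _ => 0) a y = 0 := fun y a =>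
    SpatialFrame.frameDeriv_const _ _ _
  have hXm : ∀ y, Real.exp (-m * X y) * Real.exp (m * X y) = 1 := fun y => by
    rw [← Real.exp_add]; simp
  refine hM.exists_killing hB hrU (φ := ![fun _ => 0, b, Z]) (a₀ := 1) (b₀ := 2) (fun a => ?_)
    (fun y hy a c => ?_) hx₀.1 hy₀ (fun a => ?_) ?_
  · fin_cases a
    · exact contDiffOn_const
    · exact hb
    · exact hZ
  · simp only [hD y hy]
    have h2 := hXm y
    have hbm : b y * m = (1 / 2) * (m ^ 2 * Z y ^ 2 * Real.exp (-m * X y))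
        - (1 / 2) * (Real.exp (m * X y) - Real.exp (-m * X y)) := by
      simp only [b]
      field_simp
    have hb' := hdb y hy
    simp only [neg_mul] at h2 hbm hb'
    clear_value b
    fin_cases a <;> fin_cases c <;>
      simp [hφ0, hb', hdX y hy, hdZ y hy, Fin.sum_univ_three, adaptedConst]
    · linear_combination (-m * Z y) * h2
    · linear_combination -hbm
    · linear_combination -hbm
  · fin_cases a
    · rfl
    · simp [b, hX0, hZ0]
    · exact hZ0
  · have := hdZ _ hy₀ 1
    simp only [Matrix.cons_val] at this ⊢
    rw [this]
    exact (Real.exp_pos _).ne'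

theorem IsLRS.of_changeFrame {L : Matrix (Fin 3) (Fin 3) ℝ} {hL : IsUnit L.det}
    (h : (M.changeFrame L hL).IsLRS) : M.IsLRS := by
  intro x₀ hx₀
  obtain ⟨V, hV, hxV, hVr, ξ, hξ, hK, hu, h0, hd⟩ := h x₀ hx₀
  have hVr' : V ⊆ M.region := hVr
  refine ⟨V, hV, hxV, hVr', ξ, hξ, fun x hx μ ν => ?_, fun x hx => ?_, h0, hd⟩
  · refine eq_zero_of_sum_mul_mul (T := fun μ ν => lieMetric S.e M.g ξ μ ν x)
      (isUnit_timeBlock L hL) (fun α β => ?_) μ ν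
    rw [← M.isRegularOn.lieMetric_mul (isUnit_timeBlock L hL) (hVr' hx), ← changeFrame_g M L hL,
      ← S.changeFrame_e L hL]
    exact hK x hx α β
  · exact hu x hx

/-- A shear-free model in an adapted frame is locally rotationally symmetric of type III. -/
theorem isTracelessLRSBianchiIII_of_adapted {L : Matrix (Fin 3) (Fin 3) ℝ} {hL : IsUnit L.det}
    {C : Fin 3 → Fin 3 → Fin 3 → ℝ} (hC : S.IsBianchi C) (hm : m ≠ 0)
    (hS : (S.changeFrame L hL).IsBianchi (adaptedConst m))
    (hM : (M.changeFrame L hL).IsConformallyOrthonormal s) : M.IsTracelessLRSBianchiIII := by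
  have hb := hC.isBasisChange hL hS
  refine ⟨⟨C, hC, hb.isTypeIII hL (isTypeIII_adaptedConst hm), fun t ht => ?_⟩,
    (hM.isLRS hm hS).of_changeFrame⟩
  have h1 := hb.sum_mul_behrN (h := M.h t) (M.h_symm ht)
  have h2 : L * M.h t * Lᵀ = s t • 1 := hM.h_eq t ht
  simp only [h2, SpatialFrame.smul_one_apply] at h1
  simp only [ite_mul, zero_mul, Finset.sum_ite_eq, Finset.mem_univ, if_true, ← Finset.mul_sum,
    sum_behrN_adaptedConst, mul_zero] at h1
  exact (mul_eq_zero.1 h1.symm).resolve_left hL.ne_zero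

theorem IsShearFreeSolution.isTracelessLRSBianchiIII (hS : M.IsShearFreeSolution)
    (hpos : ∀ (L : Matrix (Fin 3) (Fin 3) ℝ) (hL : IsUnit L.det),
      (M.changeFrame L hL).HasPositiveEnergy) : M.IsTracelessLRSBianchiIII := by
  obtain ⟨hhom, hmod⟩ := M.isShearFreeSolution_iff.1 hS
  rcases hhom with ⟨C, hC⟩ | ⟨hKS, A, B, hAB⟩
  · obtain ⟨L, hL, m, s, hm, hL', hs⟩ := hmod.exists_adapted hpos hC
    exact isTracelessLRSBianchiIII_of_adapted hC hm hL' hs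
  · exact (hmod.not_isKantowskiSachs hpos hKS hAB).elim

theorem HamiltoniansBoundedBelow.hasPositiveEnergy (hM : M.HamiltoniansBoundedBelow) :
    M.HasPositiveEnergy := fun i =>
  Or.inl (((hamiltonianBoundedBelow_iff (M.field i).p_le _).1 (hM i)).lt_of_ne'
    (M.field i).α_ne_zero)

theorem HasPositiveEnergy.changeFrame (hM : M.HasPositiveEnergy) (L : Matrix (Fin 3) (Fin 3) ℝ)
    (hL : IsUnit L.det) : (M.changeFrame L hL).HasPositiveEnergy := fun i => by
  refine (hM i).imp_right (Or.imp_left fun h t ht => funext fun J => ?_)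
  have h0 : mulForm (timeBlock 1 L) ((M.field i).F t) = 0 := by
    rw [h t ht]
    exact funext mulForm_zero
  exact congrFun h0 J

theorem HasPositiveEnergy.of_changeFrame {L : Matrix (Fin 3) (Fin 3) ℝ} (hL : IsUnit L.det)
    (hM : (M.changeFrame L hL).HasPositiveEnergy) : M.HasPositiveEnergy := fun i => by
  refine (hM i).imp_right (Or.imp_left fun h t ht => ?_)
  exact eq_zero_of_mulForm_eq_zero (isUnit_timeBlock L hL).ne_zero (h t ht)

/-- A shear-free solution whose gauge fields have non-negative energy density. -/
theorem IsShearFreeSolution.hasPositiveEnergy (hS : M.IsShearFreeSolution)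
    (h : ∀ i, ∀ x ∈ M.region, 0 ≤ M.fieldEMT i 0 0 x) : M.HasPositiveEnergy := by
  obtain ⟨s, k, L, -, -, -, hL, hs⟩ := M.exists_isConformallyOrthonormal hS.shear_eq_zero
  have hu : IsUnit L.det :=
    Matrix.isUnit_det_of_right_inverse (B := k * Lᵀ) (by rw [← Matrix.mul_assoc, hL])
  refine ((hs L hu hL).hasPositiveEnergy fun i x hx => ?_).of_changeFrame hu
  rw [changeFrame_fieldEMT_zero_zero]
  exact h i x hx

end Cosmology

end ShearFree

/-! ### Adapted orthonormal bases of type III algebras with traceless `N`. -/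

namespace ShearFree

section AdaptedBasis

variable {C : Fin 3 → Fin 3 → Fin 3 → ℝ}

theorem isBasisChange_adaptedConst_diagonal (m : ℝ) (d : Fin 3 → ℝ) :
    IsBasisChange (adaptedConst m) (adaptedConst (m * d 2)) (Matrix.diagonal d) := by
  intro a b c
  fin_cases a <;> fin_cases b <;> fin_cases c <;>
    simp [Fin.sum_univ_three, adaptedConst, Matrix.diagonal_apply] <;> ring

/-- The first two rows span the centre and the derived algebra. Adding multiples of them to the
third vector changes no bracket, which leaves `κ` and `l` free for orthogonalisation. -/
theorem isBasisChange_behrConst (κ l : ℝ) :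
    IsBasisChange (behrConst (Matrix.diagonal ![0, 1, -1]) ![1, 0, 0]) (adaptedConst (-2))
      !![0, 1, 1; 0, 1, -1; 1, -κ - l, l - κ] := by
  intro a b c
  fin_cases a <;> fin_cases b <;> fin_cases c <;>
    simp [Fin.sum_univ_three, adaptedConst, behrConst, eps, Matrix.det_fin_three] <;> ring

theorem behrN_behrConst (f d : Fin 3) :
    behrN (behrConst (Matrix.diagonal ![0, 1, -1]) ![1, 0, 0]) f d
      = Matrix.diagonal ![0, 1, -1] f d := by
  fin_cases f <;> fin_cases d <;>
    simp [Fin.sum_univ_three, behrN, behrConst, eps, Matrix.det_fin_three] <;> norm_num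

theorem posDef_mul_mul_transpose {L k : Matrix (Fin 3) (Fin 3) ℝ} (hk : k.PosDef)
    (hL : IsUnit L.det) : (L * k * Lᵀ).PosDef := by
  simpa using hk.mul_mul_conjTranspose_same (B := L)
    (Matrix.vecMul_injective_of_isUnit ((Matrix.isUnit_iff_isUnit_det L).2 hL))

/-- A type III algebra with traceless `N` has an adapted orthonormal basis. -/
theorem exists_adapted_basis (hC : IsTypeIII C) {k : Matrix (Fin 3) (Fin 3) ℝ} (hk : k.PosDef)
    (htr : ∑ a, ∑ b, k a b * behrN C a b = 0) :
    ∃ (L : Matrix (Fin 3) (Fin 3) ℝ) (m : ℝ), IsUnit L.det ∧ m ≠ 0 ∧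
      IsBasisChange C (adaptedConst m) L ∧ L * k * Lᵀ = 1 := by
  obtain ⟨M, hM, hMC⟩ := isTypeIII_iff.1 hC
  have hsymm : ∀ {A : Matrix (Fin 3) (Fin 3) ℝ}, A.PosDef → ∀ a b, A a b = A b a :=
    fun hA a b => by simpa using (hA.isHermitian.apply a b).symm
  set h := M * k * Mᵀ with hh
  have hpos : h.PosDef := posDef_mul_mul_transpose hk hM
  have hs := hsymm hpos
  have h11 : h 1 1 = h 2 2 := by
    have h1 := hMC.sum_mul_behrN (h := k) (hsymm hk)
    rw [htr, mul_zero, ← hh] at h1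
    simp [behrN_behrConst, Fin.sum_univ_three, Matrix.diagonal_apply] at h1
    linarith
  -- Gram–Schmidt coefficients making the third basis vector orthogonal to the first two. Those two
  -- are orthogonal to each other because `N^a_a = 0` reads `h 1 1 = h 2 2`.
  set κ := (h 0 1 + h 0 2) / (h 1 1 + h 2 2 + 2 * h 1 2) with hκ
  set l := (h 0 1 - h 0 2) / (h 1 1 + h 2 2 - 2 * h 1 2) with hl
  set A : Matrix (Fin 3) (Fin 3) ℝ := !![0, 1, 1; 0, 1, -1; 1, -κ - l, l - κ] with hA
  have hAdet : IsUnit A.det := by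
    rw [isUnit_iff_ne_zero, hA, Matrix.det_fin_three]
    simp
    norm_num
  have hApos := posDef_mul_mul_transpose hpos hAdet
  have hApp : ∀ a b, (A * h * Aᵀ) a b = ∑ i, ∑ j, A a i * A b j * h i j := fun a b =>
    mulMetric_apply (Λ := A) (g := fun _ : Pt 3 => h) 0 a b
  have hAs := hsymm hApos
  have hA00 : (A * h * Aᵀ) 0 0 = h 1 1 + h 2 2 + 2 * h 1 2 := by
    rw [hApp]; simp [hA, Fin.sum_univ_three, hs 2 1]; ring
  have hA11 : (A * h * Aᵀ) 1 1 = h 1 1 + h 2 2 - 2 * h 1 2 := by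
    rw [hApp]; simp [hA, Fin.sum_univ_three, hs 2 1]; ring
  have hA01 : (A * h * Aᵀ) 0 1 = 0 := by
    rw [hApp]; simp [hA, Fin.sum_univ_three, hs 2 1]; linarith
  have hk0 : 0 < h 1 1 + h 2 2 + 2 * h 1 2 := hA00 ▸ hApos.diag_pos
  have hl0 : 0 < h 1 1 + h 2 2 - 2 * h 1 2 := hA11 ▸ hApos.diag_pos
  have hκ' : κ * (h 1 1 + h 2 2 + 2 * h 1 2) = h 0 1 + h 0 2 := div_mul_cancel₀ _ hk0.ne'
  have hl' : l * (h 1 1 + h 2 2 - 2 * h 1 2) = h 0 1 - h 0 2 := div_mul_cancel₀ _ hl0.ne'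
  have hA02 : (A * h * Aᵀ) 0 2 = 0 := by
    rw [hApp]; simp [hA, Fin.sum_univ_three, hs 2 1, hs 1 0, hs 2 0]
    linear_combination -hκ' - l * h11
  have hA12 : (A * h * Aᵀ) 1 2 = 0 := by
    rw [hApp]; simp [hA, Fin.sum_univ_three, hs 2 1, hs 1 0, hs 2 0]
    linear_combination -hl' - κ * h11
  set d : Fin 3 → ℝ := fun a => (Real.sqrt ((A * h * Aᵀ) a a))⁻¹ with hd
  have hd0 : ∀ a, 0 < d a := fun a => inv_pos.2 (Real.sqrt_pos.2 hApos.diag_pos)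
  have hD : IsUnit (Matrix.diagonal d).det := by
    rw [Matrix.det_diagonal, isUnit_iff_ne_zero]
    exact Finset.prod_ne_zero_iff.2 fun a _ => (hd0 a).ne'
  refine ⟨Matrix.diagonal d * (A * M), -2 * d 2, ?_, ?_, ?_, ?_⟩
  · rw [Matrix.det_mul, Matrix.det_mul]
    exact hD.mul (hAdet.mul hM)
  · exact mul_ne_zero (by norm_num) (hd0 2).ne'
  · exact (hMC.trans (isBasisChange_behrConst κ l)).trans (isBasisChange_adaptedConst_diagonal _ d)
  · have h1 : Matrix.diagonal d * (A * M) * k * (Matrix.diagonal d * (A * M))ᵀ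
        = Matrix.diagonal d * (A * h * Aᵀ) * Matrix.diagonal d := by
      simp only [hh, Matrix.transpose_mul, Matrix.diagonal_transpose, Matrix.mul_assoc]
    rw [h1]
    have hdd : ∀ a, d a * (A * h * Aᵀ) a a * d a = 1 := fun a => by
      have h2 : 0 < (A * h * Aᵀ) a a := hApos.diag_pos
      have h3 := Real.mul_self_sqrt h2.le
      have h4 := (Real.sqrt_pos.2 h2).ne'
      simp only [hd]
      field_simp
      rw [sq, h3]
    ext a b
    rw [Matrix.mul_diagonal, Matrix.diagonal_mul]
    rcases eq_or_ne a b with rfl | hab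
    · rw [hdd, Matrix.one_apply_eq]
    · rw [Matrix.one_apply_ne hab]
      have h2 : (A * h * Aᵀ) a b = 0 := by
        have e1 := hAs 1 0
        have e2 := hAs 2 0
        have e3 := hAs 2 1
        rw [hA01] at e1
        rw [hA02] at e2
        rw [hA12] at e3
        fin_cases a <;> fin_cases b <;> first | exact (hab rfl).elim | assumption
      rw [h2, mul_zero, zero_mul]

end AdaptedBasis

end ShearFree

/-! ### Explicit shear-free solutions with scalar fields. -/

namespace ShearFree

/-- The constant one-form `c W¹`. -/
def gradientForm (c : ℝ) (J : Fin 1 → Fin 4) : ℝ := if J 0 = 1 then c else 0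

theorem gradientForm_isAlternating (c : ℝ) : IsAlternating (gradientForm c) := by
  intro I σ
  rw [Subsingleton.elim σ 1]
  simp

theorem gradientForm_zero (c : ℝ) : gradientForm c ![0] = 0 := by
  simp [gradientForm]

theorem gradientForm_succ (c : ℝ) (a : Fin 3) :
    gradientForm c ![a.succ] = if a = 0 then c else 0 := by
  fin_cases a <;> simp [gradientForm, Fin.ext_iff]

/-- A scalar field with constant spatial gradient along the first vector of the frame. -/
def gradientField (c : ℝ) : GaugeField where
  p := 0
  p_le := Nat.zero_le 3
  α := 1
  α_ne_zero := one_ne_zero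
  F _ := gradientForm c

theorem contDiffOn_div_sq (c : ℝ) : ContDiffOn ℝ ∞ (fun t : ℝ => c / t ^ 2) (Set.Ioi 0) :=
  ContDiffOn.div contDiffOn_const (contDiff_id.pow 2).contDiffOn
    fun _ ht => pow_ne_zero 2 (Set.mem_Ioi.1 ht).ne'

/-- A collection of `n` scalar fields with equal spatial gradient along the first vector of an
orthonormal frame, with the perfect fluid that makes the scale factor linear in time. -/
def scalarModel (S : SpatialFrame) (n : ℕ) (m : ℝ) : Cosmology S n where
  I := Set.Ioi 0
  h t := t ^ 2 • 1
  -- The `n` equal fields share the total squared gradient `m ^ 2`, which balances the curvature of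
  -- the hyperbolic factor.
  field _ := gradientField (m / Real.sqrt n)
  m := 1
  -- Fixed by the Friedmann equation with `H = 1 / t`, spatial curvature scalar `-2 m ^ 2 / t ^ 2`
  -- and scalar energy density `m ^ 2 / (2 t ^ 2)`. Since `ρ + 3P = 0`, the fluid scales as `t ^
  -- (-2)` too.
  ρ _ t := (3 - 3 / 2 * m ^ 2) / t ^ 2
  P _ t := (1 / 2 * m ^ 2 - 1) / t ^ 2
  isOpen := isOpen_Ioi
  isConnected := isConnected_Ioi
  h_posDef t ht := Matrix.PosDef.one.smul (pow_pos ht 2)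
  h_smooth a b := by
    simp only [SpatialFrame.smul_one_apply]
    split_ifs
    · exact (contDiff_id.pow 2).contDiffOn
    · exact contDiffOn_const
  F_alternating _ _ _ := gradientForm_isAlternating _
  F_smooth i J := contDiffOn_const
  ρ_smooth _ := contDiffOn_div_sq _
  P_smooth _ := contDiffOn_div_sq _

namespace scalarModel

variable {S : SpatialFrame} {n : ℕ} {m : ℝ}

theorem isConformallyOrthonormal :
    (scalarModel S n m).IsConformallyOrthonormal fun t => t ^ 2 where
  smooth := (contDiff_id.pow 2).contDiffOn
  pos _ ht := pow_pos ht 2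
  h_eq _ _ := rfl

theorem ricci_eq (hS : S.IsBianchi (adaptedConst m)) {y : Pt 3} (hy : y ∈ S.U) (a b : Fin 3) :
    ricci S.E (fun _ => 1) a b y = Matrix.diagonal ![0, -m ^ 2, -m ^ 2] a b := by
  rw [hS.ricci_eq hy]
  fin_cases a <;> fin_cases b <;> simp [Fin.sum_univ_three, SpatialFrame.structConn, adaptedConst] <;> ring

theorem deriv_sq : deriv (fun t : ℝ => t ^ 2) = fun t => 2 * t := by
  funext t
  simp

theorem fieldEMT_succ_succ {x : Pt 4} (hx : x ∈ (scalarModel S n m).region) (i : Fin n)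
    (a b : Fin 3) : (scalarModel S n m).fieldEMT i a.succ b.succ x
      = m ^ 2 / n * ((if a = 0 ∧ b = 0 then 1 else 0) - 1 / 2 * if a = b then 1 else 0) := by
  have ht : x 0 ≠ 0 := (Set.mem_Ioi.1 hx.1).ne'
  rw [Cosmology.fieldEMT]
  refine (isConformallyOrthonormal.emt_zero (α := 1) hx (gradientForm (m / Real.sqrt n)) _ _).trans ?_
  have hn : (m / Real.sqrt n) ^ 2 = m ^ 2 / n := by
    rw [div_pow, Real.sq_sqrt (Nat.cast_nonneg n)]
  rw [isConformallyOrthonormal.g_eq hx, timeBlock_succ_succ, SpatialFrame.smul_one_apply]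
  simp only [gradientForm_zero, gradientForm_succ, Fin.sum_univ_three]
  fin_cases a <;> fin_cases b <;> simp [← hn] <;> field_simp

theorem fieldEMT_zero_zero {x : Pt 4} (hx : x ∈ (scalarModel S n m).region) (i : Fin n) :
    (scalarModel S n m).fieldEMT i 0 0 x = 1 / 2 * (m ^ 2 / n) / x 0 ^ 2 := by
  have hn : (m / Real.sqrt n) ^ 2 = m ^ 2 / n := by
    rw [div_pow, Real.sq_sqrt (Nat.cast_nonneg n)]
  rw [Cosmology.fieldEMT]
  refine (isConformallyOrthonormal.emt_zero (α := 1) hx (gradientForm (m / Real.sqrt n)) _ _).trans ?_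
  rw [isConformallyOrthonormal.g_eq hx, timeBlock_zero_zero]
  simp only [gradientForm_zero, gradientForm_succ, Fin.sum_univ_three]
  simp [← hn]
  ring

theorem fieldEMT_zero_succ {x : Pt 4} (hx : x ∈ (scalarModel S n m).region) (i : Fin n)
    (a : Fin 3) : (scalarModel S n m).fieldEMT i 0 a.succ x = 0 := by
  rw [Cosmology.fieldEMT]
  refine (isConformallyOrthonormal.emt_zero (α := 1) hx (gradientForm (m / Real.sqrt n)) _ _).trans ?_
  rw [isConformallyOrthonormal.g_eq hx, timeBlock_zero_succ]
  simp [gradientForm_zero]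

theorem fieldEMT_succ_zero {x : Pt 4} (hx : x ∈ (scalarModel S n m).region) (i : Fin n)
    (a : Fin 3) : (scalarModel S n m).fieldEMT i a.succ 0 x = 0 := by
  rw [Cosmology.fieldEMT]
  refine (isConformallyOrthonormal.emt_zero (α := 1) hx (gradientForm (m / Real.sqrt n)) _ _).trans ?_
  rw [isConformallyOrthonormal.g_eq hx, timeBlock_succ_zero]
  simp [gradientForm_zero]

theorem hubble_eq {x : Pt 4} (hx : x ∈ (scalarModel S n m).region) :
    (scalarModel S n m).hubble x = 1 / x 0 := by
  have ht : x 0 ≠ 0 := (Set.mem_Ioi.1 hx.1).ne'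
  rw [isConformallyOrthonormal.hubble_eq hx, deriv_sq]
  field_simp

theorem hubbleDeriv_eq (t : ℝ) : Cosmology.IsConformallyOrthonormal.hubbleDeriv (fun t => t ^ 2) t = -1 / t ^ 2 := by
  rw [Cosmology.IsConformallyOrthonormal.hubbleDeriv, deriv_sq]
  have h : (fun t : ℝ => 2 * t / (2 * t ^ 2)) = fun t => t⁻¹ := by
    funext t
    rcases eq_or_ne t 0 with rfl | h
    · simp
    · field_simp
  rw [h, deriv_inv]
  ring

theorem totalρ_eq : (scalarModel S n m).totalρ = fun t => (3 - 3 / 2 * m ^ 2) / t ^ 2 := by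
  funext t
  exact Fin.sum_univ_one _

theorem totalP_eq : (scalarModel S n m).totalP = fun t => (1 / 2 * m ^ 2 - 1) / t ^ 2 := by
  funext t
  exact Fin.sum_univ_one _

theorem isHarmonic (hS : S.IsBianchi (adaptedConst m)) {y : Pt 3} (hy : y ∈ S.U) :
    (∀ a b, commCoeff S.E a b 0 y = 0) ∧ S.commTrace 0 y = 0 := by
  constructor
  · intro a b
    rw [hS y hy]
    simp [adaptedConst]
  · simp [SpatialFrame.commTrace, hS y hy, adaptedConst, Fin.sum_univ_three]

/-- The Ricci components `diag(0, -m², -m²)` and the gradient stress `diag(m², 0, 0)` differ by a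
multiple of the unit matrix, so the anisotropic equations hold and the fluid accounts for the
isotropic ones. The gradient is harmonic because the first frame vector is central and orthogonal to
the derived algebra. -/
theorem isShearFreeModel (hn : n ≠ 0) (hm : m ≠ 0) (hS : S.IsBianchi (adaptedConst m)) :
    (scalarModel S n m).IsShearFreeModel := by
  have hM := isConformallyOrthonormal (S := S) (n := n) (m := m)
  obtain ⟨y₀, hy₀⟩ := S.isConnected.nonempty
  have hF : ∀ J : Fin 1 → Fin 4, ContDiffOn ℝ ∞ (fun _ : ℝ => gradientForm (m / Real.sqrt n) J)
      (scalarModel S n m).I := fun J => contDiffOn_const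
  have hn' : (n : ℝ) ≠ 0 := Nat.cast_ne_zero.2 hn
  refine ⟨?_, fun x hx => hM.shear_eq_zero hx, ?_, fun i x hx J => ?_, fun i x hx J => ?_,
    fun i x hx a => fieldEMT_zero_succ hx i a, fun x hx => ?_, fun x hx μ ν => ?_⟩
  · refine ⟨1, Set.mem_Ioi.2 one_pos, y₀, hy₀, 0, 0, ?_⟩
    have h : (scalarModel S n m).h 1 = 1 := by simp [scalarModel]
    simp [Cosmology.tracelessRicci, scalarCurv, h, ricci_eq hS hy₀, Fin.sum_univ_three,
      Matrix.one_apply]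
    ring_nf
    simpa using hm
  · refine ⟨Fin.cons 1 y₀, Cosmology.mem_region (M := scalarModel S n m) (Set.mem_Ioi.2 one_pos) hy₀, ?_⟩
    rw [hubble_eq (Cosmology.mem_region (M := scalarModel S n m) (Set.mem_Ioi.2 one_pos) hy₀)]
    simp
  · have h1 : ∀ a : Fin 3, extD S.e (scalarModel S n m).g ((scalarModel S n m).fieldStrength i)
        ![0, a.succ] x = 0 := fun a => by
      refine (hM.extD_zero_form_time hF hx a).trans ?_
      simp
    have h2 : ∀ a b : Fin 3, extD S.e (scalarModel S n m).g ((scalarModel S n m).fieldStrength i)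
        ![a.succ, b.succ] x = 0 := fun a b => by
      refine (hM.extD_zero_form hF hx a b).trans ?_
      simp [gradientForm_zero, gradientForm_succ, Fin.sum_univ_three, (isHarmonic hS hx.2).1]
    have h3 : ∀ a b, extD S.e (scalarModel S n m).g ((scalarModel S n m).fieldStrength i) ![a, b] x
        = - extD S.e (scalarModel S n m).g ((scalarModel S n m).fieldStrength i) ![b, a] x :=
      fun a b => by
        refine (extD_one _ _ _).trans (Eq.trans ?_ (congrArg Neg.neg (extD_one _ _ _)).symm)
        ring
    have h4 : ∀ a b, extD S.e (scalarModel S n m).g ((scalarModel S n m).fieldStrength i)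
        ![a, b] x = 0 := fun a b => by
      refine Fin.cases (Fin.cases ?_ (fun b => h1 b) b) (fun a => Fin.cases ?_ (fun b => h2 a b) b) a
      · have := h3 0 0
        linarith
      · rw [h3, h1, neg_zero]
    have h5 : J = ![J 0, J 1] := by
      funext k
      fin_cases k <;> rfl
    rw [h5]
    exact h4 _ _
  · have h1 : J = (![] : Fin 0 → Fin 4) := Subsingleton.elim (α := Fin 0 → Fin 4) _ _
    rw [h1]
    refine (hM.diverg_zero_form hF hx).trans ?_
    simp [gradientForm_zero, gradientForm_succ, Fin.sum_univ_three, (isHarmonic hS hx.2).2]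
  · rw [totalρ_eq, totalP_eq, hubble_eq hx]
    have ht : x 0 ≠ 0 := (Set.mem_Ioi.1 hx.1).ne'
    have hd : HasDerivAt (fun t : ℝ => (3 - 3 / 2 * m ^ 2) / t ^ 2)
        (-(2 * (3 - 3 / 2 * m ^ 2)) / x 0 ^ 3) (x 0) := by
      refine ((hasDerivAt_const (x 0) (3 - 3 / 2 * m ^ 2)).div (hasDerivAt_pow 2 (x 0))
        (pow_ne_zero 2 ht)).congr_deriv ?_
      field_simp
      ring
    rw [hd.deriv]
    field_simp
    ring
  · have ht : x 0 ≠ 0 := (Set.mem_Ioi.1 hx.1).ne'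
    have hm2 : (n : ℝ) * (m ^ 2 / n) = m ^ 2 := by field_simp
    have hR : scalarCurv S.e (scalarModel S n m).g x = (6 - 2 * m ^ 2) / x 0 ^ 2 := by
      simp only [scalarCurv, hM.g_inv_diag hx, Matrix.diagonal_apply, ite_mul, zero_mul,
        Finset.sum_ite_eq, Finset.mem_univ, if_true]
      rw [Fin.sum_univ_succ]
      simp only [hM.ricci_zero_zero hx, hM.ricci_succ_succ hx, hubbleDeriv_eq,
        deriv_sq, ricci_eq hS hx.2, Fin.sum_univ_three, Fin.cons_zero, Fin.cons_succ]
      simp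
      field_simp
      ring
    rw [einstein, hR, totalρ_eq, totalP_eq, Cosmology.proj, hM.g_eq hx]
    refine Fin.cases ?_ (fun a => ?_) μ <;> refine Fin.cases ?_ (fun b => ?_) ν
    · simp only [hM.ricci_zero_zero hx, hubbleDeriv_eq, deriv_sq,
        fieldEMT_zero_zero hx, Finset.sum_const, Finset.card_univ, Fintype.card_fin, nsmul_eq_mul,
        timeBlock_zero_zero, Cosmology.uLower, if_true]
      field_simp
      ring
    · simp [hM.ricci_zero_succ hx, fieldEMT_zero_succ hx, Cosmology.uLower, Fin.succ_ne_zero]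
    · simp [hM.ricci_succ_zero hx, fieldEMT_succ_zero hx, Cosmology.uLower, Fin.succ_ne_zero]
    · simp only [hM.ricci_succ_succ hx, ricci_eq hS hx.2, deriv_sq, fieldEMT_succ_succ hx,
        Finset.sum_const, Finset.card_univ, Fintype.card_fin, nsmul_eq_mul, timeBlock_succ_succ,
        SpatialFrame.smul_one_apply, Cosmology.uLower, Fin.succ_ne_zero, if_false, ← mul_assoc, hm2]
      fin_cases a <;> fin_cases b <;> simp <;> field_simp <;> ring

end scalarModel

end ShearFree

/-! ### Existence on every type III geometry with traceless `N`, and existence of such geometries.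
-/

namespace ShearFree

/-- Existence of shear-free solutions on a type III geometry with traceless `N`. -/
theorem exists_shearFreeSolution {S : SpatialFrame} {C : Fin 3 → Fin 3 → Fin 3 → ℝ}
    {k : Matrix (Fin 3) (Fin 3) ℝ} {n : ℕ} (hn : 1 ≤ n) (hS : S.IsBianchi C) (hC : IsTypeIII C)
    (hk : k.PosDef) (htr : ∑ a, ∑ b, k a b * behrN C a b = 0) :
    ∃ M : Cosmology S n, M.IsShearFreeSolution ∧ M.HamiltoniansBoundedBelow ∧
      (∃ a : ℝ → ℝ, ∀ t ∈ M.I, 0 < a t ∧ M.h t = a t ^ 2 • k) ∧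
      ∀ i, ∀ t ∈ M.I, (M.field i).F t ≠ 0 := by
  obtain ⟨L, m, hL, hm, hLC, hLk⟩ := exists_adapted_basis hC hk htr
  have hn0 : n ≠ 0 := Nat.one_le_iff_ne_zero.1 hn
  have hS' := hS.changeFrame hL hLC
  have hL' : IsUnit (L⁻¹).det := Matrix.isUnit_nonsing_inv_det _ hL
  suffices h : ∃ M : Cosmology S n, M.IsShearFreeModel ∧ M.HamiltoniansBoundedBelow ∧
      (∃ a : ℝ → ℝ, ∀ t ∈ M.I, 0 < a t ∧ M.h t = a t ^ 2 • k) ∧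
      ∀ i, ∀ t ∈ M.I, (M.field i).F t ≠ 0 by
    obtain ⟨M, h1, h2, h3, h4⟩ := h
    exact ⟨M, M.isShearFreeSolution_iff.2 ⟨Or.inl ⟨C, hS⟩, h1⟩, h2, h3, h4⟩
  -- The frame `S` is regarded as the inverse change of the adapted frame, so that the explicit
  -- solution can be carried back. Homogeneity was settled before, as it refers to `S` itself.
  rw [← S.changeFrame_changeFrame_inv L hL hL']
  have hM := scalarModel.isShearFreeModel hn0 hm hS'
  refine ⟨(scalarModel (S.changeFrame L hL) n m).changeFrame L⁻¹ hL', hM.changeFrame L⁻¹ hL',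
    fun i => (hamiltonianBoundedBelow_iff (Nat.zero_le 3) 1).2 zero_le_one,
    ⟨fun t => t, fun t ht => ⟨ht, ?_⟩⟩, fun i t ht hF => ?_⟩
  · change L⁻¹ * (t ^ 2 • (1 : Matrix (Fin 3) (Fin 3) ℝ)) * (L⁻¹)ᵀ = t ^ 2 • k
    have hLt : IsUnit (Lᵀ).det := by rwa [Matrix.det_transpose]
    rw [← hLk, Matrix.mul_smul, Matrix.smul_mul, Matrix.transpose_nonsing_inv]
    simp only [Matrix.mul_assoc, Matrix.mul_nonsing_inv _ hLt, Matrix.mul_one]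
    rw [← Matrix.mul_assoc, Matrix.nonsing_inv_mul _ hL, Matrix.one_mul]
  · have h0 : gradientForm (m / Real.sqrt n) = 0 :=
      eq_zero_of_mulForm_eq_zero (Cosmology.isUnit_timeBlock _ hL').ne_zero hF
    have h1 := congrFun h0 ![1]
    simp only [gradientForm, Matrix.cons_val_zero, if_true, Pi.zero_apply] at h1
    exact div_ne_zero hm (Real.sqrt_ne_zero'.2 (Nat.cast_pos.2 (Nat.pos_of_ne_zero hn0))) h1

/-- A frame on `ℝ × H²`. -/
def productFrame : SpatialFrame where
  U := Set.univ
  isOpen := isOpen_univ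
  isConnected := isConnected_univ
  E a y := ![Pi.single 0 1, Real.exp (y 2) • Pi.single 1 1, Pi.single 2 1] a
  smooth a := by
    have h : ContDiffOn ℝ ∞ (fun y : Pt 3 => Real.exp (y 2) • (Pi.single 1 1 : Pt 3)) Set.univ :=
      ((Real.contDiff_exp.comp (contDiff_apply ℝ ℝ (2 : Fin 3))).smul contDiff_const).contDiffOn
    fin_cases a
    · exact contDiffOn_const
    · exact h
    · exact contDiffOn_const
  indep y _ := by
    rw [Fintype.linearIndependent_iff]
    intro c hc
    have h0 := congrFun hc 0
    have h1 := congrFun hc 1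
    have h2 := congrFun hc 2
    simp [Fin.sum_univ_three] at h0 h1 h2
    intro i
    fin_cases i <;> assumption

theorem productFrame_isBianchi : productFrame.IsBianchi (adaptedConst 1) := by
  intro y hy a b c
  have hE0 : fderiv ℝ (productFrame.E 0) y = 0 := (hasFDerivAt_const (Pi.single 0 1 : Pt 3) y).fderiv
  have hE2 : fderiv ℝ (productFrame.E 2) y = 0 := (hasFDerivAt_const (Pi.single 2 1 : Pt 3) y).fderiv
  have hE1 : ∀ v, fderiv ℝ (productFrame.E 1) y v = v 2 • productFrame.E 1 y := fun v => by
    have h : HasFDerivAt (fun y : Pt 3 => Real.exp (y 2) • (Pi.single 1 1 : Pt 3)) _ y :=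
      ((hasFDerivAt_apply (2 : Fin 3) y).exp).smul_const (Pi.single 1 1 : Pt 3)
    have h2 : fderiv ℝ (productFrame.E 1) y = _ := h.fderiv
    rw [h2]
    simp [productFrame, smul_smul, mul_comm]
  refine (frameCoord_eq (productFrame.indep y hy) (c := fun c => - adaptedConst 1 a b c) ?_ c)
  rw [Fin.sum_univ_three]
  fin_cases a <;> fin_cases b <;>
    simp [VectorField.lieBracket, hE0, hE1, hE2, adaptedConst] <;> simp [productFrame]

end ShearFree

end

theorem theorem3 :
    -- uniqueness
    (∀ (S : ShearFree.SpatialFrame) (n : ℕ) (M : ShearFree.Cosmology S n),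
      M.IsShearFreeSolution → M.HamiltoniansBoundedBelow → M.IsTracelessLRSBianchiIII) ∧
    -- every Bianchi type III geometry with traceless `N` admits such solutions, for each `n ≥ 1`
    (∀ (S : ShearFree.SpatialFrame) (C : Fin 3 → Fin 3 → Fin 3 → ℝ)
      (h₀ : Matrix (Fin 3) (Fin 3) ℝ) (n : ℕ), 1 ≤ n →
      S.IsBianchi C → ShearFree.IsTypeIII C → h₀.PosDef →
      ∑ a, ∑ b, h₀ a b * ShearFree.behrN C a b = 0 →
      ∃ M : ShearFree.Cosmology S n, M.IsShearFreeSolution ∧ M.HamiltoniansBoundedBelow ∧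
        (∃ a : ℝ → ℝ, ∀ t ∈ M.I, 0 < a t ∧ M.h t = a t ^ 2 • h₀) ∧
        ∀ i, ∀ t ∈ M.I, (M.field i).F t ≠ 0) ∧
    -- such geometries exist
    (∃ (S : ShearFree.SpatialFrame) (C : Fin 3 → Fin 3 → Fin 3 → ℝ)
      (h₀ : Matrix (Fin 3) (Fin 3) ℝ), S.IsBianchi C ∧ ShearFree.IsTypeIII C ∧ h₀.PosDef ∧
      ∑ a, ∑ b, h₀ a b * ShearFree.behrN C a b = 0) ∧
    -- boundedness of the Hamiltonian is equivalent to the weak energy condition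
    (∀ (p : ℕ) (α : ℝ), p ≤ 3 →
      (ShearFree.HamiltonianBoundedBelow p α ↔ ShearFree.WeakEnergyCondition p α)) ∧
    -- all other shear-free solutions contain a gauge field with negative energy density
    (∀ (S : ShearFree.SpatialFrame) (n : ℕ) (M : ShearFree.Cosmology S n),
      M.IsShearFreeSolution → ¬ M.IsTracelessLRSBianchiIII →
      ∃ i, ∃ x ∈ M.region, M.fieldEMT i 0 0 x < 0) := by
  refine ⟨fun S n M hS hM => hS.isTracelessLRSBianchiIII fun L hL =>
      hM.hasPositiveEnergy.changeFrame L hL,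
    fun S C h₀ n hn hS hC hh htr => ShearFree.exists_shearFreeSolution hn hS hC hh htr,
    ⟨ShearFree.productFrame, ShearFree.adaptedConst 1, 1, ShearFree.productFrame_isBianchi,
      ShearFree.isTypeIII_adaptedConst one_ne_zero, Matrix.PosDef.one, ?_⟩,
    fun p α hp => (ShearFree.hamiltonianBoundedBelow_iff hp α).trans
      (ShearFree.weakEnergyCondition_iff hp α).symm,
    fun S n M hS hM => ?_⟩
  · simpa [Matrix.one_apply] using ShearFree.sum_behrN_adaptedConst 1
  -- If no energy density is negative, every field has a positive prefactor or vanishes, and the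
  -- uniqueness argument applies.
  · by_contra! h
    exact hM (hS.isTracelessLRSBianchiIII fun L hL => (hS.hasPositiveEnergy h).changeFrame L hL)
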